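/- For $N\ge 1$ let $P_N$ denote the probability that a real $N\times N\times 2$ tensor whose entries are independent standard normal (mean $0$, variance $1$) random variables has real rank $N$, where the real rank of a real $m\times n\times p$ tensor $\mathcal T$ is the least $r$ such that $\mathcal T=\sum_{i=1}^r u_i\otimes v_i\otimes w_i$ with $u_i\in\mathbb R^m$, $v_i\in\mathbb R^n$, $w_i\in\mathbb R^p$. Let $\zeta$ be the Riemann zeta function and $A=e^{-\zeta'(-1)+1/12}=1.28242712\ldots$ the Glaisher–Kinkelin constant. Then, as $N\to\infty$, $$P_N=N^{1/12}\Big(\frac e4\Big)^{N^2/4}\cdot A\,e^{-1/6}\,\big(1+O(N^{-1})\big),$$ or equivalently $$\log P_N=\frac{N^2}{4}\log\frac e4+\frac{\log N-1}{12}-\zeta'(-1)+O\Big(\frac1N\Big).$$ -/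

import Mathlib

open MeasureTheory ProbabilityTheory Filter Asymptotics

/-- Real `m × n × p` tensors (3-way arrays), given by their entries. -/
abbrev Tensor3 (m n p : ℕ) : Type := Fin m → Fin n → Fin p → ℝ

/-- `T` is a sum of `r` real rank-one tensors `u ⊗ v ⊗ w`. -/
def IsSumOfRankOne {m n p : ℕ} (T : Tensor3 m n p) (r : ℕ) : Prop :=
  ∃ (u : Fin r → Fin m → ℝ) (v : Fin r → Fin n → ℝ) (w : Fin r → Fin p → ℝ),
    ∀ i j k, T i j k = ∑ a : Fin r, u a i * v a j * w a k

/-- Every tensor is a finite sum of rank-one tensors, so the minimum defining the rank exists. -/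
theorem exists_isSumOfRankOne {m n p : ℕ} (T : Tensor3 m n p) :
    ∃ r, IsSumOfRankOne T r := by
  classical
  let e := Fintype.equivFin (Fin m × Fin n × Fin p)
  refine ⟨Fintype.card (Fin m × Fin n × Fin p),
    fun a i => if i = (e.symm a).1 then T (e.symm a).1 (e.symm a).2.1 (e.symm a).2.2 else 0,
    fun a j => if j = (e.symm a).2.1 then 1 else 0,
    fun a k => if k = (e.symm a).2.2 then 1 else 0, fun i j k => ?_⟩
  rw [Fintype.sum_eq_single (e (i, j, k))]
  · simp
  · intro a ha
    have h : e.symm a ≠ (i, j, k) := fun h => ha (by rw [← h, Equiv.apply_symm_apply])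
    by_cases h1 : i = (e.symm a).1
    · by_cases h2 : j = (e.symm a).2.1
      · by_cases h3 : k = (e.symm a).2.2
        · exact absurd (Prod.ext h1.symm (Prod.ext h2.symm h3.symm)) h
        · simp [h3]
      · simp [h2]
    · simp [h1]

/-- The (real) rank of a real tensor: the least number of rank-one tensors that sum to it. -/
noncomputable def tensorRank {m n p : ℕ} (T : Tensor3 m n p) : ℕ :=
  sInf {r : ℕ | IsSumOfRankOne T r}

/-- The law of a random `m × n × p` tensor with independent standard normal entries. -/
noncomputable def gaussianTensor (m n p : ℕ) : Measure (Tensor3 m n p) :=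
  Measure.pi fun _ => Measure.pi fun _ => Measure.pi fun _ => gaussianReal 0 1

/-- The probability `P_N` that a random Gaussian `N × N × 2` tensor has real rank `N`. -/
noncomputable def rankProb (N : ℕ) : ℝ :=
  (gaussianTensor N N 2).real {T | tensorRank T = N}

/-- The real number `ζ'(-1)`, where `ζ` is the Riemann zeta function. -/
noncomputable def zetaDerivNegOne : ℝ := (deriv riemannZeta (-1)).re

/-- The Glaisher–Kinkelin constant `A = exp (1/12 - ζ'(-1)) = 1.28242712…`. -/
noncomputable def glaisherKinkelin : ℝ := Real.exp (-zetaDerivNegOne + 1 / 12)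

open scoped ENNReal Matrix

/-! Everything follows from the closed form `P_N = Γ((N+1)/2)^N / ∏_{j<N} j!` (`rankProb_eq_gamma`),
whose logarithm is then expanded.

Let `A`, `B` be the two slices. When `A` is invertible, rank `N` means that `A⁻¹B` is diagonalizable
over `ℝ` (`tensorRank_eq_iff`), which almost surely means that it has `N` distinct real eigenvalues.
The matrix `X = A⁻¹B` has density proportional to `det(1 + XᵀX)^(-N)` (`gaussianTensor_quotient`),
so `P_N` is the share of this mass carried by matrices with simple real spectrum.

To integrate over such matrices, the least eigenvalue `x` is split off. Its eigenvector is
normalized to `(1, l)` and replaces the first column as a variable; the Jacobian is `|det(x - Z)|`,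
where `Z` is the deflated block. For orthogonally invariant integrands a rotation removes `l`,
leaving a block triangular matrix whose off-diagonal row is integrated explicitly. Iterating gives
the eigenvalue density `∏ (1 + λᵢ²)^(-(N+1)/2) ∏ |λⱼ - λᵢ|`
(`setLIntegral_simpleSpectrum_eigenvalues`).

Under `λ = tan θ` all cosines cancel and `∏ |sin(θⱼ - θᵢ)|` remains: the circular orthogonal
ensemble in the angles `2θ`. On ordered angles this is, up to a constant, a determinant of
exponentials. De Bruijn's method turns its integral into a Pfaffian, which is block diagonal because
opposite frequencies pair only with each other (`setIntegral_strictMono_prod_sin`). The duplication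
formula collects the constants.

For the asymptotics, `log P_N = N log Γ((N+1)/2) - N log N! + ∑_{k≤N} k log k`. Euler–Maclaurin
approximations of `(s - 1)ζ(s)`, differentiated at `-1`, identify the constant in `∑ k log k` as
`1/12 - ζ'(-1)`. Stirling expansions of the other two terms are needed to error `O(N⁻²)`, because
they are multiplied by `N`. -/

noncomputable instance Matrix.instMeasureSpaceReal {m n : Type*} [Fintype m] [Fintype n] :
    MeasureSpace (Matrix m n ℝ) :=
  inferInstanceAs (MeasureSpace (m → n → ℝ))

instance Matrix.instBorelSpaceReal {m n : Type*} [Fintype m] [Fintype n] :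
    BorelSpace (Matrix m n ℝ) :=
  inferInstanceAs (BorelSpace (m → n → ℝ))

instance Matrix.instSecondCountableReal {m n : Type*} [Fintype m] [Fintype n] :
    SecondCountableTopology (Matrix m n ℝ) :=
  inferInstanceAs (SecondCountableTopology (m → n → ℝ))

instance Matrix.instSigmaFiniteReal {m n : Type*} [Fintype m] [Fintype n] :
    SigmaFinite (volume : Measure (Matrix m n ℝ)) :=
  inferInstanceAs (SigmaFinite (volume : Measure (m → n → ℝ)))

/-! ### Lebesgue integrals over matrices: splitting and linear changes of variable -/

theorem piFinSuccAbove_symm_zero {E : Type*} [MeasurableSpace E] {n : ℕ} (z : E × (Fin n → E)) :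
    (MeasurableEquiv.piFinSuccAbove (fun _ : Fin (n + 1) => E) 0).symm z = Fin.cons z.1 z.2 :=
  Fin.insertNth_zero' z.1 z.2

theorem lintegral_finCons {E : Type*} [MeasureSpace E] [SigmaFinite (volume : Measure E)] {n : ℕ}
    {f : (Fin (n + 1) → E) → ℝ≥0∞} (hf : Measurable f) :
    ∫⁻ v, f v = ∫⁻ a, ∫⁻ w, f (Fin.cons a w : Fin (n + 1) → E) := by
  have h := (volume_preserving_piFinSuccAbove (fun _ : Fin (n + 1) => E) 0).symm
  rw [← h.lintegral_comp hf]
  have hm : Measurable fun z : E × (Fin n → E) =>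
      f ((MeasurableEquiv.piFinSuccAbove (fun _ : Fin (n + 1) => E) 0).symm z) :=
    hf.comp (MeasurableEquiv.measurable _)
  erw [lintegral_prod _ hm.aemeasurable]
  simp only [piFinSuccAbove_symm_zero]

theorem measurable_finCons {E : Type*} [MeasurableSpace E] {n : ℕ} :
    Measurable fun z : E × (Fin n → E) => (Fin.cons z.1 z.2 : Fin (n + 1) → E) := by
  simp only [← piFinSuccAbove_symm_zero]
  exact (MeasurableEquiv.piFinSuccAbove (fun _ : Fin (n + 1) => E) 0).symm.measurable

/-- The square matrix with corner `x`, first row `ξ`, first column `η` and remaining block `Y`. -/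
def bordered {n : ℕ} (x : ℝ) (ξ η : Fin n → ℝ) (Y : Matrix (Fin n) (Fin n) ℝ) :
    Matrix (Fin (n + 1)) (Fin (n + 1)) ℝ :=
  Matrix.of (Fin.cons (Fin.cons x ξ) fun i => Fin.cons (η i) (Y i))

section bordered
variable {n : ℕ} (x : ℝ) (ξ η : Fin n → ℝ) (Y : Matrix (Fin n) (Fin n) ℝ)

@[simp] theorem bordered_zero_zero : bordered x ξ η Y 0 0 = x := rfl
@[simp] theorem bordered_zero_succ (j : Fin n) : bordered x ξ η Y 0 j.succ = ξ j := rfl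
@[simp] theorem bordered_succ_zero (i : Fin n) : bordered x ξ η Y i.succ 0 = η i := rfl
@[simp] theorem bordered_succ_succ (i j : Fin n) : bordered x ξ η Y i.succ j.succ = Y i j := rfl

end bordered

theorem continuous_bordered {n : ℕ} :
    Continuous fun z : ℝ × (Fin n → ℝ) × (Fin n → ℝ) × Matrix (Fin n) (Fin n) ℝ =>
      bordered z.1 z.2.1 z.2.2.1 z.2.2.2 := by
  refine continuous_pi fun i => continuous_pi fun j => ?_
  induction i using Fin.cases <;> induction j using Fin.cases
  · exact continuous_fst
  · simp only [bordered_zero_succ]; fun_prop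
  · simp only [bordered_succ_zero]; fun_prop
  · simp only [bordered_succ_succ]; fun_prop

/-- Fubini for the block splitting. The first column is integrated innermost because it is the
variable later exchanged for an eigenvector. -/
theorem lintegral_bordered {n : ℕ} {G : Matrix (Fin (n + 1)) (Fin (n + 1)) ℝ → ℝ≥0∞}
    (hG : Measurable G) :
    ∫⁻ X, G X = ∫⁻ x, ∫⁻ ξ, ∫⁻ Y, ∫⁻ η, G (bordered x ξ η Y) := by
  have h1 : ∫⁻ X, G X = ∫⁻ a : Fin (n + 1) → ℝ, ∫⁻ w : Fin n → Fin (n + 1) → ℝ,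
      G (Matrix.of (Fin.cons a w)) :=
    lintegral_finCons (E := Fin (n + 1) → ℝ) (f := fun v => G (Matrix.of v)) hG
  have hm1 : Measurable fun z : (Fin (n + 1) → ℝ) × (Fin n → Fin (n + 1) → ℝ) =>
      G (Matrix.of (Fin.cons z.1 z.2)) := hG.comp measurable_finCons
  have h2 : ∀ a : Fin (n + 1) → ℝ, ∫⁻ w : Fin n → Fin (n + 1) → ℝ, G (Matrix.of (Fin.cons a w)) =
      ∫⁻ Y : Matrix (Fin n) (Fin n) ℝ, ∫⁻ η : Fin n → ℝ,
        G (Matrix.of (Fin.cons a fun i => Fin.cons (η i) (Y i))) := by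
    intro a
    have e1 := (volume_preserving_piFinSuccAbove (fun _ : Fin (n + 1) => ℝ) 0).symm
    have e2 := measurePreserving_pi (fun _ : Fin n => (volume : Measure (ℝ × (Fin n → ℝ))))
      (fun _ => (volume : Measure (Fin (n + 1) → ℝ))) fun _ => e1
    have e3 := (volume_measurePreserving_arrowProdEquivProdArrow ℝ (Fin n → ℝ) (Fin n)).symm
    have e4 := e2.comp e3
    have hm : Measurable fun w : Fin n → Fin (n + 1) → ℝ => G (Matrix.of (Fin.cons a w)) :=
      hm1.comp measurable_prodMk_left
    have e5 := e4.lintegral_comp hm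
    refine e5.symm.trans ?_
    have hm2 := hm.comp e4.measurable
    erw [lintegral_prod_symm _ hm2.aemeasurable]
    simp only [Function.comp_def, piFinSuccAbove_symm_zero]
    rfl
  rw [h1]
  simp_rw [h2]
  rw [lintegral_finCons]
  · rfl
  · have hmm : Measurable fun z : ((Fin (n + 1) → ℝ) × Matrix (Fin n) (Fin n) ℝ) × (Fin n → ℝ) =>
        G (Matrix.of (Fin.cons z.1.1 fun i => Fin.cons (z.2 i) (z.1.2 i))) := by
      refine hm1.comp (measurable_fst.fst.prodMk (measurable_pi_lambda _ fun i => ?_))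
      exact measurable_finCons.comp (((measurable_pi_apply i).comp measurable_snd).prodMk
        ((measurable_pi_apply i).comp measurable_fst.snd))
    exact Measurable.lintegral_prod_right' (Measurable.lintegral_prod_right' hmm)

theorem lintegral_vecMul {n : ℕ} {B : Matrix (Fin n) (Fin n) ℝ} (hB : B.det ≠ 0)
    {f : (Fin n → ℝ) → ℝ≥0∞} (hf : Measurable f) :
    ∫⁻ v, f (v ᵥ* B) = ENNReal.ofReal |B.det|⁻¹ * ∫⁻ v, f v := by
  have h := Real.map_matrix_volume_pi_eq_smul_volume_pi (M := Bᵀ) (by simpa using hB)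
  have hm : Measurable (Matrix.toLin' Bᵀ) :=
    (LinearMap.continuous_of_finiteDimensional _).measurable
  have := lintegral_map (μ := volume) hf hm
  rw [h, lintegral_smul_measure] at this
  simpa [Matrix.mulVec_transpose, abs_inv] using this.symm

/-- Right multiplication acts on each row separately, and each of the `m` rows contributes one
factor `|det B|⁻¹`. -/
theorem lintegral_mul_right {m n : ℕ} {B : Matrix (Fin n) (Fin n) ℝ} (hB : B.det ≠ 0)
    {f : Matrix (Fin m) (Fin n) ℝ → ℝ≥0∞} (hf : Measurable f) :
    ∫⁻ X : Matrix (Fin m) (Fin n) ℝ, f (X * B) = ENNReal.ofReal |B.det|⁻¹ ^ m * ∫⁻ X, f X := by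
  have hB' : Continuous fun v : Fin n → ℝ => v ᵥ* B := by fun_prop
  induction m with
  | zero =>
    simp only [pow_zero, one_mul]
    refine lintegral_congr fun X => ?_
    congr 1
    ext i; exact i.elim0
  | succ m ih =>
    have key : ∀ (a : Fin n → ℝ) (w : Fin m → Fin n → ℝ),
        (Matrix.of (Fin.cons a w : Fin (m + 1) → Fin n → ℝ) : Matrix (Fin (m + 1)) (Fin n) ℝ) * B =
          Matrix.of (Fin.cons (a ᵥ* B) ((Matrix.of w : Matrix (Fin m) (Fin n) ℝ) * B) : Fin (m + 1) → Fin n → ℝ) := by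
      intro a w
      ext i j
      induction i using Fin.cases <;> rfl
    have hm1 : Measurable fun z : (Fin n → ℝ) × (Fin m → Fin n → ℝ) =>
      f (Matrix.of (Fin.cons z.1 z.2)) := hf.comp measurable_finCons
    have hfB : Measurable fun X : Matrix (Fin (m + 1)) (Fin n) ℝ => f (X * B) :=
      hf.comp (Continuous.measurable (by fun_prop))
    calc ∫⁻ X : Matrix (Fin (m + 1)) (Fin n) ℝ, f (X * B) = ∫⁻ a : Fin n → ℝ, ∫⁻ w : Fin m → Fin n → ℝ,
          f ((Matrix.of (Fin.cons a w : Fin (m + 1) → Fin n → ℝ) : Matrix (Fin (m + 1)) (Fin n) ℝ) * B) :=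
        lintegral_finCons (E := Fin n → ℝ) (f := fun v => f ((Matrix.of v : Matrix (Fin (m + 1)) (Fin n) ℝ) * B)) hfB
      _ = ∫⁻ a : Fin n → ℝ, ENNReal.ofReal |B.det|⁻¹ ^ m * ∫⁻ w : Fin m → Fin n → ℝ,
          f (Matrix.of (Fin.cons (a ᵥ* B) w : Fin (m + 1) → Fin n → ℝ)) := by
        refine lintegral_congr fun a => ?_
        simp_rw [key]
        exact ih (f := fun w => f (Matrix.of (Fin.cons (a ᵥ* B) w : Fin (m + 1) → Fin n → ℝ)))
          (hm1.comp measurable_prodMk_left)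
      _ = ENNReal.ofReal |B.det|⁻¹ ^ m * (ENNReal.ofReal |B.det|⁻¹ *
            ∫⁻ a : Fin n → ℝ, ∫⁻ w : Fin m → Fin n → ℝ,
          f (Matrix.of (Fin.cons a w : Fin (m + 1) → Fin n → ℝ))) := by
        rw [lintegral_const_mul' _ _ (by finiteness)]
        congr 1
        exact lintegral_vecMul hB (f := fun a => ∫⁻ w : Fin m → Fin n → ℝ,
          f (Matrix.of (Fin.cons a w : Fin (m + 1) → Fin n → ℝ))) hm1.lintegral_prod_right'
      _ = _ := by
        rw [← mul_assoc, ← pow_succ]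
        congr 1
        exact (lintegral_finCons (E := Fin n → ℝ) (f := fun v => f (Matrix.of v)) hf).symm

/-- Transposition is a linear involution, so its determinant is `±1`. -/
theorem lintegral_transpose {n : ℕ} {f : Matrix (Fin n) (Fin n) ℝ → ℝ≥0∞} (hf : Measurable f) :
    ∫⁻ X : Matrix (Fin n) (Fin n) ℝ, f Xᵀ = ∫⁻ X, f X := by
  let T : (Fin n → Fin n → ℝ) →ₗ[ℝ] (Fin n → Fin n → ℝ) :=
    { toFun := fun X i j => X j i, map_add' := fun _ _ => rfl, map_smul' := fun _ _ => rfl }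
  have hTT : T ∘ₗ T = LinearMap.id := rfl
  have hdet : LinearMap.det T * LinearMap.det T = 1 := by
    rw [← LinearMap.det_comp, hTT, LinearMap.det_id]
  have h0 : LinearMap.det T ≠ 0 := by
    intro h; simp [h] at hdet
  have habs : |(LinearMap.det T)⁻¹| = 1 := by
    rcases mul_self_eq_one_iff.1 hdet with h | h <;> simp [h]
  have h := Measure.map_linearMap_addHaar_eq_smul_addHaar
    (volume : Measure (Fin n → Fin n → ℝ)) h0
  rw [habs, ENNReal.ofReal_one, one_smul] at h
  have hm : Measurable T := (LinearMap.continuous_of_finiteDimensional _).measurable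
  have := lintegral_map (μ := (volume : Measure (Fin n → Fin n → ℝ)))
    (f := fun X => f (Matrix.of X)) hf hm
  rw [h] at this
  exact this.symm

theorem lintegral_mul_left {n : ℕ} {A : Matrix (Fin n) (Fin n) ℝ} (hA : A.det ≠ 0)
    {f : Matrix (Fin n) (Fin n) ℝ → ℝ≥0∞} (hf : Measurable f) :
    ∫⁻ X : Matrix (Fin n) (Fin n) ℝ, f (A * X) = ENNReal.ofReal |A.det|⁻¹ ^ n * ∫⁻ X, f X := by
  have ht : Measurable fun X : Matrix (Fin n) (Fin n) ℝ => Xᵀ :=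
    Continuous.measurable (by fun_prop)
  have hm : Measurable fun X : Matrix (Fin n) (Fin n) ℝ => f (A * X) :=
    hf.comp (Continuous.measurable (by fun_prop))
  rw [← lintegral_transpose hm, ← lintegral_transpose hf]
  have := lintegral_mul_right (m := n) (B := Aᵀ) (by simpa using hA) (f := fun X => f Xᵀ)
    (hf.comp ht)
  simpa [Matrix.transpose_mul] using this

/-! ### Zero sets of polynomials -/

/-- Fubini and induction: regarded as a polynomial in the first variable, `p` has a leading
coefficient that is nonzero at almost every value of the others, and there it has finitely many
roots. -/
theorem volume_mvPolynomial_zeros {d : ℕ} {p : MvPolynomial (Fin d) ℝ} (hp : p ≠ 0) :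
    volume {x : Fin d → ℝ | MvPolynomial.eval x p = 0} = 0 := by
  induction d with
  | zero =>
    have : {x : Fin 0 → ℝ | MvPolynomial.eval x p = 0} = ∅ := by
      ext x
      simp only [Set.mem_ofPred_eq, Set.mem_empty_iff_false, iff_false]
      rw [MvPolynomial.eq_C_of_isEmpty p] at hp ⊢
      simpa using hp
    simp [this]
  | succ d ih =>
    set q := MvPolynomial.finSuccEquiv ℝ d p with hq
    have hq0 : q ≠ 0 := by simpa [hq] using hp
    have hms : MeasurableSet {x : Fin (d + 1) → ℝ | MvPolynomial.eval x p = 0} :=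
      (isClosed_eq (MvPolynomial.continuous_eval p) continuous_const).measurableSet
    have hmind : Measurable ({x : Fin (d + 1) → ℝ | MvPolynomial.eval x p = 0}.indicator
      (1 : (Fin (d + 1) → ℝ) → ℝ≥0∞)) := measurable_one.indicator hms
    rw [← lintegral_indicator_one hms, lintegral_finCons hmind]
    have hmz : Measurable fun z : ℝ × (Fin d → ℝ) =>
        {x : Fin (d + 1) → ℝ | MvPolynomial.eval x p = 0}.indicator
          (1 : (Fin (d + 1) → ℝ) → ℝ≥0∞) (Fin.cons z.1 z.2) := hmind.comp measurable_finCons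
    rw [lintegral_lintegral_swap hmz.aemeasurable, lintegral_eq_zero_iff hmz.lintegral_prod_left']
    have hae : ∀ᵐ w : Fin d → ℝ, MvPolynomial.eval w q.leadingCoeff ≠ 0 := by
      rw [ae_iff]
      simpa using ih (p := q.leadingCoeff) (by simpa using hq0)
    filter_upwards [hae] with w hw
    have hqw : q.map (MvPolynomial.eval w) ≠ 0 := by
      intro h
      apply hw
      have := congrArg (fun r => Polynomial.coeff r q.natDegree) h
      simpa [Polynomial.coeff_map] using this
    have hfin : {a : ℝ | (q.map (MvPolynomial.eval w)).eval a = 0}.Finite := by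
      refine (q.map (MvPolynomial.eval w)).roots.toFinset.finite_toSet.subset fun a ha => ?_
      simpa [Polynomial.mem_roots, hqw] using ha
    have : (fun a : ℝ => {x : Fin (d + 1) → ℝ | MvPolynomial.eval x p = 0}.indicator
          (1 : (Fin (d + 1) → ℝ) → ℝ≥0∞) (Fin.cons a w)) =
        {a : ℝ | (q.map (MvPolynomial.eval w)).eval a = 0}.indicator 1 := by
      ext a
      simp only [Set.indicator, Set.mem_ofPred_eq, hq, ← MvPolynomial.eval_eq_eval_mv_eval']
      rfl
    simp only [this, Pi.zero_apply]
    rw [lintegral_indicator_one hfin.measurableSet, hfin.measure_zero]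

/-! ### Integrals of Cauchy type -/

theorem lintegral_rpow_mul_exp_neg_mul {s r : ℝ} (hs : 0 < s) (hr : 0 < r) :
    ∫⁻ t in Set.Ioi (0 : ℝ), ENNReal.ofReal (t ^ (s - 1) * Real.exp (-(r * t))) =
      ENNReal.ofReal (Real.Gamma s * r ^ (-s)) := by
  have h := Real.integral_rpow_mul_exp_neg_mul_Ioi hs hr
  have hne : (1 / r) ^ s * Real.Gamma s ≠ 0 :=
    (mul_pos (Real.rpow_pos_of_pos (by positivity) _) (Real.Gamma_pos_of_pos hs)).ne'
  have hint : IntegrableOn (fun t : ℝ => t ^ (s - 1) * Real.exp (-(r * t))) (Set.Ioi 0) := by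
    by_contra hcon
    rw [integral_undef hcon] at h
    exact hne h.symm
  rw [← ofReal_integral_eq_lintegral_ofReal hint, h, mul_comm, one_div, Real.inv_rpow hr.le,
    Real.rpow_neg hr.le]
  filter_upwards [ae_restrict_mem measurableSet_Ioi] with t ht
  have : (0 : ℝ) < t := ht
  positivity

theorem lintegral_exp_neg_mul_sq {t : ℝ} (ht : 0 < t) :
    ∫⁻ a : ℝ, ENNReal.ofReal (Real.exp (-(t * a ^ 2))) = ENNReal.ofReal (√(Real.pi / t)) := by
  rw [← integral_gaussian, ofReal_integral_eq_lintegral_ofReal (integrable_exp_neg_mul_sq ht)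
    (ae_of_all _ fun _ => (Real.exp_pos _).le)]
  simp only [neg_mul]

/-- The value of `∫ (1 + |x|²)^(-s)` over `ℝ^d`. -/
noncomputable def japaneseConst (d : ℕ) (s : ℝ) : ℝ :=
  Real.pi ^ ((d : ℝ) / 2) * Real.Gamma (s - d / 2) / Real.Gamma s

theorem japaneseConst_pos {d : ℕ} {s : ℝ} (hs : (d : ℝ) / 2 < s) : 0 < japaneseConst d s := by
  have h0 : (0 : ℝ) ≤ d / 2 := by positivity
  exact div_pos (mul_pos (Real.rpow_pos_of_pos Real.pi_pos _)
    (Real.Gamma_pos_of_pos (by linarith))) (Real.Gamma_pos_of_pos (by linarith))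

/-- Writing the power as a Gamma integral in an auxiliary `t` makes the integral over `a` Gaussian;
it yields `√(π/t)`, and a Gamma integral with parameter `s - 1/2` remains. -/
theorem lintegral_add_sq_rpow {s b : ℝ} (hs : 1 / 2 < s) (hb : 0 < b) :
    ∫⁻ a : ℝ, ENNReal.ofReal ((b + a ^ 2) ^ (-s)) =
      ENNReal.ofReal (b ^ (-(s - 1 / 2)) * japaneseConst 1 s) := by
  have hs0 : 0 < s := by linarith
  have hG := Real.Gamma_pos_of_pos hs0
  have hG' := Real.Gamma_pos_of_pos (s := s - 1 / 2) (by linarith)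
  have h1 : ∀ a : ℝ, ENNReal.ofReal ((b + a ^ 2) ^ (-s)) = ENNReal.ofReal (Real.Gamma s)⁻¹ *
      ∫⁻ t in Set.Ioi (0 : ℝ), ENNReal.ofReal (t ^ (s - 1) * Real.exp (-((b + a ^ 2) * t))) := by
    intro a
    rw [lintegral_rpow_mul_exp_neg_mul hs0 (by positivity),
      ← ENNReal.ofReal_mul (by positivity), inv_mul_cancel_left₀ hG.ne']
  simp_rw [h1]
  rw [lintegral_const_mul' _ _ (by finiteness), lintegral_lintegral_swap]
  · have h2 : ∀ t ∈ Set.Ioi (0 : ℝ), ∫⁻ a : ℝ, ENNReal.ofReal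
        (t ^ (s - 1) * Real.exp (-((b + a ^ 2) * t))) =
        ENNReal.ofReal √Real.pi *
          ENNReal.ofReal (t ^ (s - 1 / 2 - 1) * Real.exp (-(b * t))) := by
      intro t ht
      have ht : 0 < t := ht
      have h3 : ∀ a : ℝ, ENNReal.ofReal (t ^ (s - 1) * Real.exp (-((b + a ^ 2) * t))) =
          ENNReal.ofReal (t ^ (s - 1) * Real.exp (-(b * t))) *
            ENNReal.ofReal (Real.exp (-(t * a ^ 2))) := by
        intro a
        rw [← ENNReal.ofReal_mul (by positivity), mul_assoc, ← Real.exp_add]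
        congr 3
        ring_nf
      simp_rw [h3]
      rw [lintegral_const_mul' _ _ (by finiteness), lintegral_exp_neg_mul_sq ht,
        ← ENNReal.ofReal_mul (by positivity), ← ENNReal.ofReal_mul (by positivity)]
      congr 1
      rw [Real.sqrt_div Real.pi_pos.le, show s - 1 / 2 - 1 = (s - 1) - 1 / 2 by ring,
        Real.rpow_sub ht (s - 1), ← Real.sqrt_eq_rpow]
      ring
    rw [setLIntegral_congr_fun measurableSet_Ioi h2, lintegral_const_mul' _ _ (by finiteness),
      lintegral_rpow_mul_exp_neg_mul (by linarith) hb, ← ENNReal.ofReal_mul (by positivity),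
      ← ENNReal.ofReal_mul (by positivity)]
    congr 1
    rw [japaneseConst, Real.sqrt_eq_rpow]
    push_cast
    field_simp
  · refine Measurable.aemeasurable ?_
    refine ENNReal.measurable_ofReal.comp (Measurable.mul ?_ ?_)
    · exact measurable_snd.pow_const _
    · exact Continuous.measurable (by fun_prop)

theorem japaneseConst_succ {d : ℕ} {s : ℝ} (hs : ((d : ℝ) + 1) / 2 < s) :
    japaneseConst d (s - 1 / 2) * japaneseConst 1 s = japaneseConst (d + 1) s := by
  have h0 : (0 : ℝ) ≤ d / 2 := by positivity
  have hG := Real.Gamma_pos_of_pos (s := s - 1 / 2) (by linarith)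
  have hG' := Real.Gamma_pos_of_pos (s := s) (by linarith)
  simp only [japaneseConst]
  push_cast
  rw [add_div, Real.rpow_add Real.pi_pos, show s - 1 / 2 - (d : ℝ) / 2 = s - (d / 2 + 1 / 2) by ring]
  generalize Real.Gamma (s - 1 / 2) = u at hG ⊢
  field_simp

theorem lintegral_add_dotProduct_self_rpow {d : ℕ} {s b : ℝ} (hs : (d : ℝ) / 2 < s) (hb : 0 < b) :
    ∫⁻ x : Fin d → ℝ, ENNReal.ofReal ((b + x ⬝ᵥ x) ^ (-s)) =
      ENNReal.ofReal (b ^ (-(s - d / 2)) * japaneseConst d s) := by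
  induction d generalizing s b with
  | zero =>
    have : (0 : ℝ) < s := by simpa using hs
    have hG := (Real.Gamma_pos_of_pos this).ne'
    simp [dotProduct, japaneseConst, hG, volume_pi]
  | succ d ih =>
    push_cast at hs
    have h0 : (0 : ℝ) ≤ d / 2 := by positivity
    have hm : Measurable fun x : Fin (d + 1) → ℝ => ENNReal.ofReal ((b + x ⬝ᵥ x) ^ (-s)) := by
      refine ENNReal.measurable_ofReal.comp (Measurable.pow_const ?_ _)
      exact Continuous.measurable (by fun_prop)
    have hmc : Measurable fun z : ℝ × (Fin d → ℝ) =>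
        ENNReal.ofReal ((b + (Fin.cons z.1 z.2 : Fin (d + 1) → ℝ) ⬝ᵥ
          (Fin.cons z.1 z.2 : Fin (d + 1) → ℝ)) ^ (-s)) := hm.comp measurable_finCons
    rw [lintegral_finCons hm, lintegral_lintegral_swap hmc.aemeasurable]
    have h1 : ∀ w : Fin d → ℝ, ∫⁻ a : ℝ, ENNReal.ofReal ((b + (Fin.cons a w : Fin (d + 1) → ℝ) ⬝ᵥ
        (Fin.cons a w : Fin (d + 1) → ℝ)) ^ (-s)) =
        ENNReal.ofReal ((b + w ⬝ᵥ w) ^ (-(s - 1 / 2))) * ENNReal.ofReal (japaneseConst 1 s) := by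
      intro w
      have hw : 0 ≤ w ⬝ᵥ w := by
        simpa using dotProduct_star_self_nonneg w
      rw [← ENNReal.ofReal_mul (by positivity),
        ← lintegral_add_sq_rpow (by linarith) (by positivity : 0 < b + w ⬝ᵥ w)]
      refine lintegral_congr fun a => ?_
      congr 2
      simp only [dotProduct, Fin.sum_univ_succ, Fin.cons_zero, Fin.cons_succ]
      ring
    simp_rw [h1]
    rw [lintegral_mul_const' _ _ (by finiteness), ih (by linarith) hb,
      ← ENNReal.ofReal_mul' (japaneseConst_pos (by push_cast; linarith)).le, mul_assoc,
      japaneseConst_succ (by linarith)]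
    congr 3
    push_cast
    ring

theorem Matrix.PosDef.exists_mul_transpose {n : ℕ} {W : Matrix (Fin n) (Fin n) ℝ} (hW : W.PosDef) :
    ∃ C : Matrix (Fin n) (Fin n) ℝ, C.det ≠ 0 ∧ W = C * Cᵀ := by
  open scoped MatrixOrder in
  obtain ⟨B, hB⟩ := CStarAlgebra.nonneg_iff_eq_star_mul_self.mp hW.posSemidef.nonneg
  rw [Matrix.star_eq_conjTranspose, Matrix.conjTranspose_eq_transpose_of_trivial] at hB
  refine ⟨Bᵀ, fun h => ?_, by simpa using hB⟩
  have := hW.det_pos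
  rw [hB, Matrix.det_mul, h, zero_mul] at this
  exact this.false

theorem Matrix.det_add_vecMulVec_self {n : ℕ} {W : Matrix (Fin n) (Fin n) ℝ} (hW : W.det ≠ 0)
    (v : Fin n → ℝ) :
    (W + Matrix.vecMulVec v v).det = W.det * (1 + v ᵥ* W⁻¹ ⬝ᵥ v) := by
  rw [Matrix.vecMulVec_eq Unit, Matrix.det_add_replicateCol_mul_replicateRow hW.isUnit]
  congr 1
  simp [Matrix.det_unique, Matrix.mul_apply, dotProduct, Matrix.vecMul]

theorem Matrix.PosDef.add_vecMulVec_self {n : ℕ} {W : Matrix (Fin n) (Fin n) ℝ} (hW : W.PosDef)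
    (v : Fin n → ℝ) : (W + Matrix.vecMulVec v v).PosDef := by
  refine hW.add_posSemidef ?_
  simpa using Matrix.posSemidef_vecMulVec_self_star v

theorem Matrix.PosDef.quadratic_inv {n : ℕ} {W C : Matrix (Fin n) (Fin n) ℝ} (hC : W⁻¹ = C * Cᵀ)
    (v : Fin n → ℝ) : v ᵥ* W⁻¹ ⬝ᵥ v = (v ᵥ* C) ⬝ᵥ (v ᵥ* C) := by
  rw [hC, ← Matrix.vecMul_vecMul, Matrix.vecMul_transpose, dotProduct_comm,
    Matrix.dotProduct_mulVec]

/-- Integrating a rank-one perturbation of a positive definite quadratic form. -/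
theorem lintegral_add_quadratic_rpow {n : ℕ} {W : Matrix (Fin n) (Fin n) ℝ} (hW : W.PosDef)
    {s b : ℝ} (hs : (n : ℝ) / 2 < s) (hb : 0 < b) :
    ∫⁻ v : Fin n → ℝ, ENNReal.ofReal ((b + v ᵥ* W⁻¹ ⬝ᵥ v) ^ (-s)) =
      ENNReal.ofReal (W.det ^ (1 / 2 : ℝ) * (b ^ (-(s - n / 2)) * japaneseConst n s)) := by
  obtain ⟨C, hC, hWC⟩ := hW.inv.exists_mul_transpose
  have hWp := hW.det_pos
  simp_rw [Matrix.PosDef.quadratic_inv hWC]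
  have hm : Measurable fun x : Fin n → ℝ => ENNReal.ofReal ((b + x ⬝ᵥ x) ^ (-s)) := by
    refine ENNReal.measurable_ofReal.comp (Measurable.pow_const ?_ _)
    exact Continuous.measurable (by fun_prop)
  rw [lintegral_vecMul hC hm, lintegral_add_dotProduct_self_rpow hs hb,
    ← ENNReal.ofReal_mul (by positivity)]
  congr 2
  have h1 : W.det⁻¹ = |C.det| ^ 2 := by
    have := congrArg Matrix.det hWC
    rw [Matrix.det_nonsing_inv, Matrix.det_mul, Matrix.det_transpose, Ring.inverse_eq_inv'] at this
    rw [this, sq_abs, sq]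
  have h2 : W.det = (|C.det|⁻¹) ^ 2 := by rw [inv_pow, ← h1, inv_inv]
  rw [h2, ← Real.sqrt_eq_rpow, Real.sqrt_sq (by positivity)]

/-- The matrix determinant lemma reduces this to `lintegral_add_quadratic_rpow` with `b = 1`; the
factor `det W ^ (1/2)` is the Jacobian that straightens the quadratic form. -/
theorem lintegral_det_add_vecMulVec_rpow {n : ℕ} {W : Matrix (Fin n) (Fin n) ℝ} (hW : W.PosDef)
    {s : ℝ} (hs : (n : ℝ) / 2 < s) :
    ∫⁻ v : Fin n → ℝ, ENNReal.ofReal ((W + Matrix.vecMulVec v v).det ^ (-s)) =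
      ENNReal.ofReal (W.det ^ (-(s - 1 / 2)) * japaneseConst n s) := by
  have hWp := hW.det_pos
  have h1 : ∀ v : Fin n → ℝ, ENNReal.ofReal ((W + Matrix.vecMulVec v v).det ^ (-s)) =
      ENNReal.ofReal (W.det ^ (-s)) * ENNReal.ofReal ((1 + v ᵥ* W⁻¹ ⬝ᵥ v) ^ (-s)) := by
    intro v
    have hq : 0 ≤ v ᵥ* W⁻¹ ⬝ᵥ v := by
      obtain ⟨C, -, hC⟩ := hW.inv.exists_mul_transpose
      rw [Matrix.PosDef.quadratic_inv hC]
      simpa using dotProduct_star_self_nonneg (v ᵥ* C)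
    rw [Matrix.det_add_vecMulVec_self hWp.ne', Real.mul_rpow hWp.le (by positivity),
      ENNReal.ofReal_mul (by positivity)]
  simp_rw [h1]
  rw [lintegral_const_mul' _ _ (by finiteness), lintegral_add_quadratic_rpow hW hs one_pos,
    ← ENNReal.ofReal_mul (by positivity), Real.one_rpow, one_mul, ← mul_assoc,
    ← Real.rpow_add hWp]
  congr 3
  ring

theorem transpose_mul_self_finCons {k n : ℕ} (a : Fin n → ℝ) (w : Fin k → Fin n → ℝ) :
    (Matrix.of (Fin.cons a w : Fin (k + 1) → Fin n → ℝ) : Matrix (Fin (k + 1)) (Fin n) ℝ)ᵀ *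
        (Matrix.of (Fin.cons a w : Fin (k + 1) → Fin n → ℝ) : Matrix (Fin (k + 1)) (Fin n) ℝ) =
      Matrix.vecMulVec a a + (Matrix.of w : Matrix (Fin k) (Fin n) ℝ)ᵀ *
        (Matrix.of w : Matrix (Fin k) (Fin n) ℝ) := by
  ext i j
  simp [Matrix.mul_apply, Fin.sum_univ_succ, Matrix.vecMulVec_apply]

/-- Each row of `X` adds a rank-one term to `W`, and integrating it out raises the exponent of the
determinant by `1/2`. The case `W = 1`, `k = n = s` normalizes the density of the matrix quotient.
-/
theorem lintegral_det_add_transpose_mul_self_rpow {k n : ℕ} {W : Matrix (Fin n) (Fin n) ℝ}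
    (hW : W.PosDef) {s : ℝ} (hs : ((n : ℝ) + k) / 2 < s + 1 / 2) :
    ∫⁻ X : Matrix (Fin k) (Fin n) ℝ, ENNReal.ofReal ((W + Xᵀ * X).det ^ (-s)) =
      ENNReal.ofReal (W.det ^ (-(s - k / 2)) *
        ∏ j ∈ Finset.range k, japaneseConst n (s - j / 2)) := by
  induction k generalizing W with
  | zero =>
    have : ∀ X : Matrix (Fin 0) (Fin n) ℝ, Xᵀ * X = 0 := fun X => by ext; simp [Matrix.mul_apply]
    simp only [this]
    change ∫⁻ _ : Fin 0 → Fin n → ℝ, _ = _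
    simp [volume_pi]
  | succ k ih =>
    push_cast at hs
    have hm : Measurable fun X : Fin (k + 1) → Fin n → ℝ =>
        ENNReal.ofReal ((W + (Matrix.of X)ᵀ * Matrix.of X).det ^ (-s)) := by
      refine ENNReal.measurable_ofReal.comp (Measurable.pow_const ?_ _)
      exact Continuous.measurable (by fun_prop)
    have hp : 0 ≤ ∏ j ∈ Finset.range k, japaneseConst n (s - j / 2) := by
      refine Finset.prod_nonneg fun j hj => (japaneseConst_pos ?_).le
      have : (j : ℝ) + 1 ≤ k := by exact_mod_cast Finset.mem_range.1 hj
      linarith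
    refine (lintegral_finCons (E := Fin n → ℝ) hm).trans ?_
    have h1 : ∀ a : Fin n → ℝ, ∫⁻ w : Fin k → Fin n → ℝ, ENNReal.ofReal
        ((W + (Matrix.of (Fin.cons a w : Fin (k + 1) → Fin n → ℝ) :
            Matrix (Fin (k + 1)) (Fin n) ℝ)ᵀ *
          (Matrix.of (Fin.cons a w : Fin (k + 1) → Fin n → ℝ) :
            Matrix (Fin (k + 1)) (Fin n) ℝ)).det ^ (-s)) =
        ENNReal.ofReal ((W + Matrix.vecMulVec a a).det ^ (-(s - k / 2))) *
        ENNReal.ofReal (∏ j ∈ Finset.range k, japaneseConst n (s - j / 2)) := by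
      intro a
      simp_rw [transpose_mul_self_finCons, ← add_assoc]
      rw [← ENNReal.ofReal_mul' hp, ← ih (hW.add_vecMulVec_self a) (by linarith)]
      rfl
    simp_rw [h1]
    rw [lintegral_mul_const' _ _ (by finiteness),
      lintegral_det_add_vecMulVec_rpow hW (by linarith), ← ENNReal.ofReal_mul' hp,
      Finset.prod_range_succ, mul_assoc, mul_comm (japaneseConst n _)]
    congr 3
    push_cast
    ring

/-! ### Generic matrices -/

theorem volume_matrix_mvPolynomial_zeros {m n : ℕ} {p : MvPolynomial (Fin m × Fin n) ℝ}
    (hp : p ≠ 0) :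
    volume {X : Matrix (Fin m) (Fin n) ℝ | MvPolynomial.eval (fun i => X i.1 i.2) p = 0} = 0 := by
  let e : Fin m × Fin n ≃ Fin (m * n) := finProdFinEquiv
  let L : (Fin (m * n) → ℝ) ≃ₗ[ℝ] (Fin m → Fin n → ℝ) :=
    (LinearEquiv.funCongrLeft ℝ ℝ e).trans (LinearEquiv.curry ℝ ℝ (Fin m) (Fin n))
  let T := L.toContinuousLinearEquiv
  have hT : (Measure.map T (volume : Measure (Fin (m * n) → ℝ))).IsAddHaarMeasure :=
    T.isAddHaarMeasure_map volume
  -- Uniqueness of Haar measure: proportionality to the transported measure is enough for null sets.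
  have hvol := Measure.isAddLeftInvariant_eq_smul
    (volume : Measure (Fin m → Fin n → ℝ)) (Measure.map T volume)
  change (volume : Measure (Fin m → Fin n → ℝ))
    {X : Fin m → Fin n → ℝ | MvPolynomial.eval (fun i : Fin m × Fin n => X i.1 i.2) p = 0} = 0
  have hcont : Continuous fun X : Fin m → Fin n → ℝ =>
      MvPolynomial.eval (fun i : Fin m × Fin n => X i.1 i.2) p :=
    (MvPolynomial.continuous_eval p).comp (by fun_prop)
  have hms : MeasurableSet {X : Fin m → Fin n → ℝ |
      MvPolynomial.eval (fun i : Fin m × Fin n => X i.1 i.2) p = 0} :=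
    (isClosed_eq hcont continuous_const).measurableSet
  rw [hvol, Measure.smul_apply, Measure.map_apply T.continuous.measurable hms]
  have hq : MvPolynomial.rename e p ≠ 0 := by
    intro h
    exact hp (MvPolynomial.rename_injective e e.injective (by simpa using h))
  have := volume_mvPolynomial_zeros hq
  simp only [MvPolynomial.eval_rename] at this
  rw [smul_eq_zero]
  exact Or.inr this

theorem ae_det_ne_zero (n : ℕ) : ∀ᵐ X : Matrix (Fin n) (Fin n) ℝ, X.det ≠ 0 := by
  rw [ae_iff]
  have := volume_matrix_mvPolynomial_zeros (Matrix.det_mvPolynomialX_ne_zero (Fin n) ℝ)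
  simp only [Matrix.eval_det_mvPolynomialX] at this
  simp only [not_not]
  exact this

/-- The rows `e₀ᵀ X ^ k` for `k ≤ n`. -/
def observability {R : Type*} [Semiring R] {n : ℕ} (X : Matrix (Fin (n + 1)) (Fin (n + 1)) R) :
    Matrix (Fin (n + 1)) (Fin (n + 1)) R :=
  Matrix.of fun k j => (X ^ (k : ℕ)) 0 j

/-- The determinant is a polynomial in the entries of `X`. It is not the zero polynomial, because
for the shift matrix the rows `e₀ᵀ S ^ k` are the standard basis. -/
theorem ae_det_observability_ne_zero (n : ℕ) :
    ∀ᵐ X : Matrix (Fin (n + 1)) (Fin (n + 1)) ℝ, (observability X).det ≠ 0 := by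
  have heval : ∀ X : Matrix (Fin (n + 1)) (Fin (n + 1)) ℝ,
      MvPolynomial.eval (fun i : Fin (n + 1) × Fin (n + 1) => X i.1 i.2)
        (observability (Matrix.mvPolynomialX (Fin (n + 1)) (Fin (n + 1)) ℝ)).det =
      (observability X).det := by
    intro X
    rw [RingHom.map_det]
    congr 1
    ext k j
    have h1 := Matrix.mvPolynomialX_mapMatrix_eval X
    have h2 := congrArg (fun M => (M ^ (k : ℕ)) 0 j) h1
    simp only [← map_pow] at h2
    simpa [observability] using h2
  have hne : (observability (Matrix.mvPolynomialX (Fin (n + 1)) (Fin (n + 1)) ℝ)).det ≠ 0 := by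
    intro h0
    let S : Matrix (Fin (n + 1)) (Fin (n + 1)) ℝ :=
      Matrix.of fun i j => if (j : ℕ) = i + 1 then 1 else 0
    have hS : ∀ k : ℕ, ∀ j : Fin (n + 1), (S ^ k) 0 j = if (j : ℕ) = k then 1 else 0 := by
      intro k
      induction k with
      | zero =>
        intro j
        rw [pow_zero, Matrix.one_apply]
        refine if_congr ?_ rfl rfl
        rw [Fin.ext_iff, eq_comm]; rfl
      | succ k ih =>
        intro j
        rw [pow_succ, Matrix.mul_apply]
        simp only [ih, S, Matrix.of_apply]
        by_cases hk : k < n + 1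
        · rw [Finset.sum_eq_single ⟨k, hk⟩]
          · simp
          · intro b _ hb
            have : (b : ℕ) ≠ k := fun h => hb (Fin.ext h)
            simp [this]
          · simp
        · rw [Finset.sum_eq_zero]
          · have : (j : ℕ) ≠ k + 1 := by omega
            simp [this]
          · intro b _
            have : (b : ℕ) ≠ k := by omega
            simp [this]
    have h1 := heval S
    have h2 : observability S = 1 := by
      ext k j
      rw [observability, Matrix.of_apply, hS, Matrix.one_apply]
      refine if_congr ?_ rfl rfl
      rw [Fin.ext_iff, eq_comm]
    rw [h0, map_zero, h2, Matrix.det_one] at h1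
    exact zero_ne_one h1
  rw [ae_iff]
  have := volume_matrix_mvPolynomial_zeros hne
  simp only [heval] at this
  simpa using this

/-- If `v 0 = 0`, then every `e₀ᵀ X ^ k v = c ^ k * v 0` vanishes and `v` lies in the kernel of the
observability matrix. Hence eigenvectors can be scaled to the form `(1, l)`. -/
theorem apply_zero_ne_zero_of_observability {n : ℕ} {X : Matrix (Fin (n + 1)) (Fin (n + 1)) ℝ}
    (hX : (observability X).det ≠ 0) {v : Fin (n + 1) → ℝ} (hv : v ≠ 0) {c : ℝ}
    (hc : X *ᵥ v = c • v) : v 0 ≠ 0 := by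
  intro h0
  apply hX
  refine Matrix.exists_mulVec_eq_zero_iff.1 ⟨v, hv, ?_⟩
  have hpow : ∀ k : ℕ, (X ^ k) *ᵥ v = c ^ k • v := by
    intro k
    induction k with
    | zero => simp
    | succ k ih =>
      rw [pow_succ, ← Matrix.mulVec_mulVec, hc, Matrix.mulVec_smul, ih, smul_smul, pow_succ,
        mul_comm]
  ext k
  have := congrFun (hpow k) 0
  simpa [h0, observability, Matrix.mulVec] using this

/-! ### Simple real spectrum and measurability of the eigenvalues -/

/-- `X` is diagonalizable over `ℝ`. -/
def IsRealDiagonalizable {n : ℕ} (X : Matrix (Fin n) (Fin n) ℝ) : Prop :=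
  ∃ (P : Matrix (Fin n) (Fin n) ℝ) (d : Fin n → ℝ), P.det ≠ 0 ∧ X * P = P * Matrix.diagonal d

/-- `l` lists the roots of the characteristic polynomial of `X`. -/
def HasSpectrum {n : ℕ} (X : Matrix (Fin n) (Fin n) ℝ) (l : Fin n → ℝ) : Prop :=
  ∀ t : ℝ, (t • (1 : Matrix (Fin n) (Fin n) ℝ) - X).det = ∏ i, (t - l i)

/-- The matrices with `n` distinct real eigenvalues. -/
def simpleSpectrum (n : ℕ) : Set (Matrix (Fin n) (Fin n) ℝ) :=
  {X | ∃ l : Fin n → ℝ, StrictMono l ∧ HasSpectrum X l}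

theorem HasSpectrum.det_eq_zero {n : ℕ} {X : Matrix (Fin n) (Fin n) ℝ} {l : Fin n → ℝ}
    (h : HasSpectrum X l) (i : Fin n) :
    (l i • (1 : Matrix (Fin n) (Fin n) ℝ) - X).det = 0 := by
  rw [h, Finset.prod_eq_zero (Finset.mem_univ i) (sub_self _)]

theorem HasSpectrum.of_mul_eq {n : ℕ} {X P : Matrix (Fin n) (Fin n) ℝ} {d : Fin n → ℝ}
    (hP : P.det ≠ 0) (h : X * P = P * Matrix.diagonal d) : HasSpectrum X d := by
  intro t
  have h1 : (t • (1 : Matrix (Fin n) (Fin n) ℝ) - X) * P =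
      P * Matrix.diagonal fun i => t - d i := by
    have h2 : (Matrix.diagonal fun i => t - d i) =
        t • (1 : Matrix (Fin n) (Fin n) ℝ) - Matrix.diagonal d := by
      ext i j
      by_cases hij : i = j
      · subst hij; simp
      · simp [hij]
    rw [h2, Matrix.sub_mul, Matrix.mul_sub, h]
    simp
  have h3 := congrArg Matrix.det h1
  rw [Matrix.det_mul, Matrix.det_mul, Matrix.det_diagonal, mul_comm] at h3
  exact mul_left_cancel₀ hP h3

theorem HasSpectrum.exists_eigenvector {n : ℕ} {X : Matrix (Fin n) (Fin n) ℝ} {l : Fin n → ℝ}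
    (h : HasSpectrum X l) (i : Fin n) : ∃ v : Fin n → ℝ, v ≠ 0 ∧ X *ᵥ v = l i • v := by
  obtain ⟨v, hv, hv'⟩ := Matrix.exists_mulVec_eq_zero_iff.2 (h.det_eq_zero i)
  refine ⟨v, hv, ?_⟩
  rw [Matrix.sub_mulVec, sub_eq_zero] at hv'
  rw [← hv', Matrix.smul_mulVec, Matrix.one_mulVec]

theorem HasSpectrum.exists_eq_of_eigenvector {n : ℕ} {X : Matrix (Fin n) (Fin n) ℝ}
    {l : Fin n → ℝ} (h : HasSpectrum X l) {v : Fin n → ℝ} (hv : v ≠ 0) {c : ℝ}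
    (hc : X *ᵥ v = c • v) : ∃ i, l i = c := by
  have h0 : (c • (1 : Matrix (Fin n) (Fin n) ℝ) - X).det = 0 :=
    Matrix.exists_mulVec_eq_zero_iff.1 ⟨v, hv, by
      rw [Matrix.sub_mulVec, hc, Matrix.smul_mulVec, Matrix.one_mulVec, sub_self]⟩
  rw [h, Finset.prod_eq_zero_iff] at h0
  obtain ⟨i, -, hi⟩ := h0
  exact ⟨i, (sub_eq_zero.1 hi).symm⟩

theorem isRealDiagonalizable_of_mem_simpleSpectrum {n : ℕ} {X : Matrix (Fin n) (Fin n) ℝ}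
    (hX : X ∈ simpleSpectrum n) : IsRealDiagonalizable X := by
  obtain ⟨l, hl, hs⟩ := hX
  choose v hv0 hv using fun i => hs.exists_eigenvector i
  have hli : LinearIndependent ℝ v := by
    refine Module.End.eigenvectors_linearIndependent' (Matrix.toLin' X) l hl.injective v fun i => ?_
    exact Module.End.hasEigenvector_iff.2
      ⟨Module.End.mem_eigenspace_iff.2 (by simpa using hv i), hv0 i⟩
  refine ⟨(Matrix.of v)ᵀ, l, ?_, ?_⟩
  · have h1 : LinearIndependent ℝ (Matrix.of v).row := hli
    have h2 := Matrix.linearIndependent_rows_iff_isUnit.1 h1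
    rw [Matrix.det_transpose]
    exact ((Matrix.isUnit_iff_isUnit_det _).1 h2).ne_zero
  · ext i j
    have := congrFun (hv j) i
    simpa [Matrix.mul_apply, Matrix.mulVec, dotProduct, Matrix.diagonal_apply, mul_comm] using this

/-- A repeated eigenvalue would have two independent eigenvectors, and some combination of them
would have coordinate `0` equal to zero, which observability forbids. -/
theorem mem_simpleSpectrum_of_isRealDiagonalizable {n : ℕ}
    {X : Matrix (Fin (n + 1)) (Fin (n + 1)) ℝ} (hobs : (observability X).det ≠ 0)
    (hX : IsRealDiagonalizable X) : X ∈ simpleSpectrum (n + 1) := by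
  obtain ⟨P, d, hP, h⟩ := hX
  have hcol : ∀ j, X *ᵥ (fun i => P i j) = d j • fun i => P i j := by
    intro j
    ext i
    have := congrFun (congrFun h i) j
    simpa [Matrix.mul_apply, Matrix.mulVec, dotProduct, Matrix.diagonal_apply, mul_comm] using this
  have hinj : Function.Injective d := by
    intro j k hjk
    by_contra hne
    -- The combination of columns `j` and `k` in which coordinate `0` cancels.
    set v : Fin (n + 1) → ℝ := P *ᵥ (Pi.single j (P 0 k) - Pi.single k (P 0 j)) with hv
    have hP0 : P 0 k ≠ 0 := by
      refine apply_zero_ne_zero_of_observability hobs (v := fun i => P i k) (fun h0 => hP ?_)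
        (hcol k)
      exact Matrix.det_eq_zero_of_column_eq_zero k fun i => congrFun h0 i
    have hv0 : v ≠ 0 := by
      intro h0
      have h1 : (Pi.single j (P 0 k) - Pi.single k (P 0 j) : Fin (n + 1) → ℝ) = 0 := by
        by_contra h2
        exact hP (Matrix.exists_mulVec_eq_zero_iff.1 ⟨_, h2, h0⟩)
      have h3 := congrFun h1 j
      simp [hne] at h3
      exact hP0 h3
    have hvX : X *ᵥ v = d j • v := by
      rw [hv, Matrix.mulVec_mulVec, h, ← Matrix.mulVec_mulVec, ← Matrix.mulVec_smul]
      congr 1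
      ext i
      simp only [Matrix.mulVec_diagonal, Pi.sub_apply, Pi.smul_apply, smul_eq_mul]
      by_cases hij : i = j
      · simp [hij]
      · by_cases hik : i = k
        · simp [hik, hjk]
        · simp [hij, hik]
    refine apply_zero_ne_zero_of_observability hobs hv0 hvX ?_
    simp [hv, Matrix.mulVec_sub, mul_comm]
  have hs := HasSpectrum.of_mul_eq hP h
  have hcard : (Finset.univ.image d).card = n + 1 := by
    rw [Finset.card_image_of_injective _ hinj, Finset.card_univ, Fintype.card_fin]
  refine ⟨(Finset.univ.image d).orderEmbOfFin hcard, OrderEmbedding.strictMono _, fun t => ?_⟩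
  rw [hs t]
  have h1 : ∏ i, (t - (Finset.univ.image d).orderEmbOfFin hcard i) =
      ∏ x ∈ Finset.univ.image d, (t - x) := by
    have := Finset.image_orderEmbOfFin_univ (Finset.univ.image d) hcard
    conv_rhs => rw [← this]
    rw [Finset.prod_image fun a _ b _ hab => (OrderEmbedding.strictMono _).injective hab]
  rw [h1, Finset.prod_image fun a _ b _ hab => hinj hab]

theorem eq_of_strictMono_of_prod_eq {n : ℕ} {l m : Fin n → ℝ} (hl : StrictMono l)
    (hm : StrictMono m) (h : ∀ k : ℕ, ∏ i, ((k : ℝ) - l i) = ∏ i, ((k : ℝ) - m i)) : l = m := by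
  have hpoly : (∏ i, (Polynomial.X - Polynomial.C (l i))) =
      ∏ i, (Polynomial.X - Polynomial.C (m i)) := by
    refine Polynomial.eq_of_infinite_eval_eq _ _ ?_
    refine (Set.infinite_range_of_injective (Nat.cast_injective (R := ℝ))).mono ?_
    rintro _ ⟨k, rfl⟩
    simpa [Polynomial.eval_prod] using h k
  refine (hl.range_inj hm).1 ?_
  have hroot : ∀ l : Fin n → ℝ, Set.range l =
      {t | (∏ i, (Polynomial.X - Polynomial.C (l i))).eval t = 0} := by
    intro l
    ext t
    simp only [Polynomial.eval_prod, Polynomial.eval_sub, Polynomial.eval_X, Polynomial.eval_C,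
      Set.mem_range, Set.mem_ofPred_eq, Finset.prod_eq_zero_iff, Finset.mem_univ, true_and,
      sub_eq_zero]
    exact ⟨fun ⟨i, hi⟩ => ⟨i, hi.symm⟩, fun ⟨i, hi⟩ => ⟨i, hi.symm⟩⟩
  rw [hroot, hroot, hpoly]

theorem hasSpectrum_of_natCast {n : ℕ} {X : Matrix (Fin n) (Fin n) ℝ} {l : Fin n → ℝ}
    (h : ∀ k : ℕ, ((k : ℝ) • (1 : Matrix (Fin n) (Fin n) ℝ) - X).det = ∏ i, ((k : ℝ) - l i)) :
    HasSpectrum X l := by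
  have hev : ∀ t : ℝ, X.charpoly.eval t = (t • (1 : Matrix (Fin n) (Fin n) ℝ) - X).det := by
    intro t
    rw [Matrix.eval_charpoly]
    simp [Matrix.smul_one_eq_diagonal]
  have hpoly : X.charpoly = ∏ i, (Polynomial.X - Polynomial.C (l i)) := by
    refine Polynomial.eq_of_infinite_eval_eq _ _ ?_
    refine (Set.infinite_range_of_injective (Nat.cast_injective (R := ℝ))).mono ?_
    rintro _ ⟨k, rfl⟩
    simpa [Polynomial.eval_prod, hev] using h k
  intro t
  rw [← hev, hpoly]
  simp [Polynomial.eval_prod]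

theorem measurableSet_strictMono (n : ℕ) : MeasurableSet {l : Fin n → ℝ | StrictMono l} := by
  have : {l : Fin n → ℝ | StrictMono l} = ⋂ i, ⋂ j, ⋂ (_ : i < j), {l : Fin n → ℝ | l i < l j} := by
    ext l; simp [StrictMono]
  rw [this]
  exact MeasurableSet.iInter fun i => MeasurableSet.iInter fun j => MeasurableSet.iInter fun _ =>
    measurableSet_lt (measurable_pi_apply i) (measurable_pi_apply j)

/-- Lusin–Souslin: `φ`, the values of the monic polynomial with roots `l` at the natural numbers, is
continuous and injective on increasing lists, hence a measurable embedding there. Both claims follow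
by comparing it with the values `ψ` of the characteristic polynomial. Countably many sample points
suffice to determine a polynomial, so the target can be `ℕ → ℝ`. -/
theorem measurableSet_simpleSpectrum_and_exists_eigenvalues (n : ℕ) :
    MeasurableSet (simpleSpectrum n) ∧ ∃ ev : Matrix (Fin n) (Fin n) ℝ → Fin n → ℝ,
      Measurable ev ∧ ∀ X ∈ simpleSpectrum n, StrictMono (ev X) ∧ HasSpectrum X (ev X) := by
  let O : Set (Fin n → ℝ) := {l | StrictMono l}
  let φ : (Fin n → ℝ) → ℕ → ℝ := fun l k => ∏ i, ((k : ℝ) - l i)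
  let ψ : Matrix (Fin n) (Fin n) ℝ → ℕ → ℝ :=
    fun X k => ((k : ℝ) • (1 : Matrix (Fin n) (Fin n) ℝ) - X).det
  have hφ : Continuous φ := by
    refine continuous_pi fun k => ?_
    exact continuous_finsetProd _ fun i _ => continuous_const.sub (continuous_apply i)
  have hψ : Continuous ψ := by
    refine continuous_pi fun k => ?_
    exact Continuous.matrix_det (by fun_prop)
  have hemb : MeasurableEmbedding (O.domRestrict φ) := by
    refine ContinuousOn.measurableEmbedding (measurableSet_strictMono n) hφ.continuousOn ?_
    intro l hl m hm h
    exact eq_of_strictMono_of_prod_eq hl hm fun k => congrFun h k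
  have hspec : ∀ X l, HasSpectrum X l ↔ ψ X = φ l :=
    fun X l => ⟨fun h => funext fun k => h k, fun h => hasSpectrum_of_natCast fun k => congrFun h k⟩
  constructor
  · have : simpleSpectrum n = ψ ⁻¹' Set.range (O.domRestrict φ) := by
      ext X
      constructor
      · rintro ⟨l, hl, h⟩
        exact ⟨⟨l, hl⟩, ((hspec X l).1 h).symm⟩
      · rintro ⟨⟨l, hl⟩, h⟩
        exact ⟨l, hl, (hspec X l).2 h.symm⟩
    rw [this]
    exact hψ.measurable hemb.measurableSet_range
  · obtain ⟨g, hg, hgφ⟩ := hemb.exists_measurable_extend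
      (measurable_subtype_coe : Measurable ((↑) : O → Fin n → ℝ)) fun _ => inferInstance
    refine ⟨g ∘ ψ, hg.comp hψ.measurable, ?_⟩
    rintro X ⟨l, hl, h⟩
    have h1 : g (ψ X) = l := by
      rw [(hspec X l).1 h]
      exact congrFun hgφ ⟨l, hl⟩
    rw [Function.comp_apply, h1]
    exact ⟨hl, h⟩

theorem measurableSet_simpleSpectrum (n : ℕ) : MeasurableSet (simpleSpectrum n) :=
  (measurableSet_simpleSpectrum_and_exists_eigenvalues n).1

/-- The increasing list of eigenvalues of a matrix in `simpleSpectrum n`. -/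
noncomputable def orderedEigenvalues {n : ℕ} : Matrix (Fin n) (Fin n) ℝ → Fin n → ℝ :=
  (measurableSet_simpleSpectrum_and_exists_eigenvalues n).2.choose

theorem measurable_orderedEigenvalues {n : ℕ} :
    Measurable (orderedEigenvalues : Matrix (Fin n) (Fin n) ℝ → Fin n → ℝ) :=
  (measurableSet_simpleSpectrum_and_exists_eigenvalues n).2.choose_spec.1

theorem strictMono_orderedEigenvalues {n : ℕ} {X : Matrix (Fin n) (Fin n) ℝ}
    (hX : X ∈ simpleSpectrum n) : StrictMono (orderedEigenvalues X) :=
  ((measurableSet_simpleSpectrum_and_exists_eigenvalues n).2.choose_spec.2 X hX).1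

theorem hasSpectrum_orderedEigenvalues {n : ℕ} {X : Matrix (Fin n) (Fin n) ℝ}
    (hX : X ∈ simpleSpectrum n) : HasSpectrum X (orderedEigenvalues X) :=
  ((measurableSet_simpleSpectrum_and_exists_eigenvalues n).2.choose_spec.2 X hX).2

theorem HasSpectrum.orderedEigenvalues_eq {n : ℕ} {X : Matrix (Fin n) (Fin n) ℝ} {l : Fin n → ℝ}
    (hl : StrictMono l) (h : HasSpectrum X l) : orderedEigenvalues X = l := by
  have hX : X ∈ simpleSpectrum n := ⟨l, hl, h⟩
  refine eq_of_strictMono_of_prod_eq (strictMono_orderedEigenvalues hX) hl fun k => ?_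
  rw [← h, hasSpectrum_orderedEigenvalues hX]

theorem ae_isRealDiagonalizable_iff (n : ℕ) : ∀ᵐ X : Matrix (Fin n) (Fin n) ℝ,
    IsRealDiagonalizable X ↔ X ∈ simpleSpectrum n := by
  cases n with
  | zero =>
    refine ae_of_all _ fun X => ⟨fun _ => ⟨0, Subsingleton.strictMono _, fun t => ?_⟩, fun h =>
      isRealDiagonalizable_of_mem_simpleSpectrum h⟩
    simp
  | succ n =>
    filter_upwards [ae_det_observability_ne_zero n] with X hX
    exact ⟨mem_simpleSpectrum_of_isRealDiagonalizable hX,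
      isRealDiagonalizable_of_mem_simpleSpectrum⟩

/-! ### Tensor rank and diagonalizability of the quotient of the slices -/

/-- The frontal slices of a tensor. -/
def tensorSlice {m n p : ℕ} (T : Tensor3 m n p) (k : Fin p) : Matrix (Fin m) (Fin n) ℝ :=
  Matrix.of fun i j => T i j k

theorem isSumOfRankOne_iff {N r : ℕ} (T : Tensor3 N N 2) :
    IsSumOfRankOne T r ↔ ∃ (U : Matrix (Fin N) (Fin r) ℝ) (V : Matrix (Fin r) (Fin N) ℝ)
      (c : Fin 2 → Fin r → ℝ), ∀ k, tensorSlice T k = U * Matrix.diagonal (c k) * V := by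
  constructor
  · rintro ⟨u, v, w, h⟩
    refine ⟨(Matrix.of u)ᵀ, Matrix.of v, fun k a => w a k, fun k => ?_⟩
    ext i j
    rw [Matrix.mul_apply]
    simp only [tensorSlice, Matrix.of_apply, h, Matrix.mul_diagonal, Matrix.transpose_apply]
    exact Finset.sum_congr rfl fun a _ => by ring
  · rintro ⟨U, V, c, h⟩
    refine ⟨fun a i => U i a, fun a j => V a j, fun a k => c k a, fun i j k => ?_⟩
    have := congrFun (congrFun (h k) i) j
    rw [Matrix.mul_apply] at this
    simp only [tensorSlice, Matrix.of_apply, Matrix.mul_diagonal] at this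
    rw [this]
    exact Finset.sum_congr rfl fun a _ => by ring

/-- Invertibility of the first slice forces rank at least `N`. A decomposition of length `N` writes
the slices as `U D₀ V` and `U D₁ V` with all factors of the first invertible, so the quotient is
`V⁻¹ D₀⁻¹ D₁ V`. Conversely, an eigenbasis `P` gives the factors `A P` and `P⁻¹` with weights `1`
and `d`. -/
theorem tensorRank_eq_iff {N : ℕ} {T : Tensor3 N N 2} (hA : (tensorSlice T 0).det ≠ 0) :
    tensorRank T = N ↔ IsRealDiagonalizable ((tensorSlice T 0)⁻¹ * tensorSlice T 1) := by
  have hAu : IsUnit (tensorSlice T 0).det := hA.isUnit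
  have hle : ∀ r, IsSumOfRankOne T r → N ≤ r := by
    intro r hr
    obtain ⟨U, V, c, h⟩ := (isSumOfRankOne_iff T).1 hr
    have h1 := Matrix.rank_of_isUnit _ ((Matrix.isUnit_iff_isUnit_det _).2 hAu)
    rw [h 0, Fintype.card_fin] at h1
    have h2 := Matrix.rank_mul_le_right (U * Matrix.diagonal (c 0)) V
    have h3 := V.rank_le_card_height
    rw [Fintype.card_fin] at h3
    omega
  have hrank : tensorRank T = N ↔ IsSumOfRankOne T N := by
    constructor
    · intro h
      have : IsSumOfRankOne T (sInf {r | IsSumOfRankOne T r}) :=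
        Nat.sInf_mem (s := {r | IsSumOfRankOne T r}) (exists_isSumOfRankOne T)
      have h' : sInf {r | IsSumOfRankOne T r} = N := h
      generalize sInf {r | IsSumOfRankOne T r} = r at this h'
      subst r
      exact this
    · intro h
      exact le_antisymm (Nat.sInf_le h)
        (hle _ (Nat.sInf_mem (s := {r | IsSumOfRankOne T r}) (exists_isSumOfRankOne T)))
  rw [hrank, isSumOfRankOne_iff]
  constructor
  · rintro ⟨U, V, c, h⟩
    have hdet := hA
    rw [h 0, Matrix.det_mul, Matrix.det_mul, Matrix.det_diagonal] at hdet
    have hV : V.det ≠ 0 := right_ne_zero_of_mul hdet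
    have hc : ∀ a, c 0 a ≠ 0 := fun a =>
      Finset.prod_ne_zero_iff.1 (right_ne_zero_of_mul (left_ne_zero_of_mul hdet)) a
        (Finset.mem_univ a)
    refine ⟨V⁻¹, fun a => c 1 a / c 0 a, ?_, ?_⟩
    · rw [Matrix.det_nonsing_inv, Ring.inverse_eq_inv']
      exact inv_ne_zero hV
    · have h1 : tensorSlice T 1 * V⁻¹ = tensorSlice T 0 *
          (V⁻¹ * Matrix.diagonal fun a => c 1 a / c 0 a) := by
        rw [h 0, h 1, ← Matrix.mul_assoc,
          Matrix.mul_nonsing_inv_cancel_right _ _ hV.isUnit,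
          Matrix.mul_nonsing_inv_cancel_right _ _ hV.isUnit, Matrix.mul_assoc,
          Matrix.diagonal_mul_diagonal]
        congr 2
        ext a
        field_simp [hc a]
      rw [Matrix.mul_assoc, h1, Matrix.nonsing_inv_mul_cancel_left _ _ hAu]
  · rintro ⟨P, d, hP, h⟩
    refine ⟨tensorSlice T 0 * P, P⁻¹, ![1, d], fun k => ?_⟩
    fin_cases k
    · simp [Matrix.mul_nonsing_inv_cancel_right _ _ hP.isUnit]
    · simp only [Fin.mk_one, Matrix.cons_val_one, Matrix.cons_val_fin_one]
      rw [Matrix.mul_assoc _ P, ← h, Matrix.mul_assoc _ _ P⁻¹,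
        Matrix.mul_nonsing_inv_cancel_right _ _ hP.isUnit, Matrix.mul_nonsing_inv_cancel_left _ _ hAu]

/-! ### Deflation: exchanging a column for an eigenvector -/

instance Matrix.instIsAddLeftInvariantReal {m n : Type*} [Fintype m] [Fintype n] :
    (volume : Measure (Matrix m n ℝ)).IsAddLeftInvariant :=
  inferInstanceAs ((volume : Measure (m → n → ℝ)).IsAddLeftInvariant)

section bordered
variable {n : ℕ} (x x' : ℝ) (ξ ξ' η η' : Fin n → ℝ) (Y Y' : Matrix (Fin n) (Fin n) ℝ)

theorem bordered_mul : bordered x ξ η Y * bordered x' ξ' η' Y' =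
    bordered (x * x' + ξ ⬝ᵥ η') (x • ξ' + ξ ᵥ* Y') (x' • η + Y *ᵥ η')
      (Matrix.vecMulVec η ξ' + Y * Y') := by
  ext i j
  induction i using Fin.cases <;> induction j using Fin.cases <;>
    simp [Matrix.mul_apply, Fin.sum_univ_succ, dotProduct, Matrix.vecMul, Matrix.mulVec,
      Matrix.vecMulVec_apply, mul_comm]

theorem bordered_mulVec (a : ℝ) (v : Fin n → ℝ) : bordered x ξ η Y *ᵥ (Fin.cons a v : Fin (n + 1) → ℝ) =
    (Fin.cons (x * a + ξ ⬝ᵥ v) (a • η + Y *ᵥ v) : Fin (n + 1) → ℝ) := by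
  ext i
  induction i using Fin.cases <;>
    simp [Matrix.mulVec, dotProduct, Fin.sum_univ_succ, mul_comm]

theorem bordered_transpose : (bordered x ξ η Y)ᵀ = bordered x η ξ Yᵀ := by
  ext i j
  induction i using Fin.cases <;> induction j using Fin.cases <;> simp

theorem bordered_one : bordered 1 0 0 (1 : Matrix (Fin n) (Fin n) ℝ) = 1 := by
  ext i j
  induction i using Fin.cases <;> induction j using Fin.cases <;>
    simp [Matrix.one_apply, Fin.succ_ne_zero, (Fin.succ_ne_zero _).symm]

theorem smul_one_sub_bordered (t : ℝ) :
    t • (1 : Matrix (Fin (n + 1)) (Fin (n + 1)) ℝ) - bordered x ξ η Y =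
      bordered (t - x) (-ξ) (-η) (t • 1 - Y) := by
  rw [← bordered_one]
  ext i j
  induction i using Fin.cases <;> induction j using Fin.cases <;> simp

theorem det_bordered_zero_col : (bordered x ξ 0 Y).det = x * Y.det := by
  have h : (bordered x ξ 0 Y).submatrix Fin.succ Fin.succ = Y := by
    ext i j; simp
  rw [Matrix.det_succ_column_zero, Fin.sum_univ_succ]
  simp [h]

theorem det_bordered_zero_row : (bordered x 0 η Y).det = x * Y.det := by
  rw [← Matrix.det_transpose, bordered_transpose, det_bordered_zero_col, Matrix.det_transpose]

end bordered

theorem HasSpectrum.of_semiconj {n : ℕ} {X S P : Matrix (Fin n) (Fin n) ℝ} {l : Fin n → ℝ}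
    (hP : P.det ≠ 0) (h : X * P = P * S) : HasSpectrum X l ↔ HasSpectrum S l := by
  have key : ∀ t : ℝ, (t • (1 : Matrix (Fin n) (Fin n) ℝ) - X).det =
      (t • (1 : Matrix (Fin n) (Fin n) ℝ) - S).det := by
    intro t
    have h1 : (t • (1 : Matrix (Fin n) (Fin n) ℝ) - X) * P =
        P * (t • (1 : Matrix (Fin n) (Fin n) ℝ) - S) := by
      rw [Matrix.sub_mul, Matrix.mul_sub, h]
      simp
    have h3 := congrArg Matrix.det h1
    rw [Matrix.det_mul, Matrix.det_mul, mul_comm] at h3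
    exact mul_left_cancel₀ hP h3
  simp only [HasSpectrum, key]

theorem hasSpectrum_bordered_iff {n : ℕ} {x : ℝ} {ξ : Fin n → ℝ} {Y : Matrix (Fin n) (Fin n) ℝ}
    {l : Fin n → ℝ} : HasSpectrum (bordered x ξ 0 Y) (Fin.cons x l) ↔ HasSpectrum Y l := by
  simp only [HasSpectrum, smul_one_sub_bordered, neg_zero, det_bordered_zero_col, Fin.prod_univ_succ,
    Fin.cons_zero, Fin.cons_succ]
  refine ⟨fun h => hasSpectrum_of_natCast fun k => ?_, fun h t => by rw [h]⟩
  -- The common factor `t - x` cancels only for `t ≠ x`; continuity supplies the missing point.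
  have hcont : ∀ f g : ℝ → ℝ, Continuous f → Continuous g → (∀ t ≠ x, f t = g t) → ∀ t, f t = g t := by
    intro f g hf hg hfg
    have : f = g := by
      refine Continuous.ext_on (s := {x}ᶜ) (dense_compl_singleton x) hf hg ?_
      intro t ht
      exact hfg t ht
    exact congrFun this
  refine hcont (fun t => (t • (1 : Matrix (Fin n) (Fin n) ℝ) - Y).det) (fun t => ∏ i, (t - l i)) ?_ ?_
    (fun t ht => mul_left_cancel₀ (sub_ne_zero.2 ht) (h t)) k
  · exact Continuous.matrix_det (by fun_prop)
  · fun_prop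

/-- Pairs of a matrix with simple real spectrum and a real number below that spectrum. -/
def belowSpectrum (n : ℕ) : Set (ℝ × Matrix (Fin n) (Fin n) ℝ) :=
  {z | z.2 ∈ simpleSpectrum n ∧ ∀ i, z.1 < orderedEigenvalues z.2 i}

theorem measurableSet_belowSpectrum (n : ℕ) : MeasurableSet (belowSpectrum n) := by
  have : belowSpectrum n = (Prod.snd ⁻¹' simpleSpectrum n) ∩
      ⋂ i, {z | z.1 < orderedEigenvalues z.2 i} := by
    ext z; simp [belowSpectrum]
  rw [this]
  refine (measurable_snd (measurableSet_simpleSpectrum n)).inter (MeasurableSet.iInter fun i => ?_)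
  exact measurableSet_lt measurable_fst
    ((measurable_pi_apply i).comp (measurable_orderedEigenvalues.comp measurable_snd))

theorem strictMono_finCons {n : ℕ} {x : ℝ} {l : Fin n → ℝ} :
    StrictMono (Fin.cons x l : Fin (n + 1) → ℝ) ↔ StrictMono l ∧ ∀ i, x < l i := by
  constructor
  · intro h
    refine ⟨fun i j hij => ?_, fun i => ?_⟩
    · simpa using h (Fin.succ_lt_succ_iff.2 hij)
    · simpa using h (Fin.succ_pos i)
  · rintro ⟨h1, h2⟩ i j hij
    induction i using Fin.cases with
    | zero =>
      induction j using Fin.cases with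
      | zero => exact absurd hij (lt_irrefl _)
      | succ j => simpa using h2 j
    | succ i =>
      induction j using Fin.cases with
      | zero => exact absurd hij (Fin.not_lt_zero _)
      | succ j => simpa using h1 (Fin.succ_lt_succ_iff.1 hij)

theorem bordered_zero_spectrum {n : ℕ} {x : ℝ} (ξ : Fin n → ℝ) {Y : Matrix (Fin n) (Fin n) ℝ}
    (h : (x, Y) ∈ belowSpectrum n) : bordered x ξ 0 Y ∈ simpleSpectrum (n + 1) ∧
      orderedEigenvalues (bordered x ξ 0 Y) = Fin.cons x (orderedEigenvalues Y) := by
  have h1 : StrictMono (Fin.cons x (orderedEigenvalues Y) : Fin (n + 1) → ℝ) :=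
    strictMono_finCons.2 ⟨strictMono_orderedEigenvalues h.1, h.2⟩
  have h2 := (hasSpectrum_bordered_iff (x := x) (ξ := ξ)).2 (hasSpectrum_orderedEigenvalues h.1)
  exact ⟨⟨_, h1, h2⟩, h2.orderedEigenvalues_eq h1⟩

theorem simpleSpectrum_congr {n : ℕ} {X S P : Matrix (Fin n) (Fin n) ℝ} (hP : P.det ≠ 0)
    (h : X * P = P * S) : X ∈ simpleSpectrum n ↔ S ∈ simpleSpectrum n := by
  simp only [simpleSpectrum, Set.mem_ofPred_eq, HasSpectrum.of_semiconj hP h]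

theorem orderedEigenvalues_congr {n : ℕ} {X S P : Matrix (Fin n) (Fin n) ℝ} (hP : P.det ≠ 0)
    (h : X * P = P * S) (hS : S ∈ simpleSpectrum n) :
    orderedEigenvalues X = orderedEigenvalues S :=
  HasSpectrum.orderedEigenvalues_eq (strictMono_orderedEigenvalues hS)
    ((HasSpectrum.of_semiconj hP h).2 (hasSpectrum_orderedEigenvalues hS))

/-- The matrix with eigenvector `(1, l)` for the eigenvalue `x`, first row determined by `α`,
which induces `Z` on the quotient by that eigenvector. -/
def inflate {n : ℕ} (l : Fin n → ℝ) (x : ℝ) (α : Fin n → ℝ) (Z : Matrix (Fin n) (Fin n) ℝ) :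
    Matrix (Fin (n + 1)) (Fin (n + 1)) ℝ :=
  bordered (x - α ⬝ᵥ l) α (x • l - (Z + Matrix.vecMulVec l α) *ᵥ l) (Z + Matrix.vecMulVec l α)

theorem inflate_mul {n : ℕ} (l : Fin n → ℝ) (x : ℝ) (α : Fin n → ℝ)
    (Z : Matrix (Fin n) (Fin n) ℝ) :
    inflate l x α Z * bordered 1 0 l 1 = bordered 1 0 l 1 * bordered x α 0 Z := by
  rw [inflate, bordered_mul, bordered_mul]
  congr 1
  · simp
  · simp
  · simp
  · simp [add_comm]

theorem det_bordered_one_zero {n : ℕ} (l : Fin n → ℝ) :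
    (bordered 1 0 l (1 : Matrix (Fin n) (Fin n) ℝ)).det = 1 := by
  simp [det_bordered_zero_row]

theorem inflate_spectrum {n : ℕ} (l : Fin n → ℝ) {x : ℝ} (α : Fin n → ℝ)
    {Z : Matrix (Fin n) (Fin n) ℝ} (h : (x, Z) ∈ belowSpectrum n) :
    inflate l x α Z ∈ simpleSpectrum (n + 1) ∧
      orderedEigenvalues (inflate l x α Z) = Fin.cons x (orderedEigenvalues Z) := by
  have h1 := bordered_zero_spectrum α h
  have hd : (bordered 1 0 l (1 : Matrix (Fin n) (Fin n) ℝ)).det ≠ 0 := by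
    rw [det_bordered_one_zero]; exact one_ne_zero
  have h2 := inflate_mul l x α Z
  exact ⟨(simpleSpectrum_congr hd h2).2 h1.1, (orderedEigenvalues_congr hd h2 h1.1).trans h1.2⟩

/-- The first column of a matrix with corner `x`, first row `ξ` and remaining block `Y` which
makes `(1, l)` an eigenvector. -/
def columnOfEigenvector {n : ℕ} (x : ℝ) (ξ : Fin n → ℝ) (Y : Matrix (Fin n) (Fin n) ℝ)
    (l : Fin n → ℝ) : Fin n → ℝ :=
  (x + ξ ⬝ᵥ l) • l - Y *ᵥ l

theorem bordered_columnOfEigenvector {n : ℕ} (x : ℝ) (ξ : Fin n → ℝ)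
    (Y : Matrix (Fin n) (Fin n) ℝ) (l : Fin n → ℝ) :
    bordered x ξ (columnOfEigenvector x ξ Y l) Y =
      inflate l (x + ξ ⬝ᵥ l) ξ (Y - Matrix.vecMulVec l ξ) := by
  simp [inflate, columnOfEigenvector]

/-- The derivative is the eigenvalue `x + ξ ⬝ᵥ l` minus the deflated block. Its determinant is
therefore the product of the differences between this eigenvalue and the others, and this is where
the Vandermonde factor arises. -/
theorem hasFDerivAt_columnOfEigenvector {n : ℕ} (x : ℝ) (ξ : Fin n → ℝ)
    (Y : Matrix (Fin n) (Fin n) ℝ) (l : Fin n → ℝ) :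
    HasFDerivAt (columnOfEigenvector x ξ Y)
      (LinearMap.toContinuousLinearMap (Matrix.toLin'
        ((x + ξ ⬝ᵥ l) • (1 : Matrix (Fin n) (Fin n) ℝ) - (Y - Matrix.vecMulVec l ξ)))) l := by
  let φ : (Fin n → ℝ) →L[ℝ] ℝ := LinearMap.toContinuousLinearMap
    { toFun := fun h => ξ ⬝ᵥ h, map_add' := fun a b => dotProduct_add ξ a b,
      map_smul' := fun c a => dotProduct_smul c ξ a }
  have h1 : HasFDerivAt (fun l => x + ξ ⬝ᵥ l) φ l := (φ.hasFDerivAt (x := l)).const_add x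
  have h2 := h1.smul (hasFDerivAt_id (𝕜 := ℝ) l)
  have h3 := (LinearMap.toContinuousLinearMap (Matrix.toLin' Y)).hasFDerivAt (x := l)
  refine (h2.sub h3).congr_fderiv ?_
  ext1 h
  change (x + ξ ⬝ᵥ l) • h + (ξ ⬝ᵥ h) • l - Y *ᵥ h = _
  simp only [LinearMap.coe_toContinuousLinearMap', Matrix.toLin'_apply, Matrix.sub_mulVec,
    Matrix.smul_mulVec, Matrix.one_mulVec]
  have : Matrix.vecMulVec l ξ *ᵥ h = (ξ ⬝ᵥ h) • l := by
    ext i; simp [Matrix.vecMulVec_mulVec, mul_comm]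
  rw [this]
  abel

/-- If `l` and `m` give the same column, then `(1, l)` and `(1, m)` are eigenvectors of one matrix
for its least eigenvalue. If they differed, `l - m` would be an eigenvector of the deflated block
for that eigenvalue, which lies strictly below the spectrum of the block. -/
theorem injOn_columnOfEigenvector {n : ℕ} (x : ℝ) (ξ : Fin n → ℝ) (Y : Matrix (Fin n) (Fin n) ℝ) :
    Set.InjOn (columnOfEigenvector x ξ Y)
      {l | (x + ξ ⬝ᵥ l, Y - Matrix.vecMulVec l ξ) ∈ belowSpectrum n} := by
  intro l hl m hm h
  have hl' := inflate_spectrum l ξ hl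
  have hm' := inflate_spectrum m ξ hm
  rw [← bordered_columnOfEigenvector] at hl' hm'
  rw [← h] at hm'
  have hx : x + ξ ⬝ᵥ l = x + ξ ⬝ᵥ m := by
    have := congrFun (hl'.2.symm.trans hm'.2) 0
    simpa using this
  by_contra hne
  have hu : l - m ≠ 0 := sub_ne_zero.2 hne
  have hξu : ξ ⬝ᵥ (l - m) = 0 := by rw [dotProduct_sub]; linarith
  have hYu : Y *ᵥ (l - m) = (x + ξ ⬝ᵥ l) • (l - m) := by
    simp only [columnOfEigenvector] at h
    rw [Matrix.mulVec_sub, smul_sub]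
    nth_rewrite 2 [hx]
    have h1 := sub_eq_zero.2 h
    rw [eq_comm, ← sub_eq_zero, ← h1]
    abel
  have hZ : (Y - Matrix.vecMulVec l ξ) *ᵥ (l - m) = (x + ξ ⬝ᵥ l) • (l - m) := by
    rw [Matrix.sub_mulVec, hYu, Matrix.vecMulVec_mulVec, hξu]
    simp
  obtain ⟨i, hi⟩ := (hasSpectrum_orderedEigenvalues hl.1).exists_eq_of_eigenvector hu hZ
  exact (hl.2 i).ne' hi

/-- The eigenvector of the least eigenvalue has nonzero first coordinate by observability; scaled to
`(1, l)`, it provides `l`. -/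
theorem exists_columnOfEigenvector_eq {n : ℕ} {x : ℝ} {ξ η : Fin n → ℝ}
    {Y : Matrix (Fin n) (Fin n) ℝ} (hX : bordered x ξ η Y ∈ simpleSpectrum (n + 1))
    (hobs : (observability (bordered x ξ η Y)).det ≠ 0) :
    ∃ l, (x + ξ ⬝ᵥ l, Y - Matrix.vecMulVec l ξ) ∈ belowSpectrum n ∧
      columnOfEigenvector x ξ Y l = η := by
  set e := orderedEigenvalues (bordered x ξ η Y) with he
  have hs := hasSpectrum_orderedEigenvalues hX
  obtain ⟨v, hv, hv'⟩ := hs.exists_eigenvector 0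
  rw [← he] at hv'
  have hv0 := apply_zero_ne_zero_of_observability hobs hv hv'
  set l : Fin n → ℝ := fun i => (v 0)⁻¹ * v i.succ with hl
  have hvl : v = v 0 • (Fin.cons 1 l : Fin (n + 1) → ℝ) := by
    ext i
    induction i using Fin.cases with
    | zero => simp
    | succ i => simp [hl, hv0]
  have h1 : bordered x ξ η Y *ᵥ (Fin.cons 1 l : Fin (n + 1) → ℝ) =
      e 0 • (Fin.cons 1 l : Fin (n + 1) → ℝ) := by
    rw [hvl, Matrix.mulVec_smul, smul_comm] at hv'
    exact smul_right_injective _ hv0 hv'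
  rw [bordered_mulVec] at h1
  have hx : x + ξ ⬝ᵥ l = e 0 := by simpa using congrFun h1 0
  have hη : η + Y *ᵥ l = e 0 • l := by
    ext i
    simpa using congrFun h1 i.succ
  have hcol : columnOfEigenvector x ξ Y l = η := by
    rw [columnOfEigenvector, hx, ← hη]; abel
  refine ⟨l, ?_, hcol⟩
  have h2 := bordered_columnOfEigenvector x ξ Y l
  rw [hcol] at h2
  have hd : (bordered 1 0 l (1 : Matrix (Fin n) (Fin n) ℝ)).det ≠ 0 := by
    rw [det_bordered_one_zero]; exact one_ne_zero
  have h3 := inflate_mul l (x + ξ ⬝ᵥ l) ξ (Y - Matrix.vecMulVec l ξ)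
  rw [← h2] at h3
  have hcons : e = Fin.cons (x + ξ ⬝ᵥ l) (Fin.tail e) := by
    rw [hx, Fin.cons_self_tail]
  have h4 := (HasSpectrum.of_semiconj hd h3).1 hs
  rw [← he, hcons, hasSpectrum_bordered_iff] at h4
  have hmono := strictMono_orderedEigenvalues hX
  rw [← he, hcons, strictMono_finCons] at hmono
  refine ⟨⟨_, hmono.1, h4⟩, ?_⟩
  change ∀ i, x + ξ ⬝ᵥ l < orderedEigenvalues (Y - Matrix.vecMulVec l ξ) i
  rw [h4.orderedEigenvalues_eq hmono.1]
  exact hmono.2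

section swap
variable {α β γ δ : Type*} [MeasurableSpace α] [MeasurableSpace β] [MeasurableSpace γ]
  [MeasurableSpace δ] {μ : Measure α} {ν : Measure β} {ρ : Measure γ} {τ : Measure δ}
  [SFinite μ] [SFinite ν] [SFinite ρ] [SFinite τ]

theorem lintegral_rotate_three {f : α × β × γ → ℝ≥0∞} (hf : Measurable f) :
    ∫⁻ a, ∫⁻ b, ∫⁻ c, f (a, b, c) ∂ρ ∂ν ∂μ = ∫⁻ b, ∫⁻ c, ∫⁻ a, f (a, b, c) ∂μ ∂ρ ∂ν := by
  have h1 : Measurable fun p : (α × β) × γ => f (p.1.1, p.1.2, p.2) := hf.comp (by fun_prop)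
  rw [lintegral_lintegral_swap h1.lintegral_prod_right'.aemeasurable]
  refine lintegral_congr fun b => ?_
  have h2 : Measurable fun p : α × γ => f (p.1, b, p.2) := hf.comp (by fun_prop)
  rw [lintegral_lintegral_swap h2.aemeasurable]

theorem lintegral_swap_four {f : α × β × γ × δ → ℝ≥0∞} (hf : Measurable f) :
    ∫⁻ a, ∫⁻ b, ∫⁻ c, ∫⁻ d, f (a, b, c, d) ∂τ ∂ρ ∂ν ∂μ =
      ∫⁻ d, ∫⁻ b, ∫⁻ a, ∫⁻ c, f (a, b, c, d) ∂ρ ∂μ ∂ν ∂τ := by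
  have h1 : ∀ a, ∫⁻ b, ∫⁻ c, ∫⁻ d, f (a, b, c, d) ∂τ ∂ρ ∂ν =
      ∫⁻ d, ∫⁻ b, ∫⁻ c, f (a, b, c, d) ∂ρ ∂ν ∂τ := by
    intro a
    have h2 : Measurable fun p : δ × β × γ => f (a, p.2.1, p.2.2, p.1) := hf.comp (by fun_prop)
    exact (lintegral_rotate_three (μ := τ) (ν := ν) (ρ := ρ) h2).symm
  simp_rw [h1]
  have h3 : Measurable fun p : (α × δ) × β × γ => f (p.1.1, p.2.1, p.2.2, p.1.2) :=
    hf.comp (by fun_prop)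
  have h3' : Measurable fun p : ((α × δ) × β) × γ => f (p.1.1.1, p.1.2, p.2, p.1.1.2) :=
    hf.comp (by fun_prop)
  rw [lintegral_lintegral_swap
    (h3'.lintegral_prod_right'.lintegral_prod_right').aemeasurable]
  refine lintegral_congr fun d => ?_
  have h4 : Measurable fun p : (α × β) × γ => f (p.1.1, p.1.2, p.2, d) := hf.comp (by fun_prop)
  rw [lintegral_lintegral_swap h4.lintegral_prod_right'.aemeasurable]

end swap

theorem measurable_det {n : ℕ} : Measurable fun X : Matrix (Fin n) (Fin n) ℝ => X.det :=
  Continuous.measurable (Continuous.matrix_det continuous_id)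

theorem continuous_inflate {n : ℕ} :
    Continuous fun z : (Fin n → ℝ) × ℝ × (Fin n → ℝ) × Matrix (Fin n) (Fin n) ℝ =>
      inflate z.1 z.2.1 z.2.2.1 z.2.2.2 := by
  have h : Continuous fun z : (Fin n → ℝ) × ℝ × (Fin n → ℝ) × Matrix (Fin n) (Fin n) ℝ =>
      (z.2.1 - z.2.2.1 ⬝ᵥ z.1, z.2.2.1,
        z.2.1 • z.1 - (z.2.2.2 + Matrix.vecMulVec z.1 z.2.2.1) *ᵥ z.1,
        z.2.2.2 + Matrix.vecMulVec z.1 z.2.2.1) := by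
    have : Continuous fun z : (Fin n → ℝ) × ℝ × (Fin n → ℝ) × Matrix (Fin n) (Fin n) ℝ =>
        Matrix.vecMulVec z.1 z.2.2.1 := by
      refine continuous_pi fun i => continuous_pi fun j => ?_
      simp only [Matrix.vecMulVec_apply]
      fun_prop
    fun_prop
  exact continuous_bordered.comp h

/-- The weight `|det (x - Z)|` restricted to `x` below the spectrum of `Z`. -/
noncomputable def deflationWeight {n : ℕ} (x : ℝ) (Z : Matrix (Fin n) (Fin n) ℝ) : ℝ≥0∞ :=
  (belowSpectrum n).indicator
    (fun z => ENNReal.ofReal |(z.1 • (1 : Matrix (Fin n) (Fin n) ℝ) - z.2).det|) (x, Z)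

theorem measurable_deflationWeight {n : ℕ} :
    Measurable fun z : ℝ × Matrix (Fin n) (Fin n) ℝ => deflationWeight z.1 z.2 := by
  refine Measurable.indicator ?_ (measurableSet_belowSpectrum n)
  refine ENNReal.measurable_ofReal.comp (Continuous.measurable ?_)
  exact (Continuous.matrix_det (by fun_prop)).abs

theorem lintegral_columnOfEigenvector {n : ℕ} (x : ℝ) (ξ : Fin n → ℝ)
    (Y : Matrix (Fin n) (Fin n) ℝ) (G : Matrix (Fin (n + 1)) (Fin (n + 1)) ℝ → ℝ≥0∞) :
    ∫⁻ η in columnOfEigenvector x ξ Y ''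
        {l | (x + ξ ⬝ᵥ l, Y - Matrix.vecMulVec l ξ) ∈ belowSpectrum n}, G (bordered x ξ η Y) =
      ∫⁻ l, deflationWeight (x + ξ ⬝ᵥ l) (Y - Matrix.vecMulVec l ξ) *
        G (inflate l (x + ξ ⬝ᵥ l) ξ (Y - Matrix.vecMulVec l ξ)) := by
  have hcont : Continuous fun l : Fin n → ℝ => (x + ξ ⬝ᵥ l, Y - Matrix.vecMulVec l ξ) := by
    have : Continuous fun l : Fin n → ℝ => Matrix.vecMulVec l ξ := by
      refine continuous_pi fun i => continuous_pi fun j => ?_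
      simp only [Matrix.vecMulVec_apply]
      fun_prop
    fun_prop
  have hs : MeasurableSet {l | (x + ξ ⬝ᵥ l, Y - Matrix.vecMulVec l ξ) ∈ belowSpectrum n} :=
    hcont.measurable (measurableSet_belowSpectrum n)
  rw [lintegral_image_eq_lintegral_abs_det_fderiv_mul volume hs
    (fun l _ => (hasFDerivAt_columnOfEigenvector x ξ Y l).hasFDerivWithinAt)
    (injOn_columnOfEigenvector x ξ Y), ← lintegral_indicator hs]
  refine lintegral_congr fun l => ?_
  by_cases hl : (x + ξ ⬝ᵥ l, Y - Matrix.vecMulVec l ξ) ∈ belowSpectrum n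
  · rw [Set.indicator_of_mem (by exact hl), bordered_columnOfEigenvector, deflationWeight,
      Set.indicator_of_mem hl, ContinuousLinearMap.det, LinearMap.coe_toContinuousLinearMap,
      LinearMap.det_toLin']
  · rw [Set.indicator_of_notMem (by exact hl), deflationWeight, Set.indicator_of_notMem hl,
      zero_mul]

/-- For fixed corner, row and block, the column is exchanged for `l`. With `l` made the outermost
variable, the passage to the eigenvalue `x + ξ ⬝ᵥ l` and to the deflated block `Y - l ξᵀ` is a
translation and leaves Lebesgue measure unchanged. -/
theorem setLIntegral_simpleSpectrum_succ {n : ℕ}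
    {G : Matrix (Fin (n + 1)) (Fin (n + 1)) ℝ → ℝ≥0∞} (hG : Measurable G) :
    ∫⁻ X in simpleSpectrum (n + 1), G X = ∫⁻ l : Fin n → ℝ, ∫⁻ x : ℝ,
      ∫⁻ Z : Matrix (Fin n) (Fin n) ℝ, ∫⁻ α : Fin n → ℝ,
        deflationWeight x Z * G (inflate l x α Z) := by
  let obs : Set (Matrix (Fin (n + 1)) (Fin (n + 1)) ℝ) := {X | (observability X).det ≠ 0}
  have hobs : MeasurableSet obs := by
    refine (isOpen_ne_fun (Continuous.matrix_det ?_) continuous_const).measurableSet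
    refine continuous_pi fun k => continuous_pi fun j => ?_
    simp only [observability, Matrix.of_apply]
    fun_prop
  have hE := measurableSet_simpleSpectrum (n + 1)
  -- For fixed `x`, `ξ`, `Y`, the image of the column map lies between the sections of
  -- `simpleSpectrum ∩ obs` and of `simpleSpectrum`, and these two sets differ by a null set.
  have hmid : ∫⁻ X in simpleSpectrum (n + 1), G X = ∫⁻ x, ∫⁻ ξ, ∫⁻ Y,
      ∫⁻ η in columnOfEigenvector x ξ Y ''
        {l | (x + ξ ⬝ᵥ l, Y - Matrix.vecMulVec l ξ) ∈ belowSpectrum n}, G (bordered x ξ η Y) := by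
    have hcb : ∀ x ξ (Y : Matrix (Fin n) (Fin n) ℝ), Measurable fun η => bordered x ξ η Y :=
      fun x ξ Y => continuous_bordered.measurable.comp (f := fun η => (x, ξ, η, Y)) (by fun_prop)
    apply le_antisymm
    · have h1 : ∫⁻ X in simpleSpectrum (n + 1), G X =
          ∫⁻ X in simpleSpectrum (n + 1) ∩ obs, G X := by
        refine setLIntegral_congr ?_
        filter_upwards [ae_det_observability_ne_zero n] with X hX
        exact propext ⟨fun h => ⟨h, hX⟩, fun h => h.1⟩
      rw [h1, ← lintegral_indicator (hE.inter hobs),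
        lintegral_bordered (hG.indicator (hE.inter hobs))]
      refine lintegral_mono fun x => lintegral_mono fun ξ => lintegral_mono fun Y => ?_
      have h2 : ∀ η, (simpleSpectrum (n + 1) ∩ obs).indicator G (bordered x ξ η Y) =
          ((fun η => bordered x ξ η Y) ⁻¹' (simpleSpectrum (n + 1) ∩ obs)).indicator
            (fun η => G (bordered x ξ η Y)) η := fun η => rfl
      simp_rw [h2]
      rw [lintegral_indicator (hcb x ξ Y (hE.inter hobs))]
      refine lintegral_mono_set fun η hη => ?_
      obtain ⟨l, hl, hl'⟩ := exists_columnOfEigenvector_eq hη.1 hη.2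
      exact ⟨l, hl, hl'⟩
    · rw [← lintegral_indicator hE, lintegral_bordered (hG.indicator hE)]
      refine lintegral_mono fun x => lintegral_mono fun ξ => lintegral_mono fun Y => ?_
      have h2 : ∀ η, (simpleSpectrum (n + 1)).indicator G (bordered x ξ η Y) =
          ((fun η => bordered x ξ η Y) ⁻¹' simpleSpectrum (n + 1)).indicator
            (fun η => G (bordered x ξ η Y)) η := fun η => rfl
      simp_rw [h2]
      rw [lintegral_indicator (hcb x ξ Y hE)]
      refine lintegral_mono_set ?_
      rintro _ ⟨l, hl, rfl⟩
      have := (inflate_spectrum l ξ hl).1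
      rwa [← bordered_columnOfEigenvector] at this
  rw [hmid]
  simp_rw [lintegral_columnOfEigenvector]
  have hK : Measurable fun z : (Fin n → ℝ) × ℝ × (Fin n → ℝ) × Matrix (Fin n) (Fin n) ℝ =>
      deflationWeight z.2.1 z.2.2.2 * G (inflate z.1 z.2.1 z.2.2.1 z.2.2.2) :=
    (measurable_deflationWeight.comp
      (f := fun z : (Fin n → ℝ) × ℝ × (Fin n → ℝ) × Matrix (Fin n) (Fin n) ℝ =>
        (z.2.1, z.2.2.2)) (by fun_prop)).mul (hG.comp continuous_inflate.measurable)
  have hvm : Continuous fun z : (Fin n → ℝ) × (Fin n → ℝ) => Matrix.vecMulVec z.1 z.2 := by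
    refine continuous_pi fun i => continuous_pi fun j => ?_
    simp only [Matrix.vecMulVec_apply]
    fun_prop
  have hF : Measurable fun z : ℝ × (Fin n → ℝ) × Matrix (Fin n) (Fin n) ℝ × (Fin n → ℝ) =>
      deflationWeight (z.1 + z.2.1 ⬝ᵥ z.2.2.2) (z.2.2.1 - Matrix.vecMulVec z.2.2.2 z.2.1) *
        G (inflate z.2.2.2 (z.1 + z.2.1 ⬝ᵥ z.2.2.2) z.2.1
          (z.2.2.1 - Matrix.vecMulVec z.2.2.2 z.2.1)) := by
    refine hK.comp (f := fun z : ℝ × (Fin n → ℝ) × Matrix (Fin n) (Fin n) ℝ × (Fin n → ℝ) =>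
      (z.2.2.2, z.1 + z.2.1 ⬝ᵥ z.2.2.2, z.2.1, z.2.2.1 - Matrix.vecMulVec z.2.2.2 z.2.1)) ?_
    refine Continuous.measurable ?_
    have : Continuous fun z : ℝ × (Fin n → ℝ) × Matrix (Fin n) (Fin n) ℝ × (Fin n → ℝ) =>
        Matrix.vecMulVec z.2.2.2 z.2.1 := hvm.comp (f := fun z :
          ℝ × (Fin n → ℝ) × Matrix (Fin n) (Fin n) ℝ × (Fin n → ℝ) => (z.2.2.2, z.2.1))
          (by fun_prop)
    fun_prop
  rw [lintegral_swap_four hF]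
  refine lintegral_congr fun l => ?_
  have hKl : Measurable fun z : (Fin n → ℝ) × ℝ × Matrix (Fin n) (Fin n) ℝ =>
      deflationWeight z.2.1 z.2.2 * G (inflate l z.2.1 z.1 z.2.2) :=
    hK.comp (f := fun z : (Fin n → ℝ) × ℝ × Matrix (Fin n) (Fin n) ℝ =>
      (l, z.2.1, z.1, z.2.2)) (by fun_prop)
  rw [← lintegral_rotate_three hKl]
  refine lintegral_congr fun ξ => ?_
  simp only
  have h1 : ∀ x : ℝ, ∫⁻ Y : Matrix (Fin n) (Fin n) ℝ,
      deflationWeight (x + ξ ⬝ᵥ l) (Y - Matrix.vecMulVec l ξ) *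
        G (inflate l (x + ξ ⬝ᵥ l) ξ (Y - Matrix.vecMulVec l ξ)) =
      ∫⁻ Y : Matrix (Fin n) (Fin n) ℝ,
        deflationWeight (x + ξ ⬝ᵥ l) Y * G (inflate l (x + ξ ⬝ᵥ l) ξ Y) := fun x =>
    lintegral_sub_right_eq_self (fun Y : Matrix (Fin n) (Fin n) ℝ =>
      deflationWeight (x + ξ ⬝ᵥ l) Y * G (inflate l (x + ξ ⬝ᵥ l) ξ Y)) _
  simp_rw [h1]
  exact lintegral_add_right_eq_self (fun x : ℝ => ∫⁻ Y : Matrix (Fin n) (Fin n) ℝ,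
    deflationWeight x Y * G (inflate l x ξ Y)) _

theorem deflationWeight_congr {n : ℕ} {X S P : Matrix (Fin n) (Fin n) ℝ} (hP : P.det ≠ 0)
    (h : X * P = P * S) (x : ℝ) : deflationWeight x X = deflationWeight x S := by
  have hmem : (x, X) ∈ belowSpectrum n ↔ (x, S) ∈ belowSpectrum n := by
    simp only [belowSpectrum, Set.mem_ofPred_eq, simpleSpectrum_congr hP h]
    refine and_congr_right fun hS => ?_
    rw [orderedEigenvalues_congr hP h hS]
  unfold deflationWeight
  by_cases hS : (x, S) ∈ belowSpectrum n
  · rw [Set.indicator_of_mem hS, Set.indicator_of_mem (hmem.2 hS)]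
    have hX := hasSpectrum_orderedEigenvalues (hmem.2 hS).1
    have hS' := hasSpectrum_orderedEigenvalues hS.1
    simp only
    rw [hX, hS', orderedEigenvalues_congr hP h hS.1]
  · rw [Set.indicator_of_notMem hS, Set.indicator_of_notMem (fun h' => hS (hmem.1 h'))]

/-! ### Rotating the eigenvector to the first axis -/

section reflection
variable {n : ℕ} (l : Fin n → ℝ)

theorem dotProduct_self_nonneg_real : 0 ≤ l ⬝ᵥ l := by
  simpa using dotProduct_star_self_nonneg l

/-- The length of `(1, l)`. -/
noncomputable def affineLength : ℝ := √(1 + l ⬝ᵥ l)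

theorem affineLength_pos : 0 < affineLength l :=
  Real.sqrt_pos.2 (by have := dotProduct_self_nonneg_real l; linarith)

theorem affineLength_sq : affineLength l ^ 2 = 1 + l ⬝ᵥ l :=
  Real.sq_sqrt (by have := dotProduct_self_nonneg_real l; linarith)

/-- The positive square root of `1 + l lᵀ`. -/
noncomputable def affineRoot : Matrix (Fin n) (Fin n) ℝ :=
  1 + (1 / (1 + affineLength l)) • Matrix.vecMulVec l l

theorem affineRoot_transpose : (affineRoot l)ᵀ = affineRoot l := by
  simp [affineRoot, Matrix.transpose_vecMulVec]

theorem affineRoot_mulVec : affineRoot l *ᵥ l = affineLength l • l := by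
  have h := affineLength_pos l
  have h2 := affineLength_sq l
  rw [affineRoot, Matrix.add_mulVec, Matrix.one_mulVec, Matrix.smul_mulVec,
    Matrix.vecMulVec_mulVec]
  ext i
  simp only [Pi.add_apply, Pi.smul_apply, smul_eq_mul, op_smul_eq_mul]
  have : l ⬝ᵥ l = affineLength l ^ 2 - 1 := by linarith
  rw [this]
  field_simp
  ring

theorem vecMul_affineRoot : l ᵥ* affineRoot l = affineLength l • l := by
  rw [← affineRoot_mulVec, ← Matrix.vecMul_transpose, affineRoot_transpose]

theorem affineRoot_mul_self : affineRoot l * affineRoot l = 1 + Matrix.vecMulVec l l := by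
  have h := affineLength_pos l
  conv_lhs => arg 2; rw [affineRoot]
  rw [Matrix.mul_add, Matrix.mul_one, Matrix.mul_smul, Matrix.mul_vecMulVec, affineRoot_mulVec]
  ext i j
  simp only [affineRoot, Matrix.add_apply, Matrix.smul_apply, Matrix.vecMulVec_apply, smul_eq_mul,
    Pi.smul_apply]
  field_simp
  ring

theorem det_affineRoot : (affineRoot l).det = affineLength l := by
  have h := affineLength_pos l
  have h2 := affineLength_sq l
  have h3 : affineRoot l = 1 + Matrix.replicateCol Unit ((1 / (1 + affineLength l)) • l) *
      Matrix.replicateRow Unit l := by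
    rw [← Matrix.vecMulVec_eq, affineRoot, Matrix.smul_vecMulVec]
  rw [h3, Matrix.det_one_add_replicateCol_mul_replicateRow, dotProduct_smul, smul_eq_mul]
  have : l ⬝ᵥ l = affineLength l ^ 2 - 1 := by linarith
  rw [this]
  field_simp
  ring

theorem det_affineRoot_ne_zero : (affineRoot l).det ≠ 0 := by
  rw [det_affineRoot]; exact (affineLength_pos l).ne'

/-- A rotation which takes the first basis vector to the direction of `(1, l)`. -/
noncomputable def affineRotation : Matrix (Fin (n + 1)) (Fin (n + 1)) ℝ :=
  bordered 1 0 l 1 * bordered (affineLength l)⁻¹ (-(affineLength l)⁻¹ • l) 0 (affineRoot l)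

theorem affineRotation_mul_transpose : affineRotation l * (affineRotation l)ᵀ = 1 := by
  have h := affineLength_pos l
  have h2 := affineLength_sq l
  have h1 : bordered (affineLength l)⁻¹ (-(affineLength l)⁻¹ • l) 0 (affineRoot l) *
      (bordered (affineLength l)⁻¹ (-(affineLength l)⁻¹ • l) 0 (affineRoot l))ᵀ =
      bordered 1 (-l) (-l) (1 + Matrix.vecMulVec l l) := by
    rw [bordered_transpose, bordered_mul, affineRoot_transpose, affineRoot_mul_self]
    congr 1
    · rw [smul_dotProduct, dotProduct_smul, smul_eq_mul, smul_eq_mul]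
      have : l ⬝ᵥ l = affineLength l ^ 2 - 1 := by linarith
      rw [this]
      field_simp
      ring
    · rw [Matrix.smul_vecMul, vecMul_affineRoot, smul_smul]
      simp [h.ne']
    · rw [Matrix.mulVec_smul, affineRoot_mulVec, smul_smul]
      simp [h.ne']
    · simp
  rw [affineRotation, Matrix.transpose_mul, Matrix.mul_assoc,
    ← Matrix.mul_assoc (bordered (affineLength l)⁻¹ _ _ _), h1, bordered_transpose, bordered_mul,
    bordered_mul, ← bordered_one]
  congr 1
  · simp
  · simp
  · ext i
    simp
  · ext i j
    simp [Matrix.one_apply]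

/-- The rotation differs from the unipotent change of basis only by a block upper triangular factor,
so the matrix stays block triangular with the same `x`. The row `α` undergoes an affine map and `Z`
is conjugated by `affineRoot l`. -/
theorem inflate_eq_rotation (x : ℝ) (α : Fin n → ℝ) (Z : Matrix (Fin n) (Fin n) ℝ) :
    inflate l x α Z = affineRotation l *
      bordered x (α ᵥ* (affineLength l • affineRoot l) +
        (l ᵥ* ((affineRoot l)⁻¹ * Z * affineRoot l) - x • l)) 0
        ((affineRoot l)⁻¹ * Z * affineRoot l) * (affineRotation l)ᵀ := by
  have h := affineLength_pos l
  have hu := (det_affineRoot_ne_zero l).isUnit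
  have h1 : bordered x α 0 Z *
      bordered (affineLength l)⁻¹ (-(affineLength l)⁻¹ • l) 0 (affineRoot l) =
      bordered (affineLength l)⁻¹ (-(affineLength l)⁻¹ • l) 0 (affineRoot l) *
      bordered x (α ᵥ* (affineLength l • affineRoot l) +
        (l ᵥ* ((affineRoot l)⁻¹ * Z * affineRoot l) - x • l)) 0
        ((affineRoot l)⁻¹ * Z * affineRoot l) := by
    rw [bordered_mul, bordered_mul]
    congr 1
    · simp [mul_comm]
    · rw [Matrix.smul_vecMul, Matrix.vecMul_smul, smul_add, smul_smul, smul_sub, smul_smul,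
        inv_mul_cancel₀ h.ne', one_smul, smul_smul]
      ext i
      simp
      ring
    · simp
    · rw [Matrix.mul_assoc (affineRoot l)⁻¹, Matrix.mul_nonsing_inv_cancel_left _ _ hu]
      simp
  have h2 : inflate l x α Z * affineRotation l = affineRotation l *
      bordered x (α ᵥ* (affineLength l • affineRoot l) +
        (l ᵥ* ((affineRoot l)⁻¹ * Z * affineRoot l) - x • l)) 0
        ((affineRoot l)⁻¹ * Z * affineRoot l) := by
    rw [affineRotation, ← Matrix.mul_assoc, inflate_mul, Matrix.mul_assoc, h1, ← Matrix.mul_assoc]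
  rw [← h2, Matrix.mul_assoc, affineRotation_mul_transpose, Matrix.mul_one]

end reflection

/-- Deflation of an orthogonally invariant integrand. -/
theorem setLIntegral_simpleSpectrum_succ_of_invariant {n : ℕ}
    {G : Matrix (Fin (n + 1)) (Fin (n + 1)) ℝ → ℝ≥0∞} (hG : Measurable G)
    (hinv : ∀ X ∈ simpleSpectrum (n + 1), ∀ Q : Matrix (Fin (n + 1)) (Fin (n + 1)) ℝ,
      Q * Qᵀ = 1 → G (Q * X * Qᵀ) = G X) :
    ∫⁻ X in simpleSpectrum (n + 1), G X =
      ENNReal.ofReal (japaneseConst n (((n : ℝ) + 1) / 2)) * ∫⁻ x : ℝ,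
      ∫⁻ Z : Matrix (Fin n) (Fin n) ℝ, ∫⁻ β : Fin n → ℝ,
        deflationWeight x Z * G (bordered x β 0 Z) := by
  rw [setLIntegral_simpleSpectrum_succ hG]
  have hM : Measurable fun z : (ℝ × Matrix (Fin n) (Fin n) ℝ) × (Fin n → ℝ) =>
      deflationWeight z.1.1 z.1.2 * G (bordered z.1.1 z.2 0 z.1.2) :=
    (measurable_deflationWeight.comp measurable_fst).mul
      (hG.comp (continuous_bordered.measurable.comp
        (f := fun z : (ℝ × Matrix (Fin n) (Fin n) ℝ) × (Fin n → ℝ) => (z.1.1, z.2, 0, z.1.2))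
        (by fun_prop)))
  -- For fixed `l` the rotation disappears by invariance. Conjugating `Z` has Jacobian one, and the
  -- affine map on `α` has determinant `affineLength l ^ (n + 1)`, which produces the weight in `l`.
  -- The integral of this weight is `japaneseConst n ((n + 1) / 2)`.
  have key : ∀ l : Fin n → ℝ, ∫⁻ x : ℝ, ∫⁻ Z : Matrix (Fin n) (Fin n) ℝ, ∫⁻ α : Fin n → ℝ,
        deflationWeight x Z * G (inflate l x α Z) =
      ENNReal.ofReal ((1 + l ⬝ᵥ l) ^ (-(((n : ℝ) + 1) / 2))) * ∫⁻ x : ℝ,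
      ∫⁻ Z : Matrix (Fin n) (Fin n) ℝ, ∫⁻ β : Fin n → ℝ,
        deflationWeight x Z * G (bordered x β 0 Z) := by
    intro l
    have hρ := affineLength_pos l
    have hd := det_affineRoot_ne_zero l
    have hu := hd.isUnit
    have hdi : ((affineRoot l)⁻¹).det ≠ 0 := by
      rw [Matrix.det_nonsing_inv, Ring.inverse_eq_inv']; exact inv_ne_zero hd
    rw [← lintegral_const_mul' _ _ (by finiteness)]
    refine lintegral_congr fun x => ?_
    have hm : Measurable fun Z : Matrix (Fin n) (Fin n) ℝ => ∫⁻ β : Fin n → ℝ,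
        deflationWeight x Z * G (bordered x β 0 Z) :=
      (hM.lintegral_prod_right').comp (f := fun Z : Matrix (Fin n) (Fin n) ℝ => (x, Z))
        (by fun_prop)
    have h1 : ∀ Z : Matrix (Fin n) (Fin n) ℝ, ∫⁻ α : Fin n → ℝ,
        deflationWeight x Z * G (inflate l x α Z) =
        ENNReal.ofReal ((1 + l ⬝ᵥ l) ^ (-(((n : ℝ) + 1) / 2))) * ∫⁻ β : Fin n → ℝ,
          deflationWeight x ((affineRoot l)⁻¹ * Z * affineRoot l) *
            G (bordered x β 0 ((affineRoot l)⁻¹ * Z * affineRoot l)) := by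
      intro Z
      set Z' := (affineRoot l)⁻¹ * Z * affineRoot l with hZ'
      have hconj : Z * affineRoot l = affineRoot l * Z' := by
        rw [hZ', Matrix.mul_assoc (affineRoot l)⁻¹, Matrix.mul_nonsing_inv_cancel_left _ _ hu]
      have hw : deflationWeight x Z = deflationWeight x Z' := deflationWeight_congr hd hconj x
      have h2 : ∀ α : Fin n → ℝ, deflationWeight x Z * G (inflate l x α Z) =
          deflationWeight x Z' * G (bordered x (α ᵥ* (affineLength l • affineRoot l) +
            (l ᵥ* Z' - x • l)) 0 Z') := by
        intro α
        rw [hw]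
        -- Invariance is assumed only on `simpleSpectrum`; off `belowSpectrum` the weight vanishes.
        by_cases hmem : (x, Z') ∈ belowSpectrum n
        · rw [inflate_eq_rotation, hinv _ (bordered_zero_spectrum _ hmem).1 _
            (affineRotation_mul_transpose l)]
        · rw [deflationWeight, Set.indicator_of_notMem hmem, zero_mul, zero_mul]
      simp_rw [h2]
      have hf : Measurable fun β : Fin n → ℝ => deflationWeight x Z' * G (bordered x β 0 Z') :=
        hM.comp (f := fun β : Fin n → ℝ => ((x, Z'), β)) (by fun_prop)
      have hf' : Measurable fun β : Fin n → ℝ => deflationWeight x Z' *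
          G (bordered x (β + (l ᵥ* Z' - x • l)) 0 Z') :=
        hf.comp (f := fun β => β + (l ᵥ* Z' - x • l)) (by fun_prop)
      have hdet : (affineLength l • affineRoot l).det = affineLength l ^ (n + 1) := by
        rw [Matrix.det_smul, det_affineRoot, Fintype.card_fin, pow_succ]
      have h3 := lintegral_vecMul (B := affineLength l • affineRoot l)
        (by rw [hdet]; positivity) hf'
      rw [h3, lintegral_add_right_eq_self (fun β : Fin n → ℝ =>
        deflationWeight x Z' * G (bordered x β 0 Z')), hdet, abs_of_pos (by positivity)]
      congr 2
      rw [← affineLength_sq, ← Real.rpow_natCast _ 2, ← Real.rpow_mul hρ.le,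
        ← Real.rpow_natCast, ← Real.rpow_neg hρ.le]
      congr 1
      push_cast
      ring
    simp_rw [h1]
    rw [lintegral_const_mul' _ _ (by finiteness)]
    congr 1
    have hm' : Measurable fun Z : Matrix (Fin n) (Fin n) ℝ => ∫⁻ β : Fin n → ℝ,
        deflationWeight x ((affineRoot l)⁻¹ * Z) * G (bordered x β 0 ((affineRoot l)⁻¹ * Z)) :=
      hm.comp (Continuous.measurable (by fun_prop))
    have h4 := lintegral_mul_left hdi hm
    have h5 := lintegral_mul_right hd hm'
    simp only [← Matrix.mul_assoc] at h5
    rw [h5, h4, ← mul_assoc, ← mul_pow, ← ENNReal.ofReal_mul (by positivity), Matrix.det_nonsing_inv,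
      Ring.inverse_eq_inv', abs_inv, inv_inv, inv_mul_cancel₀ (abs_ne_zero.2 hd)]
    simp
  simp_rw [key]
  rw [lintegral_mul_const _ (by
    refine ENNReal.measurable_ofReal.comp (Measurable.pow_const ?_ _)
    exact Continuous.measurable (by fun_prop)),
    lintegral_add_dotProduct_self_rpow (by linarith) one_pos, Real.one_rpow, one_mul]

/-! ### The joint density of the eigenvalues -/

theorem posDef_one_add_transpose_mul_self {m n : ℕ} (Z : Matrix (Fin m) (Fin n) ℝ) :
    (1 + Zᵀ * Z).PosDef := by
  refine Matrix.PosDef.one.add_posSemidef ?_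
  simpa using Matrix.posSemidef_conjTranspose_mul_self Z

/-- With `v = (x, β)`, the matrix on the left is `diag(1, W) + v vᵀ`, so the matrix determinant
lemma applies. -/
theorem det_one_add_bordered {n : ℕ} (x : ℝ) (β : Fin n → ℝ) (Z : Matrix (Fin n) (Fin n) ℝ) :
    (1 + (bordered x β 0 Z)ᵀ * bordered x β 0 Z).det =
      (1 + Zᵀ * Z).det * ((1 + x ^ 2) + β ᵥ* (1 + Zᵀ * Z)⁻¹ ⬝ᵥ β) := by
  set W := 1 + Zᵀ * Z with hW
  have hWu : IsUnit W.det := (posDef_one_add_transpose_mul_self Z).det_pos.ne'.isUnit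
  have hdet : (bordered 1 0 0 W).det = W.det := by rw [det_bordered_zero_col, one_mul]
  have h1 : 1 + (bordered x β 0 Z)ᵀ * bordered x β 0 Z = bordered 1 0 0 W +
      Matrix.vecMulVec (Fin.cons x β : Fin (n + 1) → ℝ) (Fin.cons x β : Fin (n + 1) → ℝ) := by
    rw [bordered_transpose, bordered_mul, ← bordered_one, hW]
    ext i j
    induction i using Fin.cases <;> induction j using Fin.cases <;>
      simp [Matrix.vecMulVec_apply, mul_comm, add_comm, ← add_assoc]
  have hinv : (bordered 1 0 0 W)⁻¹ = bordered 1 0 0 W⁻¹ := by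
    refine Matrix.inv_eq_right_inv ?_
    rw [bordered_mul, ← bordered_one, Matrix.mul_nonsing_inv _ hWu]
    simp
  have hvm : (Fin.cons x β : Fin (n + 1) → ℝ) ᵥ* bordered 1 0 0 W⁻¹ =
      (Fin.cons x (β ᵥ* W⁻¹) : Fin (n + 1) → ℝ) := by
    ext i
    induction i using Fin.cases <;> simp [Matrix.vecMul, dotProduct, Fin.sum_univ_succ]
  rw [h1, Matrix.det_add_vecMulVec_self (by rw [hdet]; exact hWu.ne_zero), hdet, hinv, hvm]
  congr 1
  simp only [dotProduct, Fin.sum_univ_succ, Fin.cons_zero, Fin.cons_succ]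
  ring

/-- The joint density of ordered eigenvalues under the weight `det (1 + XᵀX)^(-s)`. -/
noncomputable def cauchyDensity {n : ℕ} (s : ℝ) (l : Fin n → ℝ) : ℝ≥0∞ :=
  {l : Fin n → ℝ | StrictMono l}.indicator
    (fun l => ENNReal.ofReal ((∏ i, (1 + l i ^ 2) ^ (-s)) * ∏ i, ∏ j ∈ Finset.Ioi i, |l j - l i|)) l

theorem measurable_cauchyDensity {n : ℕ} (s : ℝ) :
    Measurable (cauchyDensity s : (Fin n → ℝ) → ℝ≥0∞) := by
  refine Measurable.indicator (ENNReal.measurable_ofReal.comp (Measurable.mul ?_ ?_))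
    (measurableSet_strictMono n)
  · exact Finset.measurable_prod _ fun i _ => Measurable.pow_const (by fun_prop) _
  · exact Continuous.measurable (by fun_prop)

theorem cauchyDensity_finCons {n : ℕ} (s x : ℝ) (l : Fin n → ℝ) :
    cauchyDensity s (Fin.cons x l : Fin (n + 1) → ℝ) = ENNReal.ofReal ((1 + x ^ 2) ^ (-s)) *
      ({l : Fin n → ℝ | ∀ i, x < l i}.indicator (fun l => ENNReal.ofReal (∏ i, |x - l i|)) l *
        cauchyDensity s l) := by
  unfold cauchyDensity
  by_cases h1 : StrictMono l
  · by_cases h2 : ∀ i, x < l i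
    · rw [Set.indicator_of_mem (by exact strictMono_finCons.2 ⟨h1, h2⟩),
        Set.indicator_of_mem (s := {l : Fin n → ℝ | ∀ i, x < l i}) h2,
        Set.indicator_of_mem (s := {l : Fin n → ℝ | StrictMono l}) h1,
        ← ENNReal.ofReal_mul (by positivity), ← ENNReal.ofReal_mul (by positivity)]
      congr 1
      simp only [Fin.prod_univ_succ, Fin.cons_zero, Fin.cons_succ, Fin.prod_Ioi_zero,
        Fin.prod_Ioi_succ, abs_sub_comm x]
      ring
    · rw [Set.indicator_of_notMem (fun h => h2 (strictMono_finCons.1 h).2),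
        Set.indicator_of_notMem (s := {l : Fin n → ℝ | ∀ i, x < l i}) (by exact h2)]
      simp
  · rw [Set.indicator_of_notMem (fun h => h1 (strictMono_finCons.1 h).1),
      Set.indicator_of_notMem (s := {l : Fin n → ℝ | StrictMono l}) (by exact h1)]
    simp

/-- The constant relating the matrix integral and the eigenvalue integral. -/
noncomputable def eigenvalueConst (n : ℕ) (s : ℝ) : ℝ :=
  ∏ k ∈ Finset.range n, (japaneseConst k (((k : ℝ) + 1) / 2) *
    japaneseConst k (s - ((n : ℝ) - 1 - k) / 2))

theorem eigenvalueConst_succ (n : ℕ) (s : ℝ) : eigenvalueConst (n + 1) s =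
    japaneseConst n (((n : ℝ) + 1) / 2) * (japaneseConst n s * eigenvalueConst n (s - 1 / 2)) := by
  rw [eigenvalueConst, Finset.prod_range_succ, eigenvalueConst, mul_comm, mul_assoc]
  push_cast
  congr 2
  · congr 1; ring
  · refine Finset.prod_congr rfl fun k _ => ?_
    congr 2; ring

/-- Passing from matrices with simple real spectrum to their ordered eigenvalues. -/
theorem setLIntegral_simpleSpectrum_eigenvalues {n : ℕ} {s : ℝ} (hs : ((n : ℝ) - 1) / 2 < s)
    {g : (Fin n → ℝ) → ℝ≥0∞} (hg : Measurable g) :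
    ∫⁻ X in simpleSpectrum n, g (orderedEigenvalues X) * ENNReal.ofReal ((1 + Xᵀ * X).det ^ (-s)) =
      ENNReal.ofReal (eigenvalueConst n s) *
        ∫⁻ l, g l * cauchyDensity (s - ((n : ℝ) - 1) / 2) l := by
  induction n generalizing s with
  | zero =>
    have hmem : ∀ X : Matrix (Fin 0) (Fin 0) ℝ, X ∈ simpleSpectrum 0 := fun X =>
      ⟨0, Subsingleton.strictMono _, fun t => by simp⟩
    have : simpleSpectrum 0 = Set.univ := Set.eq_univ_of_forall hmem
    have hmono : ∀ l : Fin 0 → ℝ, StrictMono l := fun l => Subsingleton.strictMono _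
    rw [this, Measure.restrict_univ]
    have hc : ∀ l : Fin 0 → ℝ, cauchyDensity (s - (((0 : ℕ) : ℝ) - 1) / 2) l = 1 := by
      intro l
      rw [cauchyDensity, Set.indicator_of_mem (by exact hmono l)]
      simp
    simp only [hc, eigenvalueConst, Finset.range_zero, Finset.prod_empty, ENNReal.ofReal_one,
      one_mul, mul_one, Matrix.det_fin_zero, Real.one_rpow]
    change ∫⁻ X : Fin 0 → Fin 0 → ℝ, g (orderedEigenvalues (Matrix.of X)) = _
    rw [volume_pi, volume_pi, Measure.pi_of_empty, Measure.pi_of_empty, lintegral_dirac,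
      lintegral_dirac]
    congr 1
    exact Subsingleton.elim _ _
  | succ n ih =>
    push_cast at hs
    have hs' : (n : ℝ) / 2 < s := by linarith
    have hjn : 0 < japaneseConst n s := japaneseConst_pos hs'
    have hdetc : ∀ m : ℕ, ∀ t : ℝ, Measurable fun X : Matrix (Fin m) (Fin m) ℝ =>
        ENNReal.ofReal ((1 + Xᵀ * X).det ^ (-t)) := by
      intro m t
      refine ENNReal.measurable_ofReal.comp (Measurable.pow_const ?_ _)
      exact measurable_det.comp (f := fun X : Matrix (Fin m) (Fin m) ℝ => 1 + Xᵀ * X)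
        (Continuous.measurable (by fun_prop))
    have hGm : Measurable fun X : Matrix (Fin (n + 1)) (Fin (n + 1)) ℝ =>
        g (orderedEigenvalues X) * ENNReal.ofReal ((1 + Xᵀ * X).det ^ (-s)) :=
      (hg.comp measurable_orderedEigenvalues).mul (hdetc _ s)
    rw [setLIntegral_simpleSpectrum_succ_of_invariant hGm]
    swap
    · intro X hX Q hQ
      have hQ' : Qᵀ * Q = 1 := mul_eq_one_comm.1 hQ
      have hQd : Q.det ≠ 0 := by
        intro h0
        have := congrArg Matrix.det hQ
        rw [Matrix.det_mul, h0, zero_mul, Matrix.det_one] at this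
        exact zero_ne_one this
      have h1 : (Q * X * Qᵀ) * Q = Q * X := by rw [Matrix.mul_assoc, hQ', Matrix.mul_one]
      have h2 : 1 + (Q * X * Qᵀ)ᵀ * (Q * X * Qᵀ) = Q * (1 + Xᵀ * X) * Qᵀ := by
        rw [Matrix.mul_add, Matrix.add_mul, Matrix.mul_one, hQ, Matrix.transpose_mul,
          Matrix.transpose_mul, Matrix.transpose_transpose]
        congr 1
        calc Q * (Xᵀ * Qᵀ) * (Q * X * Qᵀ) = Q * Xᵀ * (Qᵀ * Q) * X * Qᵀ := by
              simp only [Matrix.mul_assoc]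
          _ = _ := by rw [hQ', Matrix.mul_one]; simp only [Matrix.mul_assoc]
      have h3 : (Q * (1 + Xᵀ * X) * Qᵀ).det = (1 + Xᵀ * X).det := by
        have := congrArg Matrix.det hQ
        rw [Matrix.det_mul, Matrix.det_one] at this
        rw [Matrix.det_mul, Matrix.det_mul, mul_right_comm, this, one_mul]
      rw [orderedEigenvalues_congr hQd h1 hX, h2, h3]
    -- The Jacobian and the condition that `x` lies below the other eigenvalues are absorbed into
    -- the test function, so the induction hypothesis applies to `Z`.
    let g' : ℝ → (Fin n → ℝ) → ℝ≥0∞ := fun x l =>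
      {l : Fin n → ℝ | ∀ i, x < l i}.indicator (fun l => ENNReal.ofReal (∏ i, |x - l i|)) l *
        g (Fin.cons x l)
    have hg' : ∀ x, Measurable (g' x) := by
      intro x
      refine Measurable.mul (Measurable.indicator ?_ ?_) ?_
      · exact ENNReal.measurable_ofReal.comp (Continuous.measurable (by fun_prop))
      · have : {l : Fin n → ℝ | ∀ i, x < l i} = ⋂ i, {l | x < l i} := by ext; simp
        rw [this]
        exact MeasurableSet.iInter fun i => measurableSet_lt measurable_const (measurable_pi_apply i)
      · exact hg.comp (measurable_finCons.comp (f := fun l => (x, l)) (by fun_prop))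
    -- Integrating out `β` separates `x` from `Z`: it leaves a power of `1 + x ^ 2` and changes the
    -- exponent at `Z` from `-s` to `-(s - 1 / 2)`.
    have h1 : ∀ (x : ℝ) (Z : Matrix (Fin n) (Fin n) ℝ), ∫⁻ β : Fin n → ℝ, deflationWeight x Z *
        (g (orderedEigenvalues (bordered x β 0 Z)) *
          ENNReal.ofReal ((1 + (bordered x β 0 Z)ᵀ * bordered x β 0 Z).det ^ (-s))) =
        ENNReal.ofReal ((1 + x ^ 2) ^ (-(s - n / 2)) * japaneseConst n s) *
          (simpleSpectrum n).indicator (fun Z => g' x (orderedEigenvalues Z) *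
            ENNReal.ofReal ((1 + Zᵀ * Z).det ^ (-(s - 1 / 2)))) Z := by
      intro x Z
      by_cases hZ : Z ∈ simpleSpectrum n
      swap
      · have : (x, Z) ∉ belowSpectrum n := fun h => hZ h.1
        rw [Set.indicator_of_notMem hZ, deflationWeight, Set.indicator_of_notMem this]
        simp
      rw [Set.indicator_of_mem hZ]
      by_cases hx : ∀ i, x < orderedEigenvalues Z i
      swap
      · have : (x, Z) ∉ belowSpectrum n := fun h => hx h.2
        simp only [g']
        rw [deflationWeight, Set.indicator_of_notMem this, Set.indicator_of_notMem (by exact hx)]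
        simp
      have hmem : (x, Z) ∈ belowSpectrum n := ⟨hZ, hx⟩
      have hW := posDef_one_add_transpose_mul_self Z
      have hWp := hW.det_pos
      have hdw : deflationWeight x Z = ENNReal.ofReal (∏ i, |x - orderedEigenvalues Z i|) := by
        rw [deflationWeight, Set.indicator_of_mem hmem]
        simp only
        rw [hasSpectrum_orderedEigenvalues hZ, Finset.abs_prod]
      have h2 : ∀ β : Fin n → ℝ, deflationWeight x Z *
          (g (orderedEigenvalues (bordered x β 0 Z)) *
            ENNReal.ofReal ((1 + (bordered x β 0 Z)ᵀ * bordered x β 0 Z).det ^ (-s))) =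
          g' x (orderedEigenvalues Z) * ENNReal.ofReal ((1 + Zᵀ * Z).det ^ (-s)) *
            ENNReal.ofReal (((1 + x ^ 2) + β ᵥ* (1 + Zᵀ * Z)⁻¹ ⬝ᵥ β) ^ (-s)) := by
        intro β
        have hq : 0 ≤ β ᵥ* (1 + Zᵀ * Z)⁻¹ ⬝ᵥ β := by
          obtain ⟨C, -, hC⟩ := hW.inv.exists_mul_transpose
          rw [Matrix.PosDef.quadratic_inv hC]
          exact dotProduct_self_nonneg_real _
        simp only [g']
        rw [(bordered_zero_spectrum β hmem).2, det_one_add_bordered, hdw,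
          Set.indicator_of_mem (by exact hx), Real.mul_rpow hWp.le (by positivity),
          ENNReal.ofReal_mul (by positivity)]
        ring
      simp_rw [h2]
      have hqm : Measurable fun β : Fin n → ℝ =>
          ENNReal.ofReal (((1 + x ^ 2) + β ᵥ* (1 + Zᵀ * Z)⁻¹ ⬝ᵥ β) ^ (-s)) := by
        refine ENNReal.measurable_ofReal.comp (Measurable.pow_const ?_ _)
        exact Continuous.measurable (by fun_prop)
      rw [lintegral_const_mul _ hqm, lintegral_add_quadratic_rpow hW hs' (by positivity), mul_assoc,
        ← ENNReal.ofReal_mul (by positivity), ← mul_assoc, ← Real.rpow_add hWp,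
        ENNReal.ofReal_mul (by positivity), show -s + 1 / 2 = -(s - 1 / 2) by ring]
      ring
    simp_rw [h1]
    have h3 : ∀ x : ℝ, ∫⁻ Z : Matrix (Fin n) (Fin n) ℝ,
        ENNReal.ofReal ((1 + x ^ 2) ^ (-(s - n / 2)) * japaneseConst n s) *
          (simpleSpectrum n).indicator (fun Z => g' x (orderedEigenvalues Z) *
            ENNReal.ofReal ((1 + Zᵀ * Z).det ^ (-(s - 1 / 2)))) Z =
        ENNReal.ofReal (japaneseConst n s * eigenvalueConst n (s - 1 / 2)) *
          ∫⁻ l : Fin n → ℝ, g (Fin.cons x l) * cauchyDensity (s - n / 2) (Fin.cons x l :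
            Fin (n + 1) → ℝ) := by
      intro x
      rw [lintegral_const_mul' _ _ (by finiteness),
        lintegral_indicator (measurableSet_simpleSpectrum n), ih (by linarith) (hg' x),
        ENNReal.ofReal_mul (by positivity), ENNReal.ofReal_mul hjn.le]
      -- The density parameter `s - (size - 1) / 2` is unchanged when the size drops by one and `s`
      -- by `1 / 2`, so the new factor at `x` matches the others.
      have h4 : ∀ l : Fin n → ℝ, g (Fin.cons x l) *
          cauchyDensity (s - n / 2) (Fin.cons x l : Fin (n + 1) → ℝ) =
          ENNReal.ofReal ((1 + x ^ 2) ^ (-(s - n / 2))) * (g' x l *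
            cauchyDensity (s - 1 / 2 - ((n : ℝ) - 1) / 2) l) := by
        intro l
        rw [cauchyDensity_finCons, show s - 1 / 2 - ((n : ℝ) - 1) / 2 = s - n / 2 by ring]
        simp only [g']
        ring
      simp_rw [h4]
      rw [lintegral_const_mul' _ _ (by finiteness)]
      ring
    simp_rw [h3]
    rw [lintegral_const_mul' _ _ (by finiteness), ← mul_assoc, ← ENNReal.ofReal_mul
      (japaneseConst_pos (by linarith)).le, ← eigenvalueConst_succ]
    congr 1
    have : s - (((n + 1 : ℕ) : ℝ) - 1) / 2 = s - n / 2 := by push_cast; ring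
    rw [this]
    exact (lintegral_finCons (f := fun l => g l * cauchyDensity (s - n / 2) l)
      (hg.mul (measurable_cauchyDensity _))).symm

/-! ### The law of the quotient of two Gaussian matrices -/

theorem lintegral_prod_apply {E : Type*} [MeasureSpace E] [SigmaFinite (volume : Measure E)] {n : ℕ}
    {f : Fin n → E → ℝ≥0∞} (hf : ∀ i, Measurable (f i)) :
    ∫⁻ v : Fin n → E, ∏ i, f i (v i) = ∏ i, ∫⁻ x, f i x := by
  induction n with
  | zero => simp [volume_pi]
  | succ n ih =>
    have hm : Measurable fun v : Fin (n + 1) → E => ∏ i, f i (v i) :=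
      Finset.measurable_prod _ fun i _ => (hf i).comp (measurable_pi_apply i)
    rw [lintegral_finCons hm]
    simp only [Fin.prod_univ_succ, Fin.cons_zero, Fin.cons_succ]
    have h1 : Measurable fun w : Fin n → E => ∏ i, f i.succ (w i) :=
      Finset.measurable_prod _ fun i _ => (hf i.succ).comp (measurable_pi_apply i)
    simp_rw [lintegral_const_mul _ h1]
    rw [lintegral_mul_const _ (hf 0), ih fun i => hf i.succ]

theorem pi_withDensity {E : Type*} [MeasureSpace E] [SigmaFinite (volume : Measure E)] (n : ℕ)
    {P : E → ℝ≥0∞} (hP : Measurable P) [SigmaFinite ((volume : Measure E).withDensity P)] :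
    Measure.pi (fun _ : Fin n => (volume : Measure E).withDensity P) =
      volume.withDensity fun v => ∏ i, P (v i) := by
  refine Measure.pi_eq fun s hs => ?_
  have hms : MeasurableSet (Set.univ.pi s) := MeasurableSet.univ_pi hs
  rw [withDensity_apply _ hms, ← lintegral_indicator hms]
  have h1 : ∀ v : Fin n → E, (Set.univ.pi s).indicator (fun v => ∏ i, P (v i)) v =
      ∏ i, (s i).indicator P (v i) := by
    intro v
    by_cases hv : v ∈ Set.univ.pi s
    · rw [Set.indicator_of_mem hv]
      exact Finset.prod_congr rfl fun i _ => (Set.indicator_of_mem (hv i trivial) _).symm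
    · rw [Set.indicator_of_notMem hv]
      simp only [Set.mem_pi, Set.mem_univ, true_implies, not_forall] at hv
      obtain ⟨i, hi⟩ := hv
      exact (Finset.prod_eq_zero (Finset.mem_univ i) (Set.indicator_of_notMem hi _)).symm
  simp_rw [h1]
  rw [lintegral_prod_apply fun i => hP.indicator (hs i)]
  refine Finset.prod_congr rfl fun i _ => ?_
  rw [lintegral_indicator (hs i), withDensity_apply _ (hs i)]

theorem gaussianTensor_eq_withDensity (m n p : ℕ) : gaussianTensor m n p =
    volume.withDensity fun T => ∏ i, ∏ j, ∏ k, gaussianPDF 0 1 (T i j k) := by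
  have h0 : gaussianReal 0 1 = volume.withDensity (gaussianPDF 0 1) :=
    gaussianReal_of_var_ne_zero 0 one_ne_zero
  have i0 : SigmaFinite ((volume : Measure ℝ).withDensity (gaussianPDF 0 1)) := by
    rw [← h0]; infer_instance
  have m0 : Measurable (gaussianPDF 0 1) := measurable_gaussianPDF 0 1
  have h1 := pi_withDensity p m0
  have m1 : Measurable fun v : Fin p → ℝ => ∏ k, gaussianPDF 0 1 (v k) :=
    Finset.measurable_prod _ fun i _ => m0.comp (measurable_pi_apply i)
  have i1 : SigmaFinite ((volume : Measure (Fin p → ℝ)).withDensity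
      fun v => ∏ k, gaussianPDF 0 1 (v k)) := by
    rw [← h1]; infer_instance
  have h2 := pi_withDensity n m1
  have m2 : Measurable fun v : Fin n → Fin p → ℝ => ∏ j, ∏ k, gaussianPDF 0 1 (v j k) :=
    Finset.measurable_prod _ fun i _ => m1.comp (measurable_pi_apply i)
  have i2 : SigmaFinite ((volume : Measure (Fin n → Fin p → ℝ)).withDensity
      fun v => ∏ j, ∏ k, gaussianPDF 0 1 (v j k)) := by
    rw [← h2]; infer_instance
  have h3 := pi_withDensity m m2
  rw [gaussianTensor, h0, h1, h2, h3]

/-- The density of a matrix with independent standard normal entries. -/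
noncomputable def gaussianMatrixPDF {m n : ℕ} (A : Matrix (Fin m) (Fin n) ℝ) : ℝ≥0∞ :=
  ∏ i, ∏ j, gaussianPDF 0 1 (A i j)

theorem gaussianMatrixPDF_eq {n : ℕ} (A : Matrix (Fin n) (Fin n) ℝ) : gaussianMatrixPDF A =
    ENNReal.ofReal ((√(2 * Real.pi))⁻¹ ^ (n * n) * Real.exp (-(A * Aᵀ).trace / 2)) := by
  have h : ∀ x : ℝ, gaussianPDF 0 1 x =
      ENNReal.ofReal ((√(2 * Real.pi))⁻¹ * Real.exp (-(x * x) / 2)) := by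
    intro x
    rw [gaussianPDF, gaussianPDFReal]
    congr 1
    simp [sq]
  simp only [gaussianMatrixPDF, h]
  have h' : ∀ i, ∏ j, ENNReal.ofReal ((√(2 * Real.pi))⁻¹ * Real.exp (-(A i j * A i j) / 2)) =
      ENNReal.ofReal (∏ j, (√(2 * Real.pi))⁻¹ * Real.exp (-(A i j * A i j) / 2)) := fun i =>
    (ENNReal.ofReal_prod_of_nonneg fun j _ => by positivity).symm
  simp_rw [h']
  rw [← ENNReal.ofReal_prod_of_nonneg fun i _ => Finset.prod_nonneg fun j _ => by positivity]
  congr 1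
  simp only [Finset.prod_mul_distrib, Finset.prod_const, Finset.card_univ, Fintype.card_fin,
    ← Real.exp_sum, ← pow_mul]
  congr 2
  simp only [Matrix.trace, Matrix.diag, Matrix.mul_apply, Matrix.transpose_apply, ← Finset.sum_div,
    Finset.sum_neg_distrib]

theorem measurable_gaussianMatrixPDF {m n : ℕ} :
    Measurable (gaussianMatrixPDF : Matrix (Fin m) (Fin n) ℝ → ℝ≥0∞) := by
  refine Finset.measurable_prod _ fun i _ => Finset.measurable_prod _ fun j _ => ?_
  exact (measurable_gaussianPDF 0 1).comp (Continuous.measurable (by fun_prop))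

theorem volume_preserving_tensorSlice (m n : ℕ) :
    MeasurePreserving (fun T : Tensor3 m n 2 => (tensorSlice T 0, tensorSlice T 1)) volume
      volume := by
  have e0 := volume_preserving_finTwoArrow ℝ
  have e1 := (volume_measurePreserving_arrowProdEquivProdArrow ℝ ℝ (Fin n)).comp
    (measurePreserving_pi (fun _ : Fin n => (volume : Measure (Fin 2 → ℝ)))
      (fun _ => (volume : Measure (ℝ × ℝ))) fun _ => e0)
  have e2 := (volume_measurePreserving_arrowProdEquivProdArrow (Fin n → ℝ) (Fin n → ℝ) (Fin m)).comp
    (measurePreserving_pi (fun _ : Fin m => (volume : Measure (Fin n → Fin 2 → ℝ)))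
      (fun _ => (volume : Measure ((Fin n → ℝ) × (Fin n → ℝ)))) fun _ => e1)
  exact e2

theorem lintegral_gaussianTensor {m n : ℕ}
    {f : Matrix (Fin m) (Fin n) ℝ × Matrix (Fin m) (Fin n) ℝ → ℝ≥0∞} (hf : Measurable f) :
    ∫⁻ T, f (tensorSlice T 0, tensorSlice T 1) ∂gaussianTensor m n 2 =
      ∫⁻ A, ∫⁻ B, gaussianMatrixPDF A * gaussianMatrixPDF B * f (A, B) := by
  have e := volume_preserving_tensorSlice m n
  have hw : Measurable fun z : Matrix (Fin m) (Fin n) ℝ × Matrix (Fin m) (Fin n) ℝ =>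
      gaussianMatrixPDF z.1 * gaussianMatrixPDF z.2 :=
    (measurable_gaussianMatrixPDF.comp measurable_fst).mul
      (measurable_gaussianMatrixPDF.comp measurable_snd)
  have hd : (fun T : Tensor3 m n 2 => ∏ i, ∏ j, ∏ k, gaussianPDF 0 1 (T i j k)) = fun T =>
      gaussianMatrixPDF (tensorSlice T 0) * gaussianMatrixPDF (tensorSlice T 1) := by
    ext T
    simp [gaussianMatrixPDF, tensorSlice, Fin.prod_univ_two, Finset.prod_mul_distrib]
  have h0 := lintegral_withDensity_eq_lintegral_mul (volume : Measure (Tensor3 m n 2))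
    (hw.comp e.measurable) (hf.comp e.measurable)
  rw [gaussianTensor_eq_withDensity, hd]
  refine h0.trans ?_
  have h1 := e.lintegral_comp (hw.mul hf)
  have h2 := lintegral_prod (μ := (volume : Measure (Matrix (Fin m) (Fin n) ℝ)))
    (ν := (volume : Measure (Matrix (Fin m) (Fin n) ℝ)))
    (fun z : Matrix (Fin m) (Fin n) ℝ × Matrix (Fin m) (Fin n) ℝ =>
      gaussianMatrixPDF z.1 * gaussianMatrixPDF z.2 * f z) (hw.mul hf).aemeasurable
  exact h1.trans h2

theorem measurable_inv_mul {n : ℕ} :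
    Measurable fun z : Matrix (Fin n) (Fin n) ℝ × Matrix (Fin n) (Fin n) ℝ => z.1⁻¹ * z.2 := by
  have h : ∀ z : Matrix (Fin n) (Fin n) ℝ × Matrix (Fin n) (Fin n) ℝ,
      z.1⁻¹ * z.2 = z.1.det⁻¹ • (z.1.adjugate * z.2) := by
    intro z
    rw [Matrix.inv_def, Ring.inverse_eq_inv', Matrix.smul_mul]
  simp_rw [h]
  refine measurable_pi_lambda _ fun i => measurable_pi_lambda _ fun j => ?_
  simp only [Matrix.smul_apply, smul_eq_mul]
  refine Measurable.mul (measurable_det.comp measurable_fst).inv ?_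
  refine Continuous.measurable ?_
  have : Continuous fun z : Matrix (Fin n) (Fin n) ℝ × Matrix (Fin n) (Fin n) ℝ =>
      z.1.adjugate * z.2 := (Continuous.matrix_adjugate continuous_fst).matrix_mul continuous_snd
  fun_prop

/-- The two exponents add up to `tr A(1 + XXᵀ)Aᵀ = tr (AC)(AC)ᵀ`. -/
theorem gaussianMatrixPDF_mul_gaussianMatrixPDF {n : ℕ} {X C : Matrix (Fin n) (Fin n) ℝ}
    (hC : 1 + X * Xᵀ = C * Cᵀ) (A : Matrix (Fin n) (Fin n) ℝ) :
    gaussianMatrixPDF A * gaussianMatrixPDF (A * X) =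
      ENNReal.ofReal ((√(2 * Real.pi))⁻¹ ^ (n * n)) * gaussianMatrixPDF (A * C) := by
  rw [gaussianMatrixPDF_eq, gaussianMatrixPDF_eq, gaussianMatrixPDF_eq,
    ← ENNReal.ofReal_mul (by positivity), ← ENNReal.ofReal_mul (by positivity)]
  congr 1
  have h : (A * C * (A * C)ᵀ).trace = (A * Aᵀ).trace + (A * X * (A * X)ᵀ).trace := by
    rw [← Matrix.trace_add]
    congr 1
    calc A * C * (A * C)ᵀ = A * (C * Cᵀ) * Aᵀ := by
          rw [Matrix.transpose_mul]; simp only [Matrix.mul_assoc]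
      _ = _ := by
          rw [← hC, Matrix.transpose_mul, Matrix.mul_add, Matrix.add_mul, Matrix.mul_one]
          simp only [Matrix.mul_assoc]
  rw [h, neg_add, add_div, Real.exp_add]
  ring

/-- Substituting `B = AX` brings in `|det A| ^ n`. With `1 + XXᵀ = CCᵀ`, the further substitution `A
↦ AC⁻¹` makes the integral over `A` independent of `X`. The constant need not be evaluated. -/
theorem gaussianTensor_quotient_eq_const_mul {n : ℕ} : ∃ κ : ℝ≥0∞,
    ∀ D : Set (Matrix (Fin n) (Fin n) ℝ), MeasurableSet D →
      gaussianTensor n n 2 {T | (tensorSlice T 0)⁻¹ * tensorSlice T 1 ∈ D} =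
        κ * ∫⁻ X in D, ENNReal.ofReal ((1 + Xᵀ * X).det ^ (-(n : ℝ))) := by
  refine ⟨ENNReal.ofReal ((√(2 * Real.pi))⁻¹ ^ (n * n)) * ∫⁻ A : Matrix (Fin n) (Fin n) ℝ,
    gaussianMatrixPDF A * ENNReal.ofReal |A.det| ^ n, fun D hD => ?_⟩
  have hmw := measurable_gaussianMatrixPDF (m := n) (n := n)
  have hmd : Measurable fun A : Matrix (Fin n) (Fin n) ℝ => ENNReal.ofReal |A.det| ^ n :=
    (ENNReal.measurable_ofReal.comp
      (continuous_abs.measurable.comp measurable_det)).pow_const _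
  have hms : MeasurableSet
      {z : Matrix (Fin n) (Fin n) ℝ × Matrix (Fin n) (Fin n) ℝ | z.1⁻¹ * z.2 ∈ D} :=
    measurable_inv_mul hD
  have hmi := measurable_one.indicator hms (β := ℝ≥0∞)
  have hsl := (volume_preserving_tensorSlice n n).measurable
  have h1 : gaussianTensor n n 2 {T | (tensorSlice T 0)⁻¹ * tensorSlice T 1 ∈ D} =
      ∫⁻ T, {z : Matrix (Fin n) (Fin n) ℝ × Matrix (Fin n) (Fin n) ℝ | z.1⁻¹ * z.2 ∈ D}.indicator 1
        (tensorSlice T 0, tensorSlice T 1) ∂gaussianTensor n n 2 :=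
    (lintegral_indicator_one (hsl hms)).symm
  rw [h1, lintegral_gaussianTensor hmi]
  have h2 : ∀ᵐ A : Matrix (Fin n) (Fin n) ℝ, ∫⁻ B, gaussianMatrixPDF A * gaussianMatrixPDF B *
      {z : Matrix (Fin n) (Fin n) ℝ × Matrix (Fin n) (Fin n) ℝ | z.1⁻¹ * z.2 ∈ D}.indicator 1
        (A, B) = ∫⁻ X, gaussianMatrixPDF A * gaussianMatrixPDF (A * X) * ENNReal.ofReal |A.det| ^ n *
          D.indicator 1 X := by
    filter_upwards [ae_det_ne_zero n] with A hA
    have hm : Measurable fun B => gaussianMatrixPDF A * gaussianMatrixPDF B *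
      {z : Matrix (Fin n) (Fin n) ℝ × Matrix (Fin n) (Fin n) ℝ | z.1⁻¹ * z.2 ∈ D}.indicator 1
        (A, B) := (hmw.const_mul _).mul (hmi.comp measurable_prodMk_left)
    have h3 := lintegral_mul_left hA hm
    have h4 : ENNReal.ofReal |A.det| ^ n * ENNReal.ofReal |A.det|⁻¹ ^ n = 1 := by
      rw [← mul_pow, ← ENNReal.ofReal_mul (abs_nonneg _), mul_inv_cancel₀ (abs_ne_zero.2 hA)]
      simp
    have h5 := congrArg (fun r => ENNReal.ofReal |A.det| ^ n * r) h3
    simp only [← mul_assoc, h4, one_mul] at h5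
    rw [← h5, ← lintegral_const_mul' _ _ (by finiteness)]
    refine lintegral_congr fun X => ?_
    have h6 : {z : Matrix (Fin n) (Fin n) ℝ × Matrix (Fin n) (Fin n) ℝ |
        z.1⁻¹ * z.2 ∈ D}.indicator (1 : Matrix (Fin n) (Fin n) ℝ × Matrix (Fin n) (Fin n) ℝ → ℝ≥0∞)
          (A, A * X) = D.indicator 1 X := by
      have h6' : A⁻¹ * (A * X) = X := Matrix.nonsing_inv_mul_cancel_left _ _ hA.isUnit
      by_cases hX : X ∈ D
      · rw [Set.indicator_of_mem hX, Set.indicator_of_mem (by simpa [h6'] using hX)]; rfl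
      · rw [Set.indicator_of_notMem hX, Set.indicator_of_notMem (by simpa [h6'] using hX)]
    rw [h6]
    ring
  rw [lintegral_congr_ae h2, lintegral_lintegral_swap]
  swap
  · refine Measurable.aemeasurable ?_
    refine Measurable.mul (Measurable.mul (Measurable.mul (hmw.comp measurable_fst) (hmw.comp ?_))
      (hmd.comp measurable_fst)) ((measurable_one.indicator hD).comp measurable_snd)
    exact (continuous_fst.matrix_mul continuous_snd).measurable
  rw [← lintegral_indicator hD, ← lintegral_const_mul]
  swap
  · refine Measurable.indicator (ENNReal.measurable_ofReal.comp (Measurable.pow_const ?_ _)) hD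
    exact measurable_det.comp (f := fun X : Matrix (Fin n) (Fin n) ℝ => 1 + Xᵀ * X)
      (Continuous.measurable (by fun_prop))
  refine lintegral_congr fun X => ?_
  by_cases hX : X ∈ D
  swap
  · simp [hX]
  simp only [Set.indicator_of_mem hX, Pi.one_apply, mul_one]
  have hW : (1 + X * Xᵀ).PosDef := by
    simpa using posDef_one_add_transpose_mul_self Xᵀ
  obtain ⟨C, hC, hWC⟩ := hW.exists_mul_transpose
  have h7 : ∀ A : Matrix (Fin n) (Fin n) ℝ,
      gaussianMatrixPDF A * gaussianMatrixPDF (A * X) * ENNReal.ofReal |A.det| ^ n =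
      ENNReal.ofReal ((√(2 * Real.pi))⁻¹ ^ (n * n)) * ENNReal.ofReal |C.det|⁻¹ ^ n *
        (gaussianMatrixPDF (A * C) * ENNReal.ofReal |(A * C).det| ^ n) := by
    intro A
    have h8 : ENNReal.ofReal |A.det| ^ n =
        ENNReal.ofReal |C.det|⁻¹ ^ n * ENNReal.ofReal |(A * C).det| ^ n := by
      rw [← mul_pow, ← ENNReal.ofReal_mul (by positivity), Matrix.det_mul, abs_mul,
        mul_comm |A.det|, inv_mul_cancel_left₀ (abs_ne_zero.2 hC)]
    rw [gaussianMatrixPDF_mul_gaussianMatrixPDF hWC, h8]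
    ring
  simp_rw [h7]
  have h10 : Measurable fun A : Matrix (Fin n) (Fin n) ℝ =>
      gaussianMatrixPDF A * ENNReal.ofReal |A.det| ^ n := hmw.mul hmd
  rw [lintegral_const_mul' _ _ (by finiteness), lintegral_mul_right hC h10]
  -- One factor comes from rewriting `|det A| ^ n` through `AC`, the other from the Jacobian of `A ↦
  -- AC`.
  have h9 : ENNReal.ofReal |C.det|⁻¹ ^ n * ENNReal.ofReal |C.det|⁻¹ ^ n =
      ENNReal.ofReal ((1 + Xᵀ * X).det ^ (-(n : ℝ))) := by
    rw [Matrix.det_one_add_mul_comm, hWC, Matrix.det_mul, Matrix.det_transpose, ← mul_pow,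
      ← ENNReal.ofReal_mul (by positivity), ← ENNReal.ofReal_pow (by positivity), ← mul_inv,
      abs_mul_abs_self, Real.rpow_neg (mul_self_nonneg _), Real.rpow_natCast, inv_pow]
  calc _ = ENNReal.ofReal ((√(2 * Real.pi))⁻¹ ^ (n * n)) *
        (ENNReal.ofReal |C.det|⁻¹ ^ n * ENNReal.ofReal |C.det|⁻¹ ^ n) *
        ∫⁻ A : Matrix (Fin n) (Fin n) ℝ, gaussianMatrixPDF A * ENNReal.ofReal |A.det| ^ n := by
        ring
    _ = _ := by rw [h9]; ring

/-- The total mass of `det (1 + XᵀX)^(-n)` over `n × n` matrices. -/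
noncomputable def matrixCauchyMass (n : ℕ) : ℝ :=
  ∏ j ∈ Finset.range n, japaneseConst n ((n : ℝ) - j / 2)

theorem matrixCauchyMass_pos (n : ℕ) : 0 < matrixCauchyMass n := by
  refine Finset.prod_pos fun j hj => japaneseConst_pos ?_
  have : (j : ℝ) + 1 ≤ n := by exact_mod_cast Finset.mem_range.1 hj
  linarith

instance isProbabilityMeasure_gaussianTensor (m n p : ℕ) :
    IsProbabilityMeasure (gaussianTensor m n p) := by
  unfold gaussianTensor; infer_instance

/-- The unknown constant is fixed by total probability: taking `D` to be everything, the integral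
equals `matrixCauchyMass n`. -/
theorem gaussianTensor_quotient {n : ℕ} {D : Set (Matrix (Fin n) (Fin n) ℝ)}
    (hD : MeasurableSet D) :
    gaussianTensor n n 2 {T | (tensorSlice T 0)⁻¹ * tensorSlice T 1 ∈ D} =
      (ENNReal.ofReal (matrixCauchyMass n))⁻¹ *
        ∫⁻ X in D, ENNReal.ofReal ((1 + Xᵀ * X).det ^ (-(n : ℝ))) := by
  obtain ⟨κ, hκ⟩ := gaussianTensor_quotient_eq_const_mul (n := n)
  have h1 := hκ Set.univ MeasurableSet.univ
  rw [Measure.restrict_univ, lintegral_det_add_transpose_mul_self_rpow Matrix.PosDef.one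
    (by linarith)] at h1
  simp only [Set.mem_univ, Set.ofPred_true, measure_univ, Matrix.det_one, Real.one_rpow,
    one_mul] at h1
  rw [hκ D hD, ENNReal.eq_inv_of_mul_eq_one_left h1.symm]
  rfl

theorem rankProb_eq (n : ℕ) : ENNReal.ofReal (rankProb n) =
    (ENNReal.ofReal (matrixCauchyMass n))⁻¹ * (ENNReal.ofReal (eigenvalueConst n n) *
      ∫⁻ l : Fin n → ℝ, cauchyDensity (((n : ℝ) + 1) / 2) l) := by
  have hsl := (volume_preserving_tensorSlice n n).measurable
  have hae0 : ∀ᵐ T ∂gaussianTensor n n 2, (tensorSlice T 0).det ≠ 0 := by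
    have hms : MeasurableSet {z : Matrix (Fin n) (Fin n) ℝ × Matrix (Fin n) (Fin n) ℝ |
        z.1.det = 0} :=
      measurableSet_eq_fun (measurable_det.comp measurable_fst) measurable_const
    have hmi := measurable_one.indicator hms (β := ℝ≥0∞)
    have h1 : gaussianTensor n n 2 {T | (tensorSlice T 0).det = 0} =
        ∫⁻ T, {z : Matrix (Fin n) (Fin n) ℝ × Matrix (Fin n) (Fin n) ℝ | z.1.det = 0}.indicator 1
          (tensorSlice T 0, tensorSlice T 1) ∂gaussianTensor n n 2 :=
      (lintegral_indicator_one (hsl hms)).symm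
    rw [lintegral_gaussianTensor hmi] at h1
    have h2 : ∀ᵐ A : Matrix (Fin n) (Fin n) ℝ, ∫⁻ B, gaussianMatrixPDF A * gaussianMatrixPDF B *
        {z : Matrix (Fin n) (Fin n) ℝ × Matrix (Fin n) (Fin n) ℝ | z.1.det = 0}.indicator 1
          (A, B) = 0 := by
      filter_upwards [ae_det_ne_zero n] with A hA
      simp [hA]
    rw [lintegral_congr_ae h2, lintegral_zero] at h1
    rw [ae_iff]
    simpa using h1
  have hae1 : ∀ᵐ T ∂gaussianTensor n n 2,
      IsRealDiagonalizable ((tensorSlice T 0)⁻¹ * tensorSlice T 1) ↔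
        (tensorSlice T 0)⁻¹ * tensorSlice T 1 ∈ simpleSpectrum n := by
    have h1 := ae_iff.1 (ae_isRealDiagonalizable_iff n)
    set B := {X : Matrix (Fin n) (Fin n) ℝ | ¬(IsRealDiagonalizable X ↔ X ∈ simpleSpectrum n)}
    -- The exceptional set is null but not known to be measurable, so the density formula is applied
    -- to its measurable hull.
    have h2 := gaussianTensor_quotient (measurableSet_toMeasurable volume B)
    have h3 : volume.restrict (toMeasurable volume B) = 0 := by
      rw [Measure.restrict_eq_zero, measure_toMeasurable, h1]
    rw [h3, lintegral_zero_measure, mul_zero] at h2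
    rw [ae_iff]
    exact measure_mono_null (fun T hT => subset_toMeasurable volume B hT) h2
  have h1 : gaussianTensor n n 2 {T | tensorRank T = n} =
      gaussianTensor n n 2 {T | (tensorSlice T 0)⁻¹ * tensorSlice T 1 ∈ simpleSpectrum n} := by
    refine measure_congr ?_
    filter_upwards [hae0, hae1] with T h2 h3
    exact propext ((tensorRank_eq_iff h2).trans h3)
  have h2 := setLIntegral_simpleSpectrum_eigenvalues (n := n) (s := n) (by
    have : (0 : ℝ) ≤ n := by positivity
    linarith) (g := fun _ => 1) measurable_const
  simp only [one_mul] at h2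
  rw [rankProb, ofReal_measureReal, h1, gaussianTensor_quotient (measurableSet_simpleSpectrum n),
    h2, show (n : ℝ) - ((n : ℝ) - 1) / 2 = ((n : ℝ) + 1) / 2 by ring]

/-! ### Signs of permutations and Pfaffians -/

section pairing
variable {m : ℕ} {K : Type*}

/-- Exchange the two members of every pair. -/
def pairSwap : (Fin m × Bool) ⊕ K → (Fin m × Bool) ⊕ K
  | .inl (i, b) => .inl (i, !b)
  | .inr k => .inr k

/-- The position of an index when consecutive pairs come first. -/
def pairRank : (Fin m × Bool) ⊕ K → ℕ
  | .inl (i, b) => 2 * i + b.toNat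
  | .inr _ => 2 * m

/-- The permutations which map pairs to pairs. -/
def PreservesPairs (σ : Equiv.Perm ((Fin m × Bool) ⊕ K)) : Prop :=
  ∀ z, σ (pairSwap z) = pairSwap (σ z)

/-- The sign recording which pairs are reversed by `σ`. -/
def pairSign (σ : Equiv.Perm ((Fin m × Bool) ⊕ K)) : ℤ :=
  ∏ i : Fin m, ((pairRank (σ (.inl (i, true))) : ℤ) - pairRank (σ (.inl (i, false)))).sign

theorem pairRank_injective [Subsingleton K] :
    Function.Injective (pairRank : (Fin m × Bool) ⊕ K → ℕ) := by
  rintro (⟨i, b⟩ | k) (⟨j, c⟩ | k') h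
  · simp only [pairRank] at h
    have hij : i = j := by
      ext
      cases b <;> cases c <;> simp at h <;> omega
    subst hij
    cases b <;> cases c <;> simp_all
  · simp only [pairRank] at h
    have := i.2
    cases b <;> simp at h <;> omega
  · simp only [pairRank] at h
    have := j.2
    cases c <;> simp at h <;> omega
  · rw [Subsingleton.elim k k']

/-- An unpaired index, of which there is at most one, is the only fixed point of `pairSwap`, so it
is fixed by `σ`. The rest of `σ` permutes the pairs by `π` and acts inside each of them by `ε`. -/
theorem PreservesPairs.exists_decomposition [Subsingleton K]
    {σ : Equiv.Perm ((Fin m × Bool) ⊕ K)} (hσ : PreservesPairs σ) :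
    ∃ (π : Equiv.Perm (Fin m)) (ε : Fin m → Equiv.Perm Bool),
      (∀ i b, σ (.inl (i, b)) = .inl (π i, ε i b)) ∧ ∀ k, σ (.inr k) = .inr k := by
  have hr : ∀ k, σ (.inr k) = .inr k := by
    intro k
    have h := hσ (.inr k)
    rcases hk : σ (.inr k) with ⟨i, b⟩ | k'
    · simp [pairSwap, hk] at h
    · rw [Subsingleton.elim k k']
  have hl : ∀ z, ∃ z', σ (.inl z) = .inl z' := by
    intro z
    rcases hz : σ (.inl z) with z' | k
    · exact ⟨z', rfl⟩
    · rw [← hr k] at hz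
      exact absurd (σ.injective hz) (by simp)
  choose f hf using hl
  have hft : ∀ i b, f (i, !b) = ((f (i, b)).1, !(f (i, b)).2) := by
    intro i b
    have h := hσ (.inl (i, b))
    rw [hf] at h
    simp only [pairSwap, hf] at h
    exact Sum.inl_injective h
  have hfi : Function.Injective f := by
    intro z z' h
    have : σ (.inl z) = σ (.inl z') := by rw [hf, hf, h]
    exact Sum.inl_injective (σ.injective this)
  have hπ : Function.Injective fun i => (f (i, false)).1 := by
    intro i j h
    simp only at h
    by_cases h2 : (f (i, false)).2 = (f (j, false)).2
    · exact congrArg Prod.fst (hfi (Prod.ext h h2))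
    · have h3 : f (i, !false) = f (j, false) := by
        rw [hft]
        refine Prod.ext h ?_
        revert h2
        cases (f (i, false)).2 <;> cases (f (j, false)).2 <;> simp
      exact congrArg Prod.fst (hfi h3)
  refine ⟨Equiv.ofBijective _ hπ.bijective_of_finite,
    fun i => if (f (i, false)).2 then Equiv.boolNot else 1, fun i b => ?_, hr⟩
  rw [hf]
  congr 1
  cases b
  · refine Prod.ext rfl ?_
    cases h : (f (i, false)).2 <;> simp [h]
  · have h1 : f (i, true) = _ := hft i false
    rw [h1]
    refine Prod.ext rfl ?_
    cases h : (f (i, false)).2 <;> simp [h]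

theorem sign_sub_pairRank (i : Fin m) (ε : Equiv.Perm Bool) :
    ((pairRank (.inl (i, ε true) : (Fin m × Bool) ⊕ K) : ℤ) -
      pairRank (.inl (i, ε false) : (Fin m × Bool) ⊕ K)).sign = Equiv.Perm.sign ε := by
  have h : ε = 1 ∨ ε = Equiv.swap true false := by
    revert ε; decide
  rcases h with rfl | rfl
  · simp [pairRank]
  · rw [Equiv.Perm.sign_swap (by decide)]
    simp [pairRank]

/-- Reformulated by preimages, failure can be located at a pair `j` of values; the cancelling
involution exchanges the two values of such a pair. -/
theorem preservesPairs_iff_symm [Subsingleton K] (σ : Equiv.Perm ((Fin m × Bool) ⊕ K)) :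
    PreservesPairs σ ↔
      ∀ j, σ.symm (.inl (j, true)) = pairSwap (σ.symm (.inl (j, false))) := by
  have hinv : ∀ z : (Fin m × Bool) ⊕ K, pairSwap (pairSwap z) = z := by
    rintro (⟨i, b⟩ | k) <;> simp [pairSwap]
  constructor
  · intro h j
    rw [Equiv.symm_apply_eq, h, Equiv.apply_symm_apply]
    rfl
  · intro h z
    have h1 : ∀ j b, σ (pairSwap (σ.symm (.inl (j, b)))) = .inl (j, !b) := by
      intro j b
      cases b
      · rw [← h j, Equiv.apply_symm_apply]; rfl
      · rw [h j, hinv, Equiv.apply_symm_apply]; rfl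
    rcases hz : σ z with ⟨j, b⟩ | k
    · have h2 := h1 j b
      rw [← hz, Equiv.symm_apply_apply] at h2
      rw [h2]; rfl
    · rcases hz' : σ (pairSwap z) with ⟨j, b⟩ | k'
      · have h2 := h1 j b
        rw [← hz', Equiv.symm_apply_apply, hinv, hz] at h2
        exact absurd h2 (by simp)
      · rw [Subsingleton.elim k' k]; rfl

variable [Fintype K] [DecidableEq K]

/-- Permuting whole pairs is even, since it acts identically on both members. Hence the sign of `σ`
counts the reversed pairs, and so does `pairSign`. -/
theorem PreservesPairs.sign_mul_pairSign [Subsingleton K]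
    {σ : Equiv.Perm ((Fin m × Bool) ⊕ K)} (hσ : PreservesPairs σ) :
    (Equiv.Perm.sign σ : ℤ) * pairSign σ = 1 := by
  obtain ⟨π, ε, h1, h2⟩ := hσ.exists_decomposition
  have hσ' : σ = Equiv.Perm.sumCongr
      (Equiv.prodCongrLeft (fun _ => π) * Equiv.prodCongrRight ε) (1 : Equiv.Perm K) := by
    ext z
    rcases z with ⟨i, b⟩ | k
    · rw [h1]; rfl
    · rw [h2]; rfl
  have hs : Equiv.Perm.sign σ = ∏ i, Equiv.Perm.sign (ε i) := by
    rw [hσ', Equiv.Perm.sign_sumCongr, Equiv.Perm.sign_mul, Equiv.Perm.sign_prodCongrLeft,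
      Equiv.Perm.sign_prodCongrRight]
    simp
  have hp : pairSign σ = ∏ i, (Equiv.Perm.sign (ε i) : ℤ) := by
    refine Finset.prod_congr rfl fun i _ => ?_
    rw [h1, h1, sign_sub_pairRank]
  rw [hs, hp]
  push_cast
  rw [← Finset.prod_mul_distrib]
  refine Finset.prod_eq_one fun i _ => ?_
  rcases Int.units_eq_one_or (Equiv.Perm.sign (ε i)) with h | h <;> simp [h]

/-- A sign-reversing involution: follow `σ` by the transposition of the two values of its first bad
pair. These values have consecutive ranks and are not taken on one common pair, so no pair changes
its order and `pairSign` is unchanged. -/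
theorem sum_sign_mul_pairSign_not_preservesPairs [Subsingleton K]
    [DecidablePred (PreservesPairs : Equiv.Perm ((Fin m × Bool) ⊕ K) → Prop)] :
    ∑ σ : Equiv.Perm ((Fin m × Bool) ⊕ K) with ¬ PreservesPairs σ,
      (Equiv.Perm.sign σ : ℤ) * pairSign σ = 0 := by
  classical
  let bad : Equiv.Perm ((Fin m × Bool) ⊕ K) → Finset (Fin m) := fun σ =>
    Finset.univ.filter fun j => σ.symm (.inl (j, true)) ≠ pairSwap (σ.symm (.inl (j, false)))
  have hbad : ∀ σ, ¬ PreservesPairs σ ↔ (bad σ).Nonempty := by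
    intro σ
    rw [preservesPairs_iff_symm, not_forall]
    simp [bad, Finset.Nonempty]
  let s : Fin m → Equiv.Perm ((Fin m × Bool) ⊕ K) := fun j =>
    Equiv.swap (.inl (j, false)) (.inl (j, true))
  have hinv : ∀ z : (Fin m × Bool) ⊕ K, pairSwap (pairSwap z) = z := by
    rintro (⟨i, b⟩ | k) <;> simp [pairSwap]
  have hbads : ∀ σ j, bad (s j * σ) = bad σ := by
    intro σ j
    ext i
    simp only [bad, Finset.mem_filter, Finset.mem_univ, true_and]
    have hsy : ∀ z, (s j * σ).symm z = σ.symm (s j z) := by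
      intro z
      rw [Equiv.symm_apply_eq]
      simp [s]
    rw [hsy, hsy]
    by_cases hij : i = j
    · subst hij
      simp only [s, Equiv.swap_apply_left, Equiv.swap_apply_right]
      constructor
      · intro h1 h2; apply h1; rw [h2, hinv]
      · intro h1 h2; apply h1; rw [h2, hinv]
    · have e1 : s j (.inl (i, true)) = .inl (i, true) :=
        Equiv.swap_apply_of_ne_of_ne (by simp) (by simp [hij])
      have e2 : s j (.inl (i, false)) = .inl (i, false) :=
        Equiv.swap_apply_of_ne_of_ne (by simp [hij]) (by simp)
      rw [e1, e2]
  let g : ∀ σ ∈ Finset.univ.filter fun σ : Equiv.Perm ((Fin m × Bool) ⊕ K) => ¬ PreservesPairs σ,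
      Equiv.Perm ((Fin m × Bool) ⊕ K) := fun σ hσ =>
    s ((bad σ).min' ((hbad σ).1 (Finset.mem_filter.1 hσ).2)) * σ
  have hg : ∀ σ hσ, ∃ j ∈ bad σ, g σ hσ = s j * σ := fun σ hσ =>
    ⟨_, Finset.min'_mem _ _, rfl⟩
  refine Finset.sum_involution g ?_ ?_ ?_ ?_
  · intro σ hσ
    obtain ⟨j, hj, hgj⟩ := hg σ hσ
    rw [hgj]
    have hsgn : (Equiv.Perm.sign (s j * σ) : ℤ) = -Equiv.Perm.sign σ := by
      rw [Equiv.Perm.sign_mul, Equiv.Perm.sign_swap (by simp)]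
      simp
    have hps : pairSign (s j * σ) = pairSign σ := by
      refine Finset.prod_congr rfl fun i _ => ?_
      -- Exchanging consecutive ranks can reverse only the comparison of those two values; badness
      -- of `j` excludes that they occur together on pair `i`.
      have hne : ∀ c : Bool, ¬ (σ (.inl (i, !c)) = .inl (j, false) ∧ σ (.inl (i, c)) = .inl (j, true)) := by
        rintro c ⟨h1, h2⟩
        simp only [bad, Finset.mem_filter, Finset.mem_univ, true_and] at hj
        apply hj
        rw [← h1, ← h2, Equiv.symm_apply_apply, Equiv.symm_apply_apply]
        simp [pairSwap]
      have hcase : ∀ z, (z ≠ .inl (j, false) ∧ z ≠ .inl (j, true) ∧ s j z = z ∧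
          pairRank z ≠ 2 * j ∧ pairRank z ≠ 2 * j + 1) ∨
          (z = .inl (j, false) ∧ s j z = .inl (j, true)) ∨
          (z = .inl (j, true) ∧ s j z = .inl (j, false)) := by
        intro z
        by_cases h1 : z = .inl (j, false)
        · right; left; exact ⟨h1, by rw [h1]; exact Equiv.swap_apply_left _ _⟩
        · by_cases h2 : z = .inl (j, true)
          · right; right; exact ⟨h2, by rw [h2]; exact Equiv.swap_apply_right _ _⟩
          · left
            refine ⟨h1, h2, Equiv.swap_apply_of_ne_of_ne h1 h2, fun h => h1 ?_, fun h => h2 ?_⟩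
            · exact pairRank_injective (by simpa [pairRank] using h)
            · exact pairRank_injective (by simpa [pairRank] using h)
      have hrf : pairRank (.inl (j, false) : (Fin m × Bool) ⊕ K) = 2 * j := by simp [pairRank]
      have hrt : pairRank (.inl (j, true) : (Fin m × Bool) ⊕ K) = 2 * j + 1 := by simp [pairRank]
      have h1 := hne true
      have h2 := hne false
      have h3 : σ (.inl (i, true)) ≠ σ (.inl (i, false)) := fun h => by
        simpa using σ.injective h
      simp only [Equiv.Perm.mul_apply]
      simp only [Bool.not_true, Bool.not_false] at h1 h2
      generalize σ (.inl (i, true)) = u at *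
      generalize σ (.inl (i, false)) = w at *
      have hsign : ∀ a b c d : ℤ, ((0 < a - b ↔ 0 < c - d) ∧ (a - b < 0 ↔ c - d < 0)) →
          (a - b).sign = (c - d).sign := by
        rintro a b c d ⟨h1, h2⟩
        rcases lt_trichotomy (a - b) 0 with h | h | h
        · rw [Int.sign_eq_neg_one_of_neg h, Int.sign_eq_neg_one_of_neg (h2.1 h)]
        · have : c - d = 0 := by omega
          rw [h, this]
        · rw [Int.sign_eq_one_of_pos h, Int.sign_eq_one_of_pos (h1.1 h)]
      rcases hcase u with ⟨-, -, hu1, hu2, hu3⟩ | ⟨hu1, hu2⟩ | ⟨hu1, hu2⟩ <;>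
        rcases hcase w with ⟨-, -, hw1, hw2, hw3⟩ | ⟨hw1, hw2⟩ | ⟨hw1, hw2⟩
      · rw [hu1, hw1]
      · rw [hu1, hw2, hw1, hrf, hrt]; apply hsign; omega
      · rw [hu1, hw2, hw1, hrf, hrt]; apply hsign; omega
      · rw [hw1, hu2, hu1, hrf, hrt]; apply hsign; omega
      · exact absurd (hu1.trans hw1.symm) h3
      · exact absurd ⟨hu1, hw1⟩ h2
      · rw [hw1, hu2, hu1, hrf, hrt]; apply hsign; omega
      · exact absurd ⟨hw1, hu1⟩ h1
      · exact absurd (hu1.trans hw1.symm) h3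
    rw [hsgn, hps]
    ring
  · intro σ hσ _ h
    obtain ⟨j, hj, hgj⟩ := hg σ hσ
    rw [hgj] at h
    have h1 : s j = 1 := mul_eq_right.1 h
    have h2 := congrArg Equiv.Perm.sign h1
    rw [Equiv.Perm.sign_swap (by simp)] at h2
    simp at h2
  · intro σ hσ
    obtain ⟨j, hj, hgj⟩ := hg σ hσ
    simp only [Finset.mem_filter, Finset.mem_univ, true_and]
    rw [hbad, hgj, hbads]
    exact ⟨j, hj⟩
  · intro σ hσ
    have hb : bad (g σ hσ) = bad σ := by
      obtain ⟨j, hj, hgj⟩ := hg σ hσ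
      rw [hgj, hbads]
    simp only [g] at hb ⊢
    simp only [hb, ← mul_assoc]
    simp [s]

/-- The Pfaffian of the sign kernel, up to the number of pair-preserving permutations. -/
theorem sum_sign_mul_pairSign [Subsingleton K]
    [DecidablePred (PreservesPairs : Equiv.Perm ((Fin m × Bool) ⊕ K) → Prop)] :
    ∑ σ : Equiv.Perm ((Fin m × Bool) ⊕ K), (Equiv.Perm.sign σ : ℤ) * pairSign σ =
      (Finset.univ.filter (PreservesPairs : Equiv.Perm ((Fin m × Bool) ⊕ K) → Prop)).card := by
  rw [← Finset.sum_filter_add_sum_filter_not _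
    (PreservesPairs : Equiv.Perm ((Fin m × Bool) ⊕ K) → Prop),
    sum_sign_mul_pairSign_not_preservesPairs, add_zero,
    Finset.sum_congr rfl fun σ hσ => (Finset.mem_filter.1 hσ).2.sign_mul_pairSign]
  simp

/-- The Pfaffian of a kernel that pairs each index only with its partner. -/
theorem sum_sign_mul_prod_kernel [Subsingleton K]
    [DecidablePred (PreservesPairs : Equiv.Perm ((Fin m × Bool) ⊕ K) → Prop)]
    {J : (Fin m × Bool) ⊕ K → (Fin m × Bool) ⊕ K → ℂ} {h : (Fin m × Bool) ⊕ K → ℂ}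
    (hJ : ∀ z z', .inl z' ≠ pairSwap (.inl z : (Fin m × Bool) ⊕ K) → J (.inl z) (.inl z') = 0)
    (hJ' : ∀ i, J (.inl (i, true)) (.inl (i, false)) = -J (.inl (i, false)) (.inl (i, true)))
    (hh : ∀ (_ : K) z, h (.inl z) = 0) :
    ∑ τ : Equiv.Perm ((Fin m × Bool) ⊕ K), ((Equiv.Perm.sign τ : ℤ) : ℂ) *
        ((∏ i, J (τ (.inl (i, false))) (τ (.inl (i, true)))) * ∏ k, h (τ (.inr k))) =
      (Finset.univ.filter (PreservesPairs : Equiv.Perm ((Fin m × Bool) ⊕ K) → Prop)).card *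
        ((∏ i, J (.inl (i, false)) (.inl (i, true))) * ∏ k, h (.inr k)) := by
  rw [← Finset.sum_filter_add_sum_filter_not _
    (PreservesPairs : Equiv.Perm ((Fin m × Bool) ⊕ K) → Prop)]
  have h0 : ∑ τ : Equiv.Perm ((Fin m × Bool) ⊕ K) with ¬ PreservesPairs τ,
      ((Equiv.Perm.sign τ : ℤ) : ℂ) *
        ((∏ i, J (τ (.inl (i, false))) (τ (.inl (i, true)))) * ∏ k, h (τ (.inr k))) = 0 := by
    refine Finset.sum_eq_zero fun τ hτ => ?_
    have hτ' := (Finset.mem_filter.1 hτ).2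
    -- If the unpaired index is fixed, some pair is sent to two indices that are not partners and
    -- `J` vanishes there; otherwise the factor `h` vanishes.
    by_cases hr : ∀ k, τ (.inr k) = .inr k
    · have hl : ∀ z, ∃ z', τ (.inl z) = .inl z' := by
        intro z
        rcases hz : τ (.inl z) with z' | k
        · exact ⟨z', rfl⟩
        · rw [← hr k] at hz
          exact absurd (τ.injective hz) (by simp)
      have hinv : ∀ z : (Fin m × Bool) ⊕ K, pairSwap (pairSwap z) = z := by
        rintro (⟨i, b⟩ | k) <;> simp [pairSwap]
      obtain ⟨i, hi⟩ : ∃ i, τ (.inl (i, true)) ≠ pairSwap (τ (.inl (i, false))) := by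
        by_contra hcon
        push Not at hcon
        apply hτ'
        rintro (⟨i, b⟩ | k)
        · cases b
          · exact hcon i
          · change τ (.inl (i, false)) = pairSwap (τ (.inl (i, true)))
            rw [hcon i, hinv]
        · simp [pairSwap, hr]
      obtain ⟨z, hz⟩ := hl (i, false)
      obtain ⟨z', hz'⟩ := hl (i, true)
      have : J (τ (.inl (i, false))) (τ (.inl (i, true))) = 0 := by
        rw [hz, hz'] at hi ⊢
        exact hJ z z' hi
      rw [Finset.prod_eq_zero (Finset.mem_univ i) this]
      simp
    · push Not at hr
      obtain ⟨k, hk⟩ := hr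
      have : h (τ (.inr k)) = 0 := by
        rcases hz : τ (.inr k) with z | k'
        · exact hh k z
        · exact absurd (hz.trans (by rw [Subsingleton.elim k' k])) hk
      rw [Finset.prod_eq_zero (Finset.mem_univ k) this]
      simp
  rw [h0, add_zero, Finset.sum_congr rfl (g := fun _ =>
    (∏ i, J (.inl (i, false)) (.inl (i, true))) * ∏ k, h (.inr k))]
  · simp
  intro τ hτ
  have hτ' := (Finset.mem_filter.1 hτ).2
  obtain ⟨π, ε, h1, h2⟩ := hτ'.exists_decomposition
  have hsig := hτ'.sign_mul_pairSign
  have h3 : ∏ i, J (τ (.inl (i, false))) (τ (.inl (i, true))) =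
      (pairSign τ : ℂ) * ∏ i, J (.inl (i, false)) (.inl (i, true)) := by
    rw [← Equiv.prod_comp π fun i => J (.inl (i, false)) (.inl (i, true)), pairSign, Int.cast_prod,
      ← Finset.prod_mul_distrib]
    refine Finset.prod_congr rfl fun i _ => ?_
    rw [h1, h1, sign_sub_pairRank]
    have h : ε i = 1 ∨ ε i = Equiv.swap true false := by
      generalize ε i = e
      revert e; decide
    rcases h with h | h
    · simp [h]
    · rw [h, Equiv.Perm.sign_swap (by decide)]
      simp [hJ']
  simp only [h2]
  rw [h3, ← mul_assoc, ← mul_assoc, ← Int.cast_mul, hsig]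
  simp

end pairing

/-! ### Integrals over ordered configurations by de Bruijn's method -/

theorem existsUnique_perm_strictMono {ι : Type*} {n : ℕ} (e : ι ≃ Fin n) {x : ι → ℝ} (hx : Function.Injective x) :
    ∃! σ : Equiv.Perm ι, StrictMono (x ∘ σ ∘ e.symm) := by
  refine ⟨e.trans ((Tuple.sort (x ∘ e.symm)).trans e.symm), ?_, ?_⟩
  · have h := (Tuple.monotone_sort (x ∘ e.symm)).strictMono_of_injective
      ((hx.comp e.symm.injective).comp (Equiv.injective _))
    have h2 : x ∘ (e.trans ((Tuple.sort (x ∘ e.symm)).trans e.symm)) ∘ e.symm =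
        (x ∘ e.symm) ∘ Tuple.sort (x ∘ e.symm) := by
      funext i; simp
    beta_reduce
    rw [h2]
    exact h
  · intro σ hσ
    have h := Tuple.unique_monotone (f := x ∘ e.symm) (σ := e.symm.trans (σ.trans e))
      (τ := Tuple.sort (x ∘ e.symm)) (by simpa [Function.comp_def] using hσ.monotone)
      (Tuple.monotone_sort _)
    ext i
    have h3 := congrFun h (e i)
    simpa using hx h3

section ordering
variable {ι : Type*} [Fintype ι] [DecidableEq ι] {n : ℕ}

/-- The integral over all configurations is a sum over the possible orderings. -/
theorem integral_eq_sum_setIntegral_strictMono (e : ι ≃ Fin n) (μ : Measure ℝ) [SigmaFinite μ]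
    {F : (ι → ℝ) → ℂ} (hF : Integrable F (Measure.pi fun _ => μ))
    (h0 : ∀ x, ¬ Function.Injective x → F x = 0) :
    ∫ x, F x ∂Measure.pi (fun _ => μ) = ∑ σ : Equiv.Perm ι,
      ∫ x in {x | StrictMono (x ∘ e.symm)}, F (x ∘ σ) ∂Measure.pi (fun _ => μ) := by
  have hO : MeasurableSet {x : ι → ℝ | StrictMono (x ∘ e.symm)} :=
    (measurableSet_strictMono n).preimage
      (measurable_pi_lambda _ fun i => measurable_pi_apply (e.symm i))
  set O := {x : ι → ℝ | StrictMono (x ∘ e.symm)} with hOdef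
  have h1 : ∀ σ : Equiv.Perm ι, ∫ x in O, F (x ∘ σ) ∂Measure.pi (fun _ => μ) =
      ∫ x, {x | x ∘ σ.symm ∈ O}.indicator F x ∂Measure.pi (fun _ => μ) := by
    intro σ
    have mp := measurePreserving_arrowCongr' (fun _ : ι => μ) (fun _ : ι => μ) σ
      (MeasurableEquiv.refl ℝ) fun _ => MeasurePreserving.id _
    rw [← integral_indicator hO, ← mp.integral_comp (MeasurableEquiv.measurableEmbedding _)]
    refine integral_congr_ae (ae_of_all _ fun x => ?_)
    have hx : MeasurableEquiv.arrowCongr' σ (MeasurableEquiv.refl ℝ) x = x ∘ σ.symm := rfl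
    simp only [hx, Set.indicator_apply, Set.mem_ofPred_eq]
    congr 2
    funext i
    simp
  have hm : ∀ σ : Equiv.Perm ι, MeasurableSet {x : ι → ℝ | x ∘ σ.symm ∈ O} := fun σ =>
    hO.preimage (measurable_pi_lambda _ fun i => measurable_pi_apply (σ.symm i))
  rw [Finset.sum_congr rfl fun σ _ => h1 σ, ← integral_finsetSum _ fun σ _ => hF.indicator (hm σ)]
  refine integral_congr_ae (ae_of_all _ fun x => ?_)
  beta_reduce
  by_cases hx : Function.Injective x
  · obtain ⟨σ, hσ, hu⟩ := existsUnique_perm_strictMono e hx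
    rw [Finset.sum_eq_single σ.symm]
    · exact (Set.indicator_of_mem (by simpa [hOdef, Function.comp_assoc] using hσ) _).symm
    · intro τ _ hτ
      refine Set.indicator_of_notMem (fun h => hτ ?_) _
      rw [← hu τ.symm (by simpa [hOdef, Function.comp_assoc] using h)]
      rfl
    · simp
  · rw [h0 x hx]
    refine (Finset.sum_eq_zero fun σ _ => ?_).symm
    rw [Set.indicator_apply, h0 x hx, ite_self]

end ordering

theorem measurable_sign : Measurable Real.sign := by
  unfold Real.sign
  exact Measurable.ite measurableSet_Iio measurable_const
    (Measurable.ite measurableSet_Ioi measurable_const measurable_const)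

theorem norm_ofReal_sign_le (r : ℝ) : ‖((Real.sign r : ℝ) : ℂ)‖ ≤ 1 := by
  rcases Real.sign_apply_eq r with h | h | h <;> rw [h] <;> simp

section pairing
variable {m : ℕ} {K : Type*} [Fintype K]

theorem pairRank_lt [Subsingleton K] (z : (Fin m × Bool) ⊕ K) :
    pairRank z < 2 * m + Fintype.card K := by
  rcases z with ⟨i, b⟩ | k
  · have := i.2
    cases b <;> simp [pairRank] <;> omega
  · have : 0 < Fintype.card K := Fintype.card_pos_iff.2 ⟨k⟩
    simp only [pairRank]; omega

/-- Enumeration of the index set with consecutive pairs first. -/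
noncomputable def pairEquiv (m : ℕ) (K : Type*) [Fintype K] [Subsingleton K] :
    (Fin m × Bool) ⊕ K ≃ Fin (2 * m + Fintype.card K) :=
  Equiv.ofBijective (fun z => ⟨pairRank z, pairRank_lt z⟩) <| by
    rw [Fintype.bijective_iff_injective_and_card]
    refine ⟨fun z w h => pairRank_injective (by simpa using h), ?_⟩
    simp; ring

theorem pairEquiv_apply [Subsingleton K] (z : (Fin m × Bool) ⊕ K) :
    (pairEquiv m K z : ℕ) = pairRank z := rfl

/-- Separating pairs of coordinates and the remaining coordinates preserves product measures. -/
theorem integral_prod_pairs (μ : Measure ℝ) [SigmaFinite μ] (f : Fin m → ℝ × ℝ → ℂ)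
    (g : K → ℝ → ℂ) :
    ∫ x : (Fin m × Bool) ⊕ K → ℝ, (∏ i, f i (x (.inl (i, false)), x (.inl (i, true)))) *
        ∏ k, g k (x (.inr k)) ∂Measure.pi (fun _ => μ) =
      (∏ i, ∫ z, f i z ∂(μ.prod μ)) * ∏ k, ∫ y, g k y ∂μ := by
  let T : (Fin m → ℝ × ℝ) × (K → ℝ) ≃ᵐ ((Fin m × Bool) ⊕ K → ℝ) :=
    { toFun := fun v z => match z with
        | .inl (i, false) => (v.1 i).1
        | .inl (i, true) => (v.1 i).2
        | .inr k => v.2 k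
      invFun := fun x => (fun i => (x (.inl (i, false)), x (.inl (i, true))), fun k => x (.inr k))
      left_inv := fun v => rfl
      right_inv := fun x => by
        funext z
        rcases z with ⟨i, _ | _⟩ | k <;> rfl
      measurable_toFun := by
        refine measurable_pi_lambda _ fun z => ?_
        rcases z with ⟨i, _ | _⟩ | k <;> simp only [Equiv.coe_fn_mk] <;> fun_prop
      measurable_invFun := by
        simp only [Equiv.symm_mk, Equiv.coe_fn_mk]
        fun_prop }
  have hT : MeasurePreserving T
      ((Measure.pi fun _ : Fin m => μ.prod μ).prod (Measure.pi fun _ : K => μ))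
      (Measure.pi fun _ => μ) := by
    refine ⟨T.measurable, (Measure.pi_eq fun s hs => ?_).symm⟩
    rw [Measure.map_apply T.measurable (MeasurableSet.univ_pi hs)]
    have : T ⁻¹' Set.univ.pi s = (Set.univ.pi fun i => s (.inl (i, false)) ×ˢ s (.inl (i, true))) ×ˢ
        (Set.univ.pi fun k => s (.inr k)) := by
      ext v
      simp only [Set.mem_preimage, Set.mem_univ_pi, Set.mem_prod, Sum.forall, Prod.forall,
        Bool.forall_bool]
      rfl
    rw [this, Measure.prod_prod, Measure.pi_pi, Measure.pi_pi, Fintype.prod_sum_type,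
      Fintype.prod_prod_type]
    simp [Measure.prod_prod, mul_comm]
  rw [← hT.integral_comp T.measurableEmbedding, ← integral_fintype_prod_eq_prod,
    ← integral_fintype_prod_eq_prod, ← integral_prod_mul]
  rfl

variable [DecidableEq K]

/-- The integral of a determinant over ordered configurations, when the associated antisymmetric
pairing is block diagonal. -/
theorem setIntegral_strictMono_det [Subsingleton K] (μ : Measure ℝ) [IsFiniteMeasure μ]
    {φ : (Fin m × Bool) ⊕ K → ℝ → ℂ} (hφm : ∀ z, Measurable (φ z)) (hφ : ∀ z x, ‖φ z x‖ ≤ 1)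
    {J : (Fin m × Bool) ⊕ K → (Fin m × Bool) ⊕ K → ℂ}
    (hJ : ∀ z w, J z w = ∫ y, φ z y.1 * φ w y.2 * (Real.sign (y.2 - y.1) : ℝ) ∂μ.prod μ)
    (hJ0 : ∀ z z', .inl z' ≠ pairSwap (.inl z : (Fin m × Bool) ⊕ K) → J (.inl z) (.inl z') = 0)
    (hJ1 : ∀ i, J (.inl (i, true)) (.inl (i, false)) = -J (.inl (i, false)) (.inl (i, true)))
    (hh : ∀ (_ : K) z, ∫ y, φ (.inl z) y ∂μ = 0) :
    ∫ x in {x | StrictMono (x ∘ (pairEquiv m K).symm)},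
        (Matrix.of fun k l => φ k (x l)).det ∂Measure.pi (fun _ => μ) =
      (∏ i, J (.inl (i, false)) (.inl (i, true))) * ∏ k, ∫ y, φ (.inr k) y ∂μ := by
  classical
  set M : Measure ((Fin m × Bool) ⊕ K → ℝ) := Measure.pi (fun _ => μ) with hM
  set O := {x : (Fin m × Bool) ⊕ K → ℝ | StrictMono (x ∘ (pairEquiv m K).symm)} with hO
  -- The integral of `D * Ψ` over all configurations is computed twice. Expanding the determinant
  -- factors it into values of `J`. Splitting by orderings gives the ordered integral of `D` times
  -- `∑ sign σ * pairSign σ`, since `Ψ` is constant on each ordering. The number of pair-preserving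
  -- permutations appears on both sides and cancels.
  let Ψ : ((Fin m × Bool) ⊕ K → ℝ) → ℂ := fun x =>
    ∏ i : Fin m, ((Real.sign (x (.inl (i, true)) - x (.inl (i, false))) : ℝ) : ℂ)
  let D : ((Fin m × Bool) ⊕ K → ℝ) → ℂ := fun x => (Matrix.of fun k l => φ k (x l)).det
  have hDΨ : ∀ x, D x * Ψ x = ∑ τ : Equiv.Perm ((Fin m × Bool) ⊕ K),
      ((Equiv.Perm.sign τ : ℤ) : ℂ) *
      ((∏ i, (fun y : ℝ × ℝ => φ (τ (.inl (i, false))) y.1 * φ (τ (.inl (i, true))) y.2 *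
        ((Real.sign (y.2 - y.1) : ℝ) : ℂ)) (x (.inl (i, false)), x (.inl (i, true)))) *
        ∏ k, φ (τ (.inr k)) (x (.inr k))) := by
    intro x
    simp only [D, Ψ, Matrix.det_apply', Finset.sum_mul, Matrix.of_apply]
    refine Finset.sum_congr rfl fun τ _ => ?_
    rw [Fintype.prod_sum_type, Fintype.prod_prod_type]
    simp only [Fintype.prod_bool, Finset.prod_mul_distrib]
    ring
  have hint : ∀ τ : Equiv.Perm ((Fin m × Bool) ⊕ K), Integrable (fun x =>
      ((Equiv.Perm.sign τ : ℤ) : ℂ) *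
      ((∏ i, (fun y : ℝ × ℝ => φ (τ (.inl (i, false))) y.1 * φ (τ (.inl (i, true))) y.2 *
        ((Real.sign (y.2 - y.1) : ℝ) : ℂ)) (x (.inl (i, false)), x (.inl (i, true)))) *
        ∏ k, φ (τ (.inr k)) (x (.inr k)))) M := by
    intro τ
    refine Integrable.const_mul (Integrable.of_bound ?_ 1 (ae_of_all _ fun x => ?_)) _
    · refine Measurable.aestronglyMeasurable ?_
      refine Measurable.mul (Finset.measurable_prod _ fun i _ => ?_)
        (Finset.measurable_prod _ fun k _ => ?_)
      · refine Measurable.mul (Measurable.mul ?_ ?_) ?_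
        · exact (hφm _).comp (measurable_pi_apply _)
        · exact (hφm _).comp (measurable_pi_apply _)
        · exact Complex.measurable_ofReal.comp
            (measurable_sign.comp ((measurable_pi_apply _).sub (measurable_pi_apply _)))
      · exact (hφm _).comp (measurable_pi_apply _)
    · rw [norm_mul, norm_prod, norm_prod]
      refine mul_le_one₀ (Finset.prod_le_one (fun _ _ => norm_nonneg _) fun i _ => ?_)
        (Finset.prod_nonneg fun _ _ => norm_nonneg _)
        (Finset.prod_le_one (fun _ _ => norm_nonneg _) fun k _ => hφ _ _)
      rw [norm_mul, norm_mul]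
      exact mul_le_one₀ (mul_le_one₀ (hφ _ _) (norm_nonneg _) (hφ _ _)) (norm_nonneg _) (norm_ofReal_sign_le _)
  have hI : ∫ x, D x * Ψ x ∂M =
      (Finset.univ.filter (PreservesPairs : Equiv.Perm ((Fin m × Bool) ⊕ K) → Prop)).card *
        ((∏ i, J (.inl (i, false)) (.inl (i, true))) * ∏ k, ∫ y, φ (.inr k) y ∂μ) := by
    rw [← sum_sign_mul_prod_kernel (J := J) (h := fun z => ∫ y, φ z y ∂μ) hJ0 hJ1 hh]
    simp only [hDΨ]
    rw [integral_finsetSum _ fun τ _ => hint τ]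
    refine Finset.sum_congr rfl fun τ _ => ?_
    rw [integral_const_mul]
    congr 1
    refine (integral_prod_pairs μ (fun i (y : ℝ × ℝ) => φ (τ (.inl (i, false))) y.1 *
      φ (τ (.inl (i, true))) y.2 * ((Real.sign (y.2 - y.1) : ℝ) : ℂ))
      fun k => φ (τ (.inr k))).trans ?_
    simp only [hJ]
  have hintF : Integrable (fun x => D x * Ψ x) M := by
    simp only [hDΨ]
    exact integrable_finsetSum _ fun τ _ => hint τ
  have h0 : ∀ x, ¬ Function.Injective x → D x * Ψ x = 0 := by
    intro x hx
    simp only [Function.Injective, not_forall] at hx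
    obtain ⟨k, l, hkl, hne⟩ := hx
    have : D x = 0 := Matrix.det_zero_of_column_eq hne fun z => by simp [hkl]
    rw [this, zero_mul]
  have hOm : MeasurableSet O := (measurableSet_strictMono _).preimage
      (measurable_pi_lambda _ fun i => measurable_pi_apply ((pairEquiv m K).symm i))
  have hsum := integral_eq_sum_setIntegral_strictMono (pairEquiv m K) μ hintF h0
  rw [← hM, hI] at hsum
  have hterm : ∀ σ : Equiv.Perm ((Fin m × Bool) ⊕ K),
      ∫ x in O, D (x ∘ σ) * Ψ (x ∘ σ) ∂M =
        (((Equiv.Perm.sign σ : ℤ) * pairSign σ : ℤ) : ℂ) * ∫ x in O, D x ∂M := by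
    intro σ
    rw [← integral_const_mul]
    refine setIntegral_congr_fun hOm fun x hx => ?_
    have hD : D (x ∘ σ) = ((Equiv.Perm.sign σ : ℤ) : ℂ) * D x := by
      simp only [D]
      rw [← Matrix.det_permute' σ]
      rfl
    have hlt : ∀ z w, pairRank z < pairRank w → x z < x w := by
      intro z w hzw
      have h := @hx (pairEquiv m K z) (pairEquiv m K w) (by
        rw [Fin.lt_def, pairEquiv_apply, pairEquiv_apply]; exact hzw)
      simpa using h
    have hΨ : Ψ (x ∘ σ) = (pairSign σ : ℂ) := by
      simp only [Ψ, pairSign, Int.cast_prod]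
      refine Finset.prod_congr rfl fun i _ => ?_
      have hne : σ (.inl (i, true)) ≠ σ (.inl (i, false)) := fun h => by
        simpa using σ.injective h
      simp only [Function.comp_apply]
      generalize σ (.inl (i, true)) = u at *
      generalize σ (.inl (i, false)) = w at *
      rcases lt_or_gt_of_ne (pairRank_injective.ne hne) with h | h
      · rw [Real.sign_of_neg (sub_neg.2 (hlt _ _ h)), Int.sign_eq_neg_one_of_neg (by omega)]
        simp
      · rw [Real.sign_of_pos (sub_pos.2 (hlt _ _ h)), Int.sign_eq_one_of_pos (by omega)]
        simp
    rw [hD, hΨ]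
    push_cast
    ring
  rw [Finset.sum_congr rfl fun σ _ => hterm σ, ← Finset.sum_mul, ← Int.cast_sum,
    sum_sign_mul_pairSign] at hsum
  have hc : ((Finset.univ.filter
      (PreservesPairs : Equiv.Perm ((Fin m × Bool) ⊕ K) → Prop)).card : ℂ) ≠ 0 := by
    rw [Nat.cast_ne_zero, Finset.card_ne_zero]
    exact ⟨1, Finset.mem_filter.2 ⟨Finset.mem_univ _, fun z => rfl⟩⟩
  push_cast at hsum
  exact (mul_left_cancel₀ hc hsum).symm

end pairing

/-! ### Pairings of exponentials on an interval of length `π` -/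

section characters

/-- Lebesgue measure on an interval of length `π`. -/
noncomputable def circleMeasure : Measure ℝ :=
  volume.restrict (Set.Ioo (-(Real.pi / 2)) (Real.pi / 2))

instance : IsFiniteMeasure circleMeasure := by
  unfold circleMeasure
  refine ⟨?_⟩
  rw [Measure.restrict_apply_univ, Real.volume_Ioo]
  exact ENNReal.ofReal_lt_top

theorem integral_circleMeasure (f : ℝ → ℂ) :
    ∫ x, f x ∂circleMeasure = ∫ x in (-(Real.pi / 2))..(Real.pi / 2), f x := by
  rw [circleMeasure, ← integral_Ioc_eq_integral_Ioo,
    intervalIntegral.integral_of_le (by linarith [Real.pi_pos])]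

theorem exp_intCast_mul_pi_div_two_sub {p : ℤ} (hp : Even p) :
    Complex.exp (p * Complex.I * (Real.pi / 2 : ℝ)) =
      Complex.exp (p * Complex.I * (-(Real.pi / 2) : ℝ)) := by
  obtain ⟨k, rfl⟩ := hp
  rw [Complex.exp_eq_exp_iff_exists_int]
  exact ⟨k, by push_cast; ring⟩

theorem exp_intCast_mul_pi_div_two_add {p : ℤ} (hp : Odd p) :
    Complex.exp (p * Complex.I * (Real.pi / 2 : ℝ)) +
      Complex.exp (p * Complex.I * (-(Real.pi / 2) : ℝ)) = 0 := by
  obtain ⟨k, rfl⟩ := hp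
  have : ((2 * k + 1 : ℤ) : ℂ) * Complex.I * (Real.pi / 2 : ℝ) =
      ((2 * k + 1 : ℤ) : ℂ) * Complex.I * (-(Real.pi / 2) : ℝ) + Real.pi * Complex.I +
        k * (2 * Real.pi * Complex.I) := by
    push_cast; ring
  rw [this, Complex.exp_periodic.int_mul k, Complex.exp_add, Complex.exp_pi_mul_I]
  ring

theorem integral_exp_circleMeasure {p : ℤ} (hp : Even p) :
    ∫ x : ℝ, Complex.exp (p * Complex.I * x) ∂circleMeasure =
      if p = 0 then (Real.pi : ℂ) else 0 := by
  rw [integral_circleMeasure]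
  split_ifs with h
  · subst h
    simp
  · have h2 : (p : ℂ) * Complex.I ≠ 0 := by simp [h]
    rw [integral_exp_mul_complex h2, exp_intCast_mul_pi_div_two_sub hp, sub_self, zero_div]

theorem integral_exp_mul_sign_circleMeasure {q : ℤ} (hq : q ≠ 0) {x : ℝ}
    (hx : x ∈ Set.Ioo (-(Real.pi / 2)) (Real.pi / 2)) :
    ∫ y : ℝ, Complex.exp (q * Complex.I * y) * (Real.sign (y - x) : ℝ) ∂circleMeasure =
      (Complex.exp (q * Complex.I * (Real.pi / 2 : ℝ)) +
        Complex.exp (q * Complex.I * (-(Real.pi / 2) : ℝ)) -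
        2 * Complex.exp (q * Complex.I * x)) / (q * Complex.I) := by
  have h2 : (q : ℂ) * Complex.I ≠ 0 := by simp [hq]
  have hc : Continuous fun y : ℝ => Complex.exp (q * Complex.I * y) := by fun_prop
  have hne : ∀ᵐ y : ℝ, y ≠ x := by
    rw [ae_iff]
    simp
  have e1 : ∀ᵐ y : ℝ, y ∈ Set.uIoc (-(Real.pi / 2)) x →
      Complex.exp (q * Complex.I * y) * (Real.sign (y - x) : ℝ) =
        -Complex.exp (q * Complex.I * y) := by
    filter_upwards [hne] with y hy hyx
    rw [Set.uIoc_of_le hx.1.le] at hyx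
    rw [Real.sign_of_neg (sub_neg.2 (lt_of_le_of_ne hyx.2 hy))]
    simp
  have e2 : ∀ᵐ y : ℝ, y ∈ Set.uIoc x (Real.pi / 2) →
      Complex.exp (q * Complex.I * y) * (Real.sign (y - x) : ℝ) =
        Complex.exp (q * Complex.I * y) := by
    refine ae_of_all _ fun y hyx => ?_
    rw [Set.uIoc_of_le hx.2.le] at hyx
    rw [Real.sign_of_pos (sub_pos.2 hyx.1)]
    simp
  have i1 : IntervalIntegrable (fun y : ℝ => Complex.exp (q * Complex.I * y) *
      (Real.sign (y - x) : ℝ)) volume (-(Real.pi / 2)) x :=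
    (hc.neg.intervalIntegrable _ _).congr_ae ((ae_restrict_iff' measurableSet_uIoc).2
      (e1.mono fun y hy h => (hy h).symm))
  have i2 : IntervalIntegrable (fun y : ℝ => Complex.exp (q * Complex.I * y) *
      (Real.sign (y - x) : ℝ)) volume x (Real.pi / 2) :=
    (hc.intervalIntegrable _ _).congr_ae ((ae_restrict_iff' measurableSet_uIoc).2
      (e2.mono fun y hy h => (hy h).symm))
  rw [integral_circleMeasure, ← intervalIntegral.integral_add_adjacent_intervals i1 i2,
    intervalIntegral.integral_congr_ae e1, intervalIntegral.integral_congr_ae e2,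
    intervalIntegral.integral_neg, integral_exp_mul_complex h2, integral_exp_mul_complex h2]
  ring

theorem norm_exp_intCast_mul_I_mul (p : ℤ) (x : ℝ) :
    ‖Complex.exp (p * Complex.I * x)‖ = 1 := by
  rw [show (p : ℂ) * Complex.I * x = ((p * x : ℝ) : ℂ) * Complex.I by push_cast; ring,
    Complex.norm_exp_ofReal_mul_I]

/-- The inner integral leaves a boundary term and a term in `exp (q i x)`. The boundary term drops
out in either parity: for odd `q` the two endpoint values cancel, for even `q` also `p` is even and
nonzero and its exponential integrates to zero. The other term is orthogonality. -/
theorem integral_exp_mul_exp_mul_sign {p q : ℤ} (hp : p ≠ 0) (hq : q ≠ 0) (hpq : Even (p + q)) :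
    ∫ y : ℝ × ℝ, Complex.exp (p * Complex.I * y.1) * Complex.exp (q * Complex.I * y.2) *
        (Real.sign (y.2 - y.1) : ℝ) ∂circleMeasure.prod circleMeasure =
      if p + q = 0 then -(2 * Real.pi) / (q * Complex.I) else 0 := by
  have hint : Integrable (fun y : ℝ × ℝ => Complex.exp (p * Complex.I * y.1) *
      Complex.exp (q * Complex.I * y.2) * (Real.sign (y.2 - y.1) : ℝ))
      (circleMeasure.prod circleMeasure) := by
    refine Integrable.of_bound ?_ 1 (ae_of_all _ fun y => ?_)
    · refine Measurable.aestronglyMeasurable (Measurable.mul (by fun_prop) ?_)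
      exact Complex.measurable_ofReal.comp (measurable_sign.comp (by fun_prop))
    · rw [norm_mul, norm_mul, norm_exp_intCast_mul_I_mul, norm_exp_intCast_mul_I_mul]
      simpa using norm_ofReal_sign_le _
  rw [integral_prod _ hint]
  simp only [mul_assoc (Complex.exp _)]
  simp only [integral_const_mul]
  have h1 : ∫ x : ℝ, Complex.exp (p * Complex.I * x) *
      ∫ y : ℝ, Complex.exp (q * Complex.I * y) * (Real.sign (y - x) : ℝ) ∂circleMeasure
        ∂circleMeasure =
      ∫ x : ℝ, ((Complex.exp (q * Complex.I * (Real.pi / 2 : ℝ)) +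
        Complex.exp (q * Complex.I * (-(Real.pi / 2) : ℝ))) / (q * Complex.I)) *
          Complex.exp (p * Complex.I * x) -
        2 / (q * Complex.I) * Complex.exp (((p + q : ℤ) : ℂ) * Complex.I * x) ∂circleMeasure := by
    refine setIntegral_congr_fun measurableSet_Ioo fun x hx => ?_
    rw [integral_exp_mul_sign_circleMeasure hq hx, show ((p + q : ℤ) : ℂ) * Complex.I * x =
      p * Complex.I * x + q * Complex.I * x by push_cast; ring, Complex.exp_add]
    ring
  have hi : ∀ r : ℤ, Integrable (fun x : ℝ => Complex.exp (r * Complex.I * x)) circleMeasure :=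
    fun r => Integrable.of_bound (by fun_prop) 1
      (ae_of_all _ fun x => (norm_exp_intCast_mul_I_mul r x).le)
  rw [h1, integral_sub ((hi p).const_mul _) ((hi _).const_mul _), integral_const_mul,
    integral_const_mul, integral_exp_circleMeasure hpq]
  have h3 : (Complex.exp (q * Complex.I * (Real.pi / 2 : ℝ)) +
        Complex.exp (q * Complex.I * (-(Real.pi / 2) : ℝ))) / (q * Complex.I) *
        ∫ x : ℝ, Complex.exp (p * Complex.I * x) ∂circleMeasure = 0 := by
    rcases Int.even_or_odd p with h | h
    · rw [integral_exp_circleMeasure h, if_neg hp, mul_zero]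
    · rw [exp_intCast_mul_pi_div_two_add (by rw [Int.even_add'] at hpq; exact hpq.1 h),
        zero_div, zero_mul]
  rw [h3]
  split_ifs
  · ring
  · simp

end characters

section pairing
variable {m : ℕ} {K : Type*} [Fintype K]

/-- Paired indices carry opposite exponents. -/
def pairExponent : (Fin m × Bool) ⊕ K → ℤ
  | .inl (i, true) => 2 * i + 1 + Fintype.card K
  | .inl (i, false) => -(2 * i + 1 + Fintype.card K)
  | .inr _ => 0

theorem even_pairExponent_add (z z' : Fin m × Bool) :
    Even (pairExponent (.inl z : (Fin m × Bool) ⊕ K) +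
      pairExponent (.inl z' : (Fin m × Bool) ⊕ K)) := by
  rcases z with ⟨i, _ | _⟩ <;> rcases z' with ⟨j, _ | _⟩ <;> simp only [pairExponent]
  · exact ⟨-(i + j + 1 + Fintype.card K), by ring⟩
  · exact ⟨j - i, by ring⟩
  · exact ⟨i - j, by ring⟩
  · exact ⟨i + j + 1 + Fintype.card K, by ring⟩

theorem pairExponent_inl_ne_zero (z : Fin m × Bool) :
    pairExponent (.inl z : (Fin m × Bool) ⊕ K) ≠ 0 := by
  rcases z with ⟨i, _ | _⟩ <;> simp only [pairExponent] <;> omega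

variable [DecidableEq K]

/-- Exponents pair nontrivially only when they are opposite, so the Pfaffian is the product of one
entry per pair, times `π` for the zero exponent of an unpaired index. -/
theorem setIntegral_strictMono_det_exp [Subsingleton K] :
    ∫ x in {x | StrictMono (x ∘ (pairEquiv m K).symm)},
        (Matrix.of fun k l => Complex.exp (pairExponent k * Complex.I * x l)).det
          ∂Measure.pi (fun _ : (Fin m × Bool) ⊕ K => circleMeasure) =
      (∏ i : Fin m, 2 * Real.pi * Complex.I / (2 * i + 1 + Fintype.card K)) *
        (Real.pi : ℂ) ^ Fintype.card K := by
  have h := setIntegral_strictMono_det (m := m) (K := K) circleMeasure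
    (φ := fun k x => Complex.exp (pairExponent k * Complex.I * x)) (by fun_prop)
    (fun z x => (norm_exp_intCast_mul_I_mul _ x).le) (fun z w => rfl)
    (fun z z' hz => ?_) (fun i => ?_) (fun k z => ?_)
  · rw [h]
    congr 1
    · refine Finset.prod_congr rfl fun i _ => ?_
      rw [integral_exp_mul_exp_mul_sign (pairExponent_inl_ne_zero _) (pairExponent_inl_ne_zero _)
        (even_pairExponent_add _ _), if_pos (by simp only [pairExponent]; ring)]
      have h1 : (2 * i + 1 + Fintype.card K : ℂ) ≠ 0 := by
        norm_cast; omega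
      simp only [pairExponent]
      push_cast
      rw [div_eq_div_iff (mul_ne_zero h1 Complex.I_ne_zero) h1]
      linear_combination (-2 * (Real.pi : ℂ) * (2 * i + 1 + Fintype.card K)) * Complex.I_sq
    · simp only [pairExponent]
      rw [Finset.prod_congr rfl fun k _ => (integral_exp_circleMeasure (p := 0) (by simp)).trans
        (if_pos rfl)]
      simp
  · rw [integral_exp_mul_exp_mul_sign (pairExponent_inl_ne_zero _) (pairExponent_inl_ne_zero _)
      (even_pairExponent_add _ _), if_neg]
    intro h0
    apply hz
    rcases z with ⟨i, _ | _⟩ <;> rcases z' with ⟨j, _ | _⟩ <;>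
      simp only [pairExponent, pairSwap, Bool.not_true, Bool.not_false, Sum.inl.injEq,
        Prod.mk.injEq] at h0 ⊢ <;> simp <;> omega
  · rw [integral_exp_mul_exp_mul_sign (pairExponent_inl_ne_zero _) (pairExponent_inl_ne_zero _)
      (even_pairExponent_add _ _), integral_exp_mul_exp_mul_sign (pairExponent_inl_ne_zero _)
      (pairExponent_inl_ne_zero _) (even_pairExponent_add _ _), if_pos (by simp only [pairExponent]; ring),
      if_pos (by simp only [pairExponent]; ring)]
    simp only [pairExponent]
    push_cast
    rw [neg_mul (_ + _), div_neg]
  -- With an unpaired index present, the paired exponents are even and nonzero, so they integrate to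
  -- zero over length `π`.
  · have hK : Fintype.card K = 1 := Fintype.card_eq_one_iff.2 ⟨k, fun y => Subsingleton.elim _ _⟩
    have he : Even (pairExponent (.inl z : (Fin m × Bool) ⊕ K)) := by
      rcases z with ⟨i, _ | _⟩ <;> simp only [pairExponent, hK]
      · exact ⟨-(i + 1), by push_cast; ring⟩
      · exact ⟨i + 1, by push_cast; ring⟩
    rw [integral_exp_circleMeasure he, if_neg (pairExponent_inl_ne_zero _)]

end pairing

/-! ### The circular orthogonal ensemble -/

theorem prod_prod_Ioi_mul_mul_prod {n : ℕ} {R : Type*} [CommMonoid R] (a : Fin n → R) :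
    (∏ i, ∏ j ∈ Finset.Ioi i, (a i * a j)) * ∏ i, a i = ∏ i, a i ^ n := by
  have h : ∏ i, ∏ j ∈ Finset.Ioi i, a j = ∏ j, ∏ i ∈ Finset.Iio j, a j :=
    Finset.prod_comm' (by simp)
  simp only [Finset.prod_mul_distrib, h, Finset.prod_const, Fin.card_Ioi, Fin.card_Iio]
  rw [← Finset.prod_mul_distrib, ← Finset.prod_mul_distrib]
  refine Finset.prod_congr rfl fun i _ => ?_
  rw [← pow_add, ← pow_succ]
  congr 1
  have := i.2
  omega

/-- This is a Vandermonde determinant in `exp (2 i y)`. Each difference equals `exp (i (yᵢ + yⱼ)) *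
2 i sin (yⱼ - yᵢ)`, and the symmetric choice of frequencies cancels the phases. -/
theorem det_exp_eq_prod_sin {n : ℕ} (y : Fin n → ℝ) :
    (Matrix.of fun r s : Fin n =>
      Complex.exp (((2 * (r : ℕ) - (n - 1) : ℤ) : ℂ) * Complex.I * y s)).det =
      ∏ i, ∏ j ∈ Finset.Ioi i, (2 * Complex.I * (Real.sin (y j - y i) : ℝ)) := by
  have h1 : (Matrix.of fun r s : Fin n =>
      Complex.exp (((2 * (r : ℕ) - (n - 1) : ℤ) : ℂ) * Complex.I * y s)) =
      Matrix.of fun r s => (Complex.exp (-((n - 1 : ℤ) : ℂ) * Complex.I * y s)) *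
        (Matrix.vandermonde fun s => Complex.exp (2 * Complex.I * y s))ᵀ r s := by
    ext r s
    simp only [Matrix.of_apply, Matrix.transpose_apply, Matrix.vandermonde_apply]
    rw [← Complex.exp_nat_mul, ← Complex.exp_add]
    congr 1
    push_cast
    ring
  have h2 : ∀ i j, Complex.exp (2 * Complex.I * y j) - Complex.exp (2 * Complex.I * y i) =
      (Complex.exp (Complex.I * y i) * Complex.exp (Complex.I * y j)) *
        (2 * Complex.I * (Real.sin (y j - y i) : ℝ)) := by
    intro i j
    rw [Complex.ofReal_sin, Complex.sin, ← Complex.exp_add]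
    have e1 : Complex.exp (2 * Complex.I * y j) = Complex.exp (Complex.I * y i + Complex.I * y j) *
        Complex.exp ((y j - y i : ℝ) * Complex.I) := by
      rw [← Complex.exp_add]; congr 1; push_cast; ring
    have e2 : Complex.exp (2 * Complex.I * y i) = Complex.exp (Complex.I * y i + Complex.I * y j) *
        Complex.exp (-((y j - y i : ℝ) : ℂ) * Complex.I) := by
      rw [← Complex.exp_add]; congr 1; push_cast; ring
    rw [e1, e2]
    linear_combination (-Complex.exp (Complex.I * y i + Complex.I * y j) *
      (Complex.exp (-((y j - y i : ℝ) : ℂ) * Complex.I) -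
        Complex.exp ((y j - y i : ℝ) * Complex.I))) * Complex.I_sq
  rw [h1, Matrix.det_mul_row, Matrix.det_transpose, Matrix.det_vandermonde]
  simp only [h2, Finset.prod_mul_distrib (s := Finset.Ioi _)]
  rw [Finset.prod_mul_distrib, ← mul_assoc]
  have h3 := prod_prod_Ioi_mul_mul_prod fun i => Complex.exp (Complex.I * y i)
  simp only [Finset.prod_mul_distrib (s := Finset.Ioi _)] at h3
  have h4 : (∏ i, Complex.exp (-((n - 1 : ℤ) : ℂ) * Complex.I * y i)) *
      ∏ i, Complex.exp (Complex.I * y i) ^ n = ∏ i, Complex.exp (Complex.I * y i) := by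
    rw [← Finset.prod_mul_distrib]
    refine Finset.prod_congr rfl fun i _ => ?_
    rw [← Complex.exp_nat_mul, ← Complex.exp_add]
    congr 1
    push_cast
    ring
  have h5 : ∏ i, Complex.exp (Complex.I * y i) ≠ 0 :=
    Finset.prod_ne_zero_iff.2 fun i _ => Complex.exp_ne_zero _
  have h6 := mul_right_cancel₀ h5 (((mul_assoc _ _ _).trans ((congrArg _ h3).trans h4)).trans
    (one_mul _).symm)
  rw [h6, one_mul]

section pairing
variable {m : ℕ} {K : Type*} [Fintype K]

/-- With `n = 2m + |K|`, the paired exponents are exactly `-(n - 1), -(n - 3), …, n - 1`; zero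
occurs precisely when there is an unpaired index. -/
theorem exists_equiv_pairExponent (m : ℕ) (K : Type*) [Fintype K] [Subsingleton K] :
    ∃ e : (Fin m × Bool) ⊕ K ≃ Fin (2 * m + Fintype.card K),
      ∀ k, pairExponent k = 2 * ((e k : ℕ) : ℤ) - ((2 * m + Fintype.card K : ℕ) - 1) := by
  have hcard : Nonempty K → Fintype.card K = 1 := fun ⟨k⟩ =>
    Fintype.card_eq_one_iff.2 ⟨k, fun y => Subsingleton.elim _ _⟩
  have h : ∀ k : (Fin m × Bool) ⊕ K, ∃ r : Fin (2 * m + Fintype.card K),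
      pairExponent k = 2 * ((r : ℕ) : ℤ) - ((2 * m + Fintype.card K : ℕ) - 1) := by
    rintro (⟨i, _ | _⟩ | k)
    · have := i.2
      refine ⟨⟨m - 1 - i, by omega⟩, ?_⟩
      simp only [pairExponent]
      omega
    · have := i.2
      refine ⟨⟨i + m + Fintype.card K, by omega⟩, ?_⟩
      simp only [pairExponent]
      omega
    · have := hcard ⟨k⟩
      refine ⟨⟨m, by omega⟩, ?_⟩
      simp only [pairExponent]
      omega
  choose f hf using h
  have hinj : Function.Injective f := by
    intro k l hkl
    have h1 : pairExponent k = pairExponent l := by rw [hf, hf, hkl]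
    rcases k with ⟨i, _ | _⟩ | k <;> rcases l with ⟨j, _ | _⟩ | l <;>
      simp only [pairExponent] at h1
    · rw [show i = j by ext; omega]
    · omega
    · omega
    · omega
    · rw [show i = j by ext; omega]
    · omega
    · omega
    · omega
    · rw [Subsingleton.elim k l]
  refine ⟨Equiv.ofBijective f ?_, hf⟩
  rw [Fintype.bijective_iff_injective_and_card]
  refine ⟨hinj, ?_⟩
  simp; ring

variable [DecidableEq K]

/-- Only the orders of rows and columns differ, so `ε` is a sign. Its value is irrelevant, since
norms are taken afterwards. -/
theorem exists_det_exp_pairExponent_eq [Subsingleton K] :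
    ∃ ε : ℂ, ‖ε‖ = 1 ∧ ∀ x : (Fin m × Bool) ⊕ K → ℝ,
      (Matrix.of fun k l => Complex.exp (pairExponent k * Complex.I * x l)).det =
        ε * ∏ i, ∏ j ∈ Finset.Ioi i, (2 * Complex.I *
          (Real.sin (x ((pairEquiv m K).symm j) - x ((pairEquiv m K).symm i)) : ℝ)) := by
  obtain ⟨e, he⟩ := exists_equiv_pairExponent m K
  refine ⟨((Equiv.Perm.sign ((pairEquiv m K).symm.trans e) : ℤ) : ℂ), ?_, fun x => ?_⟩
  · rcases Int.units_eq_one_or (Equiv.Perm.sign ((pairEquiv m K).symm.trans e)) with h | h <;>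
      simp [h]
  · rw [← det_exp_eq_prod_sin fun i => x ((pairEquiv m K).symm i), ← Matrix.det_permute,
      ← Matrix.det_submatrix_equiv_self (pairEquiv m K)]
    congr 1
    ext k l
    simp [he]

end pairing

theorem integrable_prod_prod_sin (n : ℕ) : Integrable
    (fun y : Fin n → ℝ => ∏ i, ∏ j ∈ Finset.Ioi i, Real.sin (y j - y i))
    (Measure.pi fun _ => circleMeasure) := by
  refine Integrable.of_bound (by fun_prop) 1 (ae_of_all _ fun y => ?_)
  rw [norm_prod]
  refine Finset.prod_le_one (fun _ _ => norm_nonneg _) fun i _ => ?_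
  rw [norm_prod]
  exact Finset.prod_le_one (fun _ _ => norm_nonneg _) fun j _ => Real.abs_sin_le_one _

theorem ae_mem_Ioo_pi_circleMeasure (n : ℕ) : ∀ᵐ y ∂Measure.pi fun _ : Fin n => circleMeasure,
    ∀ i, y i ∈ Set.Ioo (-(Real.pi / 2)) (Real.pi / 2) := by
  rw [ae_all_iff]
  intro i
  exact (Measure.quasiMeasurePreserving_eval (fun _ : Fin n => circleMeasure) i).ae
    (ae_restrict_mem measurableSet_Ioo)

theorem sin_prod_nonneg {n : ℕ} {y : Fin n → ℝ}
    (hy : ∀ i, y i ∈ Set.Ioo (-(Real.pi / 2)) (Real.pi / 2)) (hm : StrictMono y) :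
    ∀ i, ∀ j ∈ Finset.Ioi i, 0 ≤ Real.sin (y j - y i) := by
  intro i j hj
  have h := hm (Finset.mem_Ioi.1 hj)
  have h1 := hy i
  have h2 := hy j
  exact Real.sin_nonneg_of_nonneg_of_le_pi (by linarith) (by linarith [h1.1, h2.2])

/-- The circular orthogonal ensemble normalization, over ordered configurations. -/
theorem setIntegral_strictMono_prod_sin (m κ : ℕ) (hκ : κ ≤ 1) :
    2 ^ ((2 * m + κ) * (2 * m + κ - 1) / 2) *
      ∫ y in {y : Fin (2 * m + κ) → ℝ | StrictMono y},
        ∏ i, ∏ j ∈ Finset.Ioi i, Real.sin (y j - y i) ∂Measure.pi (fun _ => circleMeasure) =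
      (∏ i : Fin m, 2 * Real.pi / (2 * i + 1 + κ)) * Real.pi ^ κ := by
  have hs : Subsingleton (Fin κ) := by
    rw [Fin.subsingleton_iff_le_one]; exact hκ
  obtain ⟨ε, hε, hD⟩ := exists_det_exp_pairExponent_eq (m := m) (K := Fin κ)
  have h := setIntegral_strictMono_det_exp (m := m) (K := Fin κ)
  simp only [hD] at h
  rw [integral_const_mul] at h
  generalize pairEquiv m (Fin κ) = e at h
  have hκ' : Fintype.card (Fin κ) = κ := Fintype.card_fin κ
  generalize Fintype.card (Fin κ) = κ' at e h hκ'
  subst hκ'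
  have mp := measurePreserving_arrowCongr' (fun _ : (Fin m × Bool) ⊕ Fin κ' => circleMeasure)
    (fun _ : Fin (2 * m + κ') => circleMeasure) e
    (MeasurableEquiv.refl ℝ) fun _ => MeasurePreserving.id _
  have h1 := mp.setIntegral_preimage_emb (MeasurableEquiv.measurableEmbedding _)
    (fun y : Fin (2 * m + κ') → ℝ => ∏ i, ∏ j ∈ Finset.Ioi i,
      (2 * Complex.I * (Real.sin (y j - y i) : ℝ))) {y | StrictMono y}
  have h2 : (∫ x in {x | StrictMono (x ∘ e.symm)}, ∏ i, ∏ j ∈ Finset.Ioi i,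
      (2 * Complex.I * (Real.sin (x (e.symm j) - x (e.symm i)) : ℝ))
        ∂Measure.pi fun _ : (Fin m × Bool) ⊕ Fin κ' => circleMeasure) = _ := h1
  rw [h2] at h
  have h3 : ∀ y : Fin (2 * m + κ') → ℝ, ∏ i, ∏ j ∈ Finset.Ioi i,
      (2 * Complex.I * (Real.sin (y j - y i) : ℝ)) =
      (2 * Complex.I) ^ ((2 * m + κ') * (2 * m + κ' - 1) / 2) *
        ((∏ i, ∏ j ∈ Finset.Ioi i, Real.sin (y j - y i) : ℝ) : ℂ) := by
    intro y
    simp only [Finset.prod_mul_distrib (s := Finset.Ioi _)]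
    rw [Finset.prod_mul_distrib]
    push_cast
    congr 1
    simp only [Finset.prod_const, Fin.card_Ioi]
    simp only [← mul_pow]
    rw [Finset.prod_pow_eq_pow_sum, Fin.sum_univ_eq_sum_range (fun i => 2 * m + κ' - 1 - i),
      Finset.sum_range_reflect (fun i => i), Finset.sum_range_id]
  simp only [h3] at h
  rw [integral_const_mul, integral_complex_ofReal] at h
  -- Norms discard `ε` and the powers of `i`; nothing else is lost, because the sine product is
  -- nonnegative on ordered angles.
  have h4 := congrArg norm h
  rw [norm_mul, norm_mul, hε, norm_pow, one_mul, Complex.norm_real, norm_mul, norm_mul, norm_prod] at h4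
  have h5 : (0 : ℝ) ≤ ∫ y in {y : Fin (2 * m + κ') → ℝ | StrictMono y},
        ∏ i, ∏ j ∈ Finset.Ioi i, Real.sin (y j - y i) ∂Measure.pi (fun _ => circleMeasure) := by
    refine setIntegral_nonneg_of_ae_restrict ?_
    rw [EventuallyLE, ae_restrict_iff' (measurableSet_strictMono _)]
    filter_upwards [ae_mem_Ioo_pi_circleMeasure (2 * m + κ')] with y hy hmono
    exact Finset.prod_nonneg fun i _ => Finset.prod_nonneg fun j hj => sin_prod_nonneg hy hmono i j hj
  rw [Real.norm_of_nonneg h5] at h4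
  have h6 : ‖(2 : ℂ)‖ * ‖Complex.I‖ = 2 := by simp
  rw [h6] at h4
  rw [h4]
  congr 1
  · refine Finset.prod_congr rfl fun i _ => ?_
    rw [norm_div, norm_mul, norm_mul]
    simp only [Complex.norm_I, Complex.norm_real, mul_one]
    rw [show (2 * (i : ℕ) + 1 + κ' : ℂ) = ((2 * (i : ℕ) + 1 + κ' : ℝ) : ℂ) by push_cast; ring,
      Complex.norm_real, Real.norm_of_nonneg Real.pi_pos.le, Real.norm_of_nonneg (by positivity)]
    simp
  · simp [abs_of_pos Real.pi_pos]

theorem setLIntegral_strictMono_prod_sin (m κ : ℕ) (hκ : κ ≤ 1) :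
    ∫⁻ y in {y : Fin (2 * m + κ) → ℝ | StrictMono y},
        ENNReal.ofReal (∏ i, ∏ j ∈ Finset.Ioi i, |Real.sin (y j - y i)|)
        ∂Measure.pi (fun _ => circleMeasure) =
      ENNReal.ofReal ((∏ i : Fin m, 2 * Real.pi / (2 * i + 1 + κ)) * Real.pi ^ κ /
        2 ^ ((2 * m + κ) * (2 * m + κ - 1) / 2)) := by
  rw [← setIntegral_strictMono_prod_sin m κ hκ, mul_div_cancel_left₀ _ (by positivity),
    ofReal_integral_eq_lintegral_ofReal (integrable_prod_prod_sin _).integrableOn]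
  · refine lintegral_congr_ae ?_
    rw [EventuallyEq, ae_restrict_iff' (measurableSet_strictMono _)]
    filter_upwards [ae_mem_Ioo_pi_circleMeasure (2 * m + κ)] with y hy hmono
    congr 1
    exact Finset.prod_congr rfl fun i _ => Finset.prod_congr rfl fun j hj =>
      abs_of_nonneg (sin_prod_nonneg hy hmono i j hj)
  · rw [EventuallyLE, ae_restrict_iff' (measurableSet_strictMono _)]
    filter_upwards [ae_mem_Ioo_pi_circleMeasure (2 * m + κ)] with y hy hmono
    exact Finset.prod_nonneg fun i _ => Finset.prod_nonneg fun j hj => sin_prod_nonneg hy hmono i j hj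

/-! ### From the Cauchy density to the circle -/

theorem tan_sub_tan {x y : ℝ} (hx : Real.cos x ≠ 0) (hy : Real.cos y ≠ 0) :
    Real.tan y - Real.tan x = Real.sin (y - x) / (Real.cos x * Real.cos y) := by
  rw [Real.tan_eq_sin_div_cos, Real.tan_eq_sin_div_cos, Real.sin_sub]
  field_simp

/-- Integration in the angular coordinates `v = tan θ`. -/
theorem lintegral_comp_tan {n : ℕ} (f : (Fin n → ℝ) → ℝ≥0∞) :
    ∫⁻ v, f v = ∫⁻ θ, ENNReal.ofReal (∏ i, (Real.cos (θ i) ^ 2)⁻¹) * f fun i => Real.tan (θ i)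
      ∂Measure.pi fun _ : Fin n => circleMeasure := by
  set C : Set (Fin n → ℝ) := Set.univ.pi fun _ => Set.Ioo (-(Real.pi / 2)) (Real.pi / 2) with hC
  have hCm : MeasurableSet C := MeasurableSet.univ_pi fun _ => measurableSet_Ioo
  have hcos : ∀ θ ∈ C, ∀ i, 0 < Real.cos (θ i) := fun θ hθ i =>
    Real.cos_pos_of_mem_Ioo (hθ i (Set.mem_univ i))
  let L : (Fin n → ℝ) → (Fin n → ℝ) →L[ℝ] (Fin n → ℝ) := fun θ =>
    ContinuousLinearMap.pi fun i =>
      (1 / Real.cos (θ i) ^ 2) • (ContinuousLinearMap.proj i : (Fin n → ℝ) →L[ℝ] ℝ)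
  have hd : ∀ θ ∈ C, HasFDerivWithinAt (fun θ : Fin n → ℝ => fun i => Real.tan (θ i)) (L θ) C θ := by
    intro θ hθ
    refine HasFDerivAt.hasFDerivWithinAt (hasFDerivAt_pi.2 fun i => ?_)
    exact (Real.hasDerivAt_tan (hcos θ hθ i).ne').comp_hasFDerivAt θ
      (ContinuousLinearMap.proj (R := ℝ) (φ := fun _ : Fin n => ℝ) i).hasFDerivAt
  have hdet : ∀ θ, (L θ).det = ∏ i, (Real.cos (θ i) ^ 2)⁻¹ := by
    intro θ
    have : (L θ : (Fin n → ℝ) →ₗ[ℝ] (Fin n → ℝ)) =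
        Matrix.toLin' (Matrix.diagonal fun i => (Real.cos (θ i) ^ 2)⁻¹) := by
      refine LinearMap.ext fun v => ?_
      funext i
      simp [L, Matrix.mulVec_diagonal]
    rw [ContinuousLinearMap.det, this, LinearMap.det_toLin', Matrix.det_diagonal]
  have hinj : Set.InjOn (fun θ : Fin n → ℝ => fun i => Real.tan (θ i)) C := by
    intro θ hθ η hη h
    funext i
    exact Real.injOn_tan (hθ i (Set.mem_univ i)) (hη i (Set.mem_univ i)) (congrFun h i)
  have himg : (fun θ : Fin n → ℝ => fun i => Real.tan (θ i)) '' C = Set.univ := by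
    refine Set.eq_univ_of_forall fun v => ⟨fun i => Real.arctan (v i), fun i _ => ?_, ?_⟩
    · exact ⟨Real.neg_pi_div_two_lt_arctan _, Real.arctan_lt_pi_div_two _⟩
    · funext i; exact Real.tan_arctan _
  have h := lintegral_image_eq_lintegral_abs_det_fderiv_mul volume hCm hd hinj f
  rw [himg, Measure.restrict_univ] at h
  rw [h]
  have hpi : Measure.pi (fun _ : Fin n => circleMeasure) =
      (volume : Measure (Fin n → ℝ)).restrict C := by
    rw [volume_pi, hC, Measure.restrict_pi_pi]
    rfl
  rw [hpi]
  refine lintegral_congr fun θ => ?_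
  rw [hdet, abs_of_nonneg (Finset.prod_nonneg fun i _ => by positivity)]

/-- Under `l = tan θ` the powers of each `cos θᵢ` cancel: `n + 1` from the weight, `-2` from the
Jacobian and `-(n - 1)` from the differences of tangents. -/
theorem lintegral_cauchyDensity_eq (n : ℕ) :
    ∫⁻ l : Fin n → ℝ, cauchyDensity (((n : ℝ) + 1) / 2) l =
      ∫⁻ y in {y : Fin n → ℝ | StrictMono y},
        ENNReal.ofReal (∏ i, ∏ j ∈ Finset.Ioi i, |Real.sin (y j - y i)|)
        ∂Measure.pi (fun _ => circleMeasure) := by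
  rw [lintegral_comp_tan, ← lintegral_indicator (measurableSet_strictMono n)]
  refine lintegral_congr_ae ?_
  filter_upwards [ae_mem_Ioo_pi_circleMeasure n] with θ hθ
  have hcos : ∀ i, 0 < Real.cos (θ i) := fun i => Real.cos_pos_of_mem_Ioo (hθ i)
  by_cases hm : StrictMono θ
  · have hm' : StrictMono fun i => Real.tan (θ i) := fun i j hij =>
      Real.strictMonoOn_tan (hθ i) (hθ j) (hm hij)
    rw [Set.indicator_of_mem (by exact hm), cauchyDensity, Set.indicator_of_mem (by exact hm'),
      ← ENNReal.ofReal_mul (Finset.prod_nonneg fun i _ => by positivity)]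
    congr 1
    have h1 : ∀ i, (1 + Real.tan (θ i) ^ 2) ^ (-(((n : ℝ) + 1) / 2)) =
        Real.cos (θ i) ^ (n + 1) := by
      intro i
      rw [← inv_inv (1 + Real.tan (θ i) ^ 2), Real.inv_one_add_tan_sq (hcos i).ne',
        ← Real.rpow_neg_one, ← Real.rpow_mul (sq_nonneg _), ← Real.rpow_natCast,
        ← Real.rpow_natCast, ← Real.rpow_mul (hcos i).le]
      congr 1
      push_cast
      ring
    have h2 : ∀ i j, |Real.tan (θ j) - Real.tan (θ i)| =
        |Real.sin (θ j - θ i)| / (Real.cos (θ i) * Real.cos (θ j)) := by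
      intro i j
      rw [tan_sub_tan (hcos i).ne' (hcos j).ne', abs_div,
        abs_of_pos (mul_pos (hcos i) (hcos j))]
    simp only [h1, h2, Finset.prod_div_distrib]
    have h3 := prod_prod_Ioi_mul_mul_prod fun i => Real.cos (θ i)
    have hA : (∏ i, ∏ j ∈ Finset.Ioi i, (Real.cos (θ i) * Real.cos (θ j))) ≠ 0 :=
      Finset.prod_ne_zero_iff.2 fun i _ => Finset.prod_ne_zero_iff.2 fun j _ =>
        (mul_pos (hcos i) (hcos j)).ne'
    have hB : (∏ i, Real.cos (θ i)) ≠ 0 := Finset.prod_ne_zero_iff.2 fun i _ => (hcos i).ne'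
    have h4 : ∏ i, Real.cos (θ i) ^ (n + 1) =
        (∏ i, Real.cos (θ i) ^ n) * ∏ i, Real.cos (θ i) := by
      rw [← Finset.prod_mul_distrib]
      exact Finset.prod_congr rfl fun i _ => pow_succ _ _
    rw [h4, ← h3, Finset.prod_inv_distrib, Finset.prod_pow]
    field_simp
  · have hm' : ¬ StrictMono fun i => Real.tan (θ i) := fun h => hm fun i j hij =>
      (Real.strictMonoOn_tan.lt_iff_lt (hθ i) (hθ j)).1 (h hij)
    rw [Set.indicator_of_notMem (by exact hm), cauchyDensity,
      Set.indicator_of_notMem (by exact hm'), mul_zero]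

theorem lintegral_cauchyDensity (m κ : ℕ) (hκ : κ ≤ 1) :
    ∫⁻ l : Fin (2 * m + κ) → ℝ, cauchyDensity ((((2 * m + κ : ℕ) : ℝ) + 1) / 2) l =
      ENNReal.ofReal ((∏ i : Fin m, 2 * Real.pi / (2 * i + 1 + κ)) * Real.pi ^ κ /
        2 ^ ((2 * m + κ) * (2 * m + κ - 1) / 2)) := by
  rw [lintegral_cauchyDensity_eq, setLIntegral_strictMono_prod_sin m κ hκ]

/-! ### Collecting the constants -/

theorem japaneseConst_ratio {n k : ℕ} :
    japaneseConst k (((k : ℝ) + 1) / 2) * japaneseConst k (n - ((n : ℝ) - 1 - k) / 2) *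
        Real.pi ^ ((n : ℝ) / 2) * Real.Gamma (((k : ℝ) + 1) / 2) ^ 2 =
      Real.pi ^ ((k : ℝ) + 1 / 2) * Real.Gamma (((n : ℝ) + 1) / 2) *
        japaneseConst n (((n : ℝ) + 1 + k) / 2) := by
  have h1 : Real.Gamma (((k : ℝ) + 1) / 2) ≠ 0 := (Real.Gamma_pos_of_pos (by positivity)).ne'
  have h2 : Real.Gamma (((n : ℝ) + 1 + k) / 2) ≠ 0 := (Real.Gamma_pos_of_pos (by positivity)).ne'
  have e1 : (n : ℝ) - ((n : ℝ) - 1 - k) / 2 = ((n : ℝ) + 1 + k) / 2 := by ring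
  have e2 : ((k : ℝ) + 1) / 2 - (k : ℝ) / 2 = 1 / 2 := by ring
  have e3 : ((n : ℝ) + 1 + k) / 2 - (k : ℝ) / 2 = ((n : ℝ) + 1) / 2 := by ring
  have e4 : ((n : ℝ) + 1 + k) / 2 - (n : ℝ) / 2 = ((k : ℝ) + 1) / 2 := by ring
  have e5 : Real.pi ^ ((k : ℝ) + 1 / 2) =
      Real.pi ^ ((k : ℝ) / 2) * Real.pi ^ ((k : ℝ) / 2) * Real.sqrt Real.pi := by
    rw [Real.sqrt_eq_rpow, ← Real.rpow_add Real.pi_pos, ← Real.rpow_add Real.pi_pos]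
    congr 1; ring
  unfold japaneseConst
  rw [e1, e2, e3, e4, e5, Real.Gamma_one_half_eq]
  field_simp

/-- The factors are matched one by one after reversing the product for `matrixCauchyMass`. The
powers of `π` cancel because the sum of `k + 1 / 2` over `k < n` is `n² / 2`. -/
theorem eigenvalueConst_div_matrixCauchyMass (n : ℕ) :
    eigenvalueConst n n * ∏ k ∈ Finset.range n, Real.Gamma (((k : ℝ) + 1) / 2) ^ 2 =
      matrixCauchyMass n * Real.Gamma (((n : ℝ) + 1) / 2) ^ n := by
  have h1 : matrixCauchyMass n =
      ∏ k ∈ Finset.range n, japaneseConst n (((n : ℝ) + 1 + k) / 2) := by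
    rw [matrixCauchyMass, ← Finset.prod_range_reflect]
    refine Finset.prod_congr rfl fun k hk => ?_
    have := Finset.mem_range.1 hk
    congr 1
    rw [Nat.sub_sub, Nat.cast_sub (by omega)]
    push_cast
    ring
  have h2 : ∏ k ∈ Finset.range n, Real.pi ^ ((k : ℝ) + 1 / 2) =
      ∏ _k ∈ Finset.range n, Real.pi ^ ((n : ℝ) / 2) := by
    rw [← Real.rpow_sum_of_pos Real.pi_pos, ← Real.rpow_sum_of_pos Real.pi_pos]
    congr 1
    rw [Finset.sum_add_distrib, Finset.sum_const, Finset.sum_const, Finset.card_range]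
    have := Finset.sum_range_id_mul_two n
    have h : (∑ k ∈ Finset.range n, (k : ℝ)) * 2 = n * (n - 1) := by
      rcases n with _ | n
      · simp
      · have h' := congrArg (Nat.cast : ℕ → ℝ) this
        push_cast at h'
        simpa using h'
    simp only [nsmul_eq_mul]
    linarith
  have h3 : (∏ _k ∈ Finset.range n, Real.pi ^ ((n : ℝ) / 2)) ≠ 0 :=
    Finset.prod_ne_zero_iff.2 fun _ _ => (Real.rpow_pos_of_pos Real.pi_pos _).ne'
  have h4 := Finset.prod_congr (rfl : Finset.range n = _)
    fun k _ => japaneseConst_ratio (n := n) (k := k)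
  simp only [Finset.prod_mul_distrib] at h4
  rw [h2, ← h1] at h4
  simp only [Finset.prod_const (Real.Gamma _), Finset.card_range] at h4
  rw [eigenvalueConst]
  simp only [Finset.prod_mul_distrib]
  refine mul_left_cancel₀ h3 ?_
  linear_combination h4

/-- The recursion of `Γ` brings both parities into a single formula: raising `m` by one raises `(2m
+ κ + 1) / 2` by one. -/
theorem prod_two_pi_div (m κ : ℕ) (hκ : κ ≤ 1) :
    (∏ i : Fin m, 2 * Real.pi / (2 * i + 1 + κ)) * Real.pi ^ κ =
      Real.pi ^ ((((2 * m + κ : ℕ) : ℝ) + 1) / 2) / Real.Gamma ((((2 * m + κ : ℕ) : ℝ) + 1) / 2) := by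
  rw [Fin.prod_univ_eq_prod_range (fun i => 2 * Real.pi / (2 * (i : ℝ) + 1 + κ)) m]
  induction m with
  | zero =>
    interval_cases κ
    · simp only [Finset.range_zero, Finset.prod_empty, mul_zero, pow_zero, zero_add, Nat.cast_zero]
      rw [Real.Gamma_one_half_eq, Real.sqrt_eq_rpow,
        div_self (Real.rpow_pos_of_pos Real.pi_pos _).ne', one_mul]
    · norm_num
  | succ m ih =>
    have e : ((2 * (m + 1) + κ : ℕ) + 1 : ℝ) / 2 = (((2 * m + κ : ℕ) : ℝ) + 1) / 2 + 1 := by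
      push_cast; ring
    have hG : Real.Gamma ((((2 * m + κ : ℕ) : ℝ) + 1) / 2) ≠ 0 :=
      (Real.Gamma_pos_of_pos (by positivity)).ne'
    rw [Finset.prod_range_succ, mul_right_comm, ih, e, Real.Gamma_add_one (by positivity),
      Real.rpow_add_one Real.pi_pos.ne']
    push_cast
    field_simp
    ring

/-- Legendre's duplication formula at `(n + 1) / 2`, namely `n! √π = 2^n Γ((n + 1) / 2) Γ((n + 2) /
2)`, is the induction step. -/
theorem prod_factorial_eq (n : ℕ) :
    (∏ j ∈ Finset.range n, (Nat.factorial j : ℝ)) * Real.pi ^ (((n : ℝ) + 1) / 2) =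
      (∏ k ∈ Finset.range n, Real.Gamma (((k : ℝ) + 1) / 2) ^ 2) * 2 ^ (n * (n - 1) / 2) *
        Real.Gamma (((n : ℝ) + 1) / 2) := by
  induction n with
  | zero =>
    simp only [Finset.range_zero, Finset.prod_empty, Nat.cast_zero, zero_add, zero_mul,
      Nat.zero_div, pow_zero]
    rw [Real.Gamma_one_half_eq, Real.sqrt_eq_rpow]
    simp
  | succ n ih =>
    have h1 := Real.Gamma_mul_Gamma_add_half (((n : ℝ) + 1) / 2)
    have e1 : ((n : ℝ) + 1) / 2 + 1 / 2 = ((n + 1 : ℕ) + 1 : ℝ) / 2 := by push_cast; ring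
    have e2 : 2 * (((n : ℝ) + 1) / 2) = n + 1 := by ring
    have e3 : (1 : ℝ) - (n + 1) = -n := by ring
    rw [e2, e1, e3, Real.Gamma_nat_eq_factorial, Real.rpow_neg zero_le_two, Real.rpow_natCast] at h1
    have e4 : Real.pi ^ (((n + 1 : ℕ) + 1 : ℝ) / 2) =
        Real.pi ^ (((n : ℝ) + 1) / 2) * Real.sqrt Real.pi := by
      rw [Real.sqrt_eq_rpow, ← Real.rpow_add Real.pi_pos]
      congr 1; push_cast; ring
    have e5 : (n + 1) * (n + 1 - 1) / 2 = n * (n - 1) / 2 + n := by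
      rcases n with _ | n
      · rfl
      · simp only [Nat.add_sub_cancel]
        rw [show (n + 1 + 1) * (n + 1) = (n + 1) * n + (n + 1) * 2 by ring,
          Nat.add_mul_div_right _ _ zero_lt_two]
    have hf : (Nat.factorial n : ℝ) * Real.sqrt Real.pi =
        2 ^ n * (Real.Gamma (((n : ℝ) + 1) / 2) * Real.Gamma (((n + 1 : ℕ) + 1 : ℝ) / 2)) := by
      rw [h1]
      field_simp
    rw [Finset.prod_range_succ, Finset.prod_range_succ, e4, e5, pow_add]
    calc _ = ((∏ j ∈ Finset.range n, (Nat.factorial j : ℝ)) * Real.pi ^ (((n : ℝ) + 1) / 2)) *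
          ((Nat.factorial n : ℝ) * Real.sqrt Real.pi) := by ring
      _ = _ := by rw [ih, hf]; ring

/-- The probability that a Gaussian `n × n × 2` tensor has rank `n`. -/
theorem rankProb_eq_gamma (n : ℕ) :
    rankProb n = Real.Gamma (((n : ℝ) + 1) / 2) ^ n /
      ∏ j ∈ Finset.range n, (Nat.factorial j : ℝ) := by
  obtain ⟨m, κ, hκ, rfl⟩ : ∃ m κ, κ ≤ 1 ∧ n = 2 * m + κ :=
    ⟨n / 2, n % 2, by omega, by omega⟩
  have h := rankProb_eq (2 * m + κ)
  rw [lintegral_cauchyDensity m κ hκ, prod_two_pi_div m κ hκ] at h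
  generalize 2 * m + κ = n at h ⊢
  have hE : 0 ≤ eigenvalueConst n n := by
    refine Finset.prod_nonneg fun k hk => ?_
    have hk' : ((k : ℝ) + 1) ≤ n := by exact_mod_cast Finset.mem_range.1 hk
    exact mul_nonneg (japaneseConst_pos (by linarith)).le (japaneseConst_pos (by linarith)).le
  have hG : 0 < Real.Gamma (((n : ℝ) + 1) / 2) := Real.Gamma_pos_of_pos (by positivity)
  have hP : 0 ≤ rankProb n := measureReal_nonneg
  have hF : 0 < ∏ j ∈ Finset.range n, (Nat.factorial j : ℝ) :=
    Finset.prod_pos fun j _ => by positivity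
  have hΓ : 0 < ∏ k ∈ Finset.range n, Real.Gamma (((k : ℝ) + 1) / 2) ^ 2 :=
    Finset.prod_pos fun k _ => pow_pos (Real.Gamma_pos_of_pos (by positivity)) 2
  have hM := matrixCauchyMass_pos n
  have hπ : 0 < Real.pi ^ (((n : ℝ) + 1) / 2) := Real.rpow_pos_of_pos Real.pi_pos _
  rw [← ENNReal.ofReal_inv_of_pos hM, ← ENNReal.ofReal_mul hE,
    ← ENNReal.ofReal_mul (inv_nonneg.2 hM.le), ENNReal.ofReal_eq_ofReal_iff hP (by positivity)] at h
  have h1 := eigenvalueConst_div_matrixCauchyMass n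
  have h2 := prod_factorial_eq n
  rw [h, eq_div_iff hF.ne']
  have h3 : (∏ j ∈ Finset.range n, (Nat.factorial j : ℝ)) =
      (∏ k ∈ Finset.range n, Real.Gamma (((k : ℝ) + 1) / 2) ^ 2) * 2 ^ (n * (n - 1) / 2) *
        Real.Gamma (((n : ℝ) + 1) / 2) / Real.pi ^ (((n : ℝ) + 1) / 2) := by
    rw [← h2]; field_simp
  rw [h3]
  calc _ = (matrixCauchyMass n)⁻¹ * (eigenvalueConst n n *
        ∏ k ∈ Finset.range n, Real.Gamma (((k : ℝ) + 1) / 2) ^ 2) := by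
        field_simp
    _ = _ := by rw [h1]; field_simp

/-! ### Euler–Maclaurin summation for zeta and the constant `ζ'(-1)` -/

/-- Error bound for the trapezoidal rule with its first end correction. -/
theorem norm_corrected_trapezoid_le {F₀ F₁ F₂ F₃ F₄ : ℝ → ℂ} {M : ℝ}
    (h₀ : ∀ t ∈ Set.Icc (0 : ℝ) 1, HasDerivAt F₀ (F₁ t) t)
    (h₁ : ∀ t ∈ Set.Icc (0 : ℝ) 1, HasDerivAt F₁ (F₂ t) t)
    (h₂ : ∀ t ∈ Set.Icc (0 : ℝ) 1, HasDerivAt F₂ (F₃ t) t)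
    (h₃ : ∀ t ∈ Set.Icc (0 : ℝ) 1, HasDerivAt F₃ (F₄ t) t)
    (hM : ∀ t ∈ Set.Icc (0 : ℝ) 1, ‖F₄ t‖ ≤ M) :
    ‖F₀ 1 - F₀ 0 - (F₁ 0 + F₁ 1) / 2 + (F₂ 1 - F₂ 0) / 12‖ ≤ M := by
  have hM0 : 0 ≤ M := (norm_nonneg _).trans (hM 0 (by simp))
  have hid : ∀ t : ℝ, HasDerivAt (fun t : ℝ => (t : ℂ)) 1 t := fun t => Complex.ofRealCLM.hasDerivAt
  have hK : ∀ t ∈ Set.Icc (0 : ℝ) 1, ‖F₂ t - F₂ 0 - t * F₃ t‖ ≤ M := by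
    intro t ht
    have h := norm_image_sub_le_of_norm_deriv_le_segment' (a := 0) (b := 1) (C := M)
      (f := fun t => F₂ t - F₂ 0 - t * F₃ t) (f' := fun t => F₃ t - (1 * F₃ t + t * F₄ t))
      (fun x hx => (((h₂ x hx).sub_const _).sub ((hid x).mul (h₃ x hx))).hasDerivWithinAt)
      (fun x hx => ?_) t ht
    · simp only [Complex.ofReal_zero, zero_mul, sub_self, sub_zero] at h
      exact h.trans (mul_le_of_le_one_right hM0 ht.2)
    · have : F₃ x - (1 * F₃ x + x * F₄ x) = -(x * F₄ x) := by ring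
      rw [this, norm_neg, norm_mul, Complex.norm_real, Real.norm_of_nonneg hx.1]
      exact (mul_le_of_le_one_left (norm_nonneg _) hx.2.le).trans (hM x ⟨hx.1, hx.2.le⟩)
  -- The derivative of the trapezoid defect as a function of the right endpoint. Its own derivative
  -- involves only `F₂ t - F₂ 0 - t * F₃ t`, already bounded, and `F₄`; each mean value estimate
  -- starts from zero at `t = 0`.
  let G₁ : ℝ → ℂ := fun t => F₁ t - (F₁ 0 + F₁ t) / 2 - t / 2 * F₂ t + t / 6 * (F₂ t - F₂ 0) +
    t ^ 2 / 12 * F₃ t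
  have hG₁ : ∀ t ∈ Set.Icc (0 : ℝ) 1, ‖G₁ t‖ ≤ M := by
    intro t ht
    have h := norm_image_sub_le_of_norm_deriv_le_segment' (a := 0) (b := 1) (C := M) (f := G₁)
      (f' := fun t => (F₂ t - F₂ 0 - t * F₃ t) / 6 + t ^ 2 / 12 * F₄ t)
      (fun x hx => HasDerivAt.hasDerivWithinAt ?_) (fun x hx => ?_) t ht
    · have h0 : G₁ 0 = 0 := by simp [G₁]
      rw [h0, sub_zero, sub_zero] at h
      exact h.trans (mul_le_of_le_one_right hM0 ht.2)
    · have e := (((((h₁ x hx).sub (((h₁ x hx).const_add (F₁ 0)).div_const 2)).sub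
        (((hid x).div_const 2).mul (h₂ x hx))).add
        (((hid x).div_const 6).mul ((h₂ x hx).sub_const (F₂ 0)))).add
        ((((hid x).fun_pow 2).div_const 12).mul (h₃ x hx)))
      refine e.congr_deriv ?_
      push_cast
      ring
    · have hx' : x ∈ Set.Icc (0 : ℝ) 1 := ⟨hx.1, hx.2.le⟩
      refine (norm_add_le _ _).trans ?_
      have e1 : ‖(F₂ x - F₂ 0 - x * F₃ x) / 6‖ ≤ M / 6 := by
        rw [norm_div]
        simpa using div_le_div_of_nonneg_right (hK x hx') (by norm_num : (0 : ℝ) ≤ 6)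
      have e2 : ‖(x : ℂ) ^ 2 / 12 * F₄ x‖ ≤ M / 12 := by
        rw [norm_mul, norm_div, norm_pow, Complex.norm_real, Real.norm_of_nonneg hx.1]
        have : x ^ 2 ≤ 1 := pow_le_one₀ hx.1 hx.2.le
        have h4 := hM x hx'
        simp only [Complex.norm_ofNat]
        nlinarith [norm_nonneg (F₄ x), mul_le_mul_of_nonneg_right this (norm_nonneg (F₄ x))]
      linarith
  have h := norm_image_sub_le_of_norm_deriv_le_segment_01' (C := M)
    (f := fun t => F₀ t - F₀ 0 - t / 2 * (F₁ 0 + F₁ t) + t ^ 2 / 12 * (F₂ t - F₂ 0)) (f' := G₁)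
    (fun x hx => HasDerivAt.hasDerivWithinAt ?_) (fun x hx => hG₁ x ⟨hx.1, hx.2.le⟩)
  · refine le_trans (le_of_eq ?_) h
    congr 1
    simp
    ring
  · have e := (((h₀ x hx).sub_const (F₀ 0)).sub
      (((hid x).div_const 2).mul ((h₁ x hx).const_add (F₁ 0)))).add
      ((((hid x).fun_pow 2).div_const 12).mul ((h₂ x hx).sub_const (F₂ 0)))
    refine e.congr_deriv ?_
    simp only [G₁]
    push_cast
    ring

/-- `(s - 1) ζ(s)` approximated by Euler–Maclaurin summation of the first `n` terms. -/
noncomputable def eulerMaclaurinZeta (n : ℕ) (s : ℂ) : ℂ :=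
  (s - 1) * (∑ k ∈ Finset.range n, ((k + 1 : ℕ) : ℂ) ^ (-s) - (n : ℂ) ^ (-s) / 2 +
    s / 12 * (n : ℂ) ^ (-s - 1)) + (n : ℂ) ^ (1 - s)

theorem hasDerivAt_add_ofReal_cpow {a t : ℝ} (h : 0 < a + t) (r : ℂ) :
    HasDerivAt (fun t : ℝ => ((a : ℂ) + t) ^ r) (r * ((a : ℂ) + t) ^ (r - 1)) t := by
  have h1 : HasDerivAt (fun z : ℂ => ((a : ℂ) + z) ^ r) (r * ((a : ℂ) + t) ^ (r - 1) * 1) (t : ℂ) := by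
    refine ((hasDerivAt_id (t : ℂ)).const_add (a : ℂ)).cpow_const ?_
    rw [id, ← Complex.ofReal_add]
    exact Complex.ofReal_mem_slitPlane.2 h
  rw [mul_one] at h1
  exact h1.comp_ofReal

/-- The region where the Euler–Maclaurin approximations converge uniformly. -/
def eulerMaclaurinRegion : Set ℂ := {s | -(3 / 2) < s.re} ∩ Metric.ball 0 4

/-- The increment is the corrected trapezoid defect of `(n + t)^(1 - s)`, whose fourth derivative
has size `(n + t)^(-Re s - 3)`. The bound is summable in `n` and uniform on a region containing both
`-1` and points with `Re s > 1`. -/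
theorem norm_eulerMaclaurinZeta_succ_sub_le {n : ℕ} (hn : 1 ≤ n) {s : ℂ}
    (hs : s ∈ eulerMaclaurinRegion) :
    ‖eulerMaclaurinZeta (n + 1) s - eulerMaclaurinZeta n s‖ ≤ 600 * (n : ℝ) ^ (-(3 / 2) : ℝ) := by
  have hn1 : (1 : ℝ) ≤ n := by exact_mod_cast hn
  have hpos : ∀ t ∈ Set.Icc (0 : ℝ) 1, 0 < (n : ℝ) + t := fun t ht => by linarith [ht.1]
  have hd : ∀ (c r : ℂ), ∀ t ∈ Set.Icc (0 : ℝ) 1,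
      HasDerivAt (fun t : ℝ => c * (((n : ℝ) : ℂ) + t) ^ r)
        (c * r * (((n : ℝ) : ℂ) + t) ^ (r - 1)) t := by
    intro c r t ht
    rw [mul_assoc]
    exact (hasDerivAt_add_ofReal_cpow (hpos t ht) r).const_mul c
  have h := norm_corrected_trapezoid_le (M := 600 * (n : ℝ) ^ (-(3 / 2) : ℝ))
    (hd 1 (1 - s)) (hd _ _) (hd _ _) (hd _ _) (fun t ht => ?_)
  · refine le_trans (le_of_eq ?_) h
    congr 1
    simp only [eulerMaclaurinZeta, Finset.sum_range_succ]
    push_cast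
    rw [add_zero, show 1 - s - 1 = -s by ring]
    ring
  · rw [show 1 - s - 1 - 1 - 1 - 1 = -s - 3 by ring, norm_mul, ← Complex.ofReal_add,
      Complex.norm_cpow_eq_rpow_re_of_pos (hpos t ht)]
    have hre : (-s - 3).re = -s.re - 3 := by simp
    have hs1 : -(3 / 2) < s.re := hs.1
    have hs2 : ‖s‖ ≤ 4 := (mem_ball_zero_iff.1 hs.2).le
    rw [hre]
    have h1 : ((n : ℝ) + t) ^ (-s.re - 3) ≤ (n : ℝ) ^ (-(3 / 2) : ℝ) :=
      (Real.rpow_le_rpow_of_nonpos (by linarith) (by linarith [ht.1]) (by linarith)).trans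
        (Real.rpow_le_rpow_of_exponent_le hn1 (by linarith))
    refine mul_le_mul ?_ h1 (Real.rpow_nonneg (hpos t ht).le _) (by norm_num)
    rw [show 1 * (1 - s) * (1 - s - 1) * (1 - s - 1 - 1) * (1 - s - 1 - 1 - 1) =
      (1 - s) * s * (s + 1) * -(s + 2) by ring, norm_mul, norm_mul, norm_mul, norm_neg]
    have n1 : ‖1 - s‖ ≤ 5 := (norm_sub_le _ _).trans (by simp; linarith)
    have n2 : ‖s + 1‖ ≤ 5 := (norm_add_le _ _).trans (by simp; linarith)
    have n3 : ‖s + 2‖ ≤ 6 := (norm_add_le _ _).trans (by simp; linarith)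
    calc _ ≤ (5 : ℝ) * 4 * 5 * 6 := by gcongr
      _ = 600 := by norm_num

theorem hasDerivAt_natCast_cpow_neg {n : ℕ} (hn : n ≠ 0) (a s : ℂ) :
    HasDerivAt (fun s : ℂ => (n : ℂ) ^ (a - s)) (-(Complex.log n * (n : ℂ) ^ (a - s))) s := by
  have h := ((hasDerivAt_id s).const_sub a).const_cpow (c := (n : ℂ)) (Or.inl (by simpa using hn))
  refine h.congr_deriv ?_
  simp only [id]
  ring

theorem hasDerivAt_eulerMaclaurinZeta {n : ℕ} (hn : n ≠ 0) (s : ℂ) :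
    HasDerivAt (eulerMaclaurinZeta n)
      ((∑ k ∈ Finset.range n, ((k + 1 : ℕ) : ℂ) ^ (-s) - (n : ℂ) ^ (-s) / 2 +
        s / 12 * (n : ℂ) ^ (-s - 1)) +
      (s - 1) * (-∑ k ∈ Finset.range n, Complex.log (k + 1 : ℕ) * ((k + 1 : ℕ) : ℂ) ^ (-s) +
        Complex.log n * (n : ℂ) ^ (-s) / 2 +
        ((n : ℂ) ^ (-s - 1) / 12 - s / 12 * (Complex.log n * (n : ℂ) ^ (-s - 1)))) -
      Complex.log n * (n : ℂ) ^ (1 - s)) s := by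
  have h0 : ∀ {k : ℕ}, k ≠ 0 → HasDerivAt (fun s : ℂ => (k : ℂ) ^ (-s))
      (-(Complex.log k * (k : ℂ) ^ (-s))) s := by
    intro k hk
    simpa using hasDerivAt_natCast_cpow_neg hk 0 s
  have h1 : HasDerivAt (fun s : ℂ => (n : ℂ) ^ (-s - 1))
      (-(Complex.log n * (n : ℂ) ^ (-s - 1))) s := by
    simpa [sub_eq_add_neg, add_comm] using hasDerivAt_natCast_cpow_neg hn (-1) s
  have hsum := HasDerivAt.fun_sum (u := Finset.range n) fun k _ => h0 (Nat.succ_ne_zero k)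
  have e := ((((hasDerivAt_id s).sub_const 1).mul ((hsum.sub ((h0 hn).div_const 2)).add
    (((hasDerivAt_id s).div_const 12).mul h1))).add (hasDerivAt_natCast_cpow_neg hn 1 s))
  refine e.congr_deriv ?_
  simp only [id, Finset.sum_neg_distrib, Pi.add_apply, Pi.sub_apply, Pi.mul_apply]
  ring

/-- The entire function `(s - 1) ζ(s)`. -/
noncomputable def zetaNumerator : ℂ → ℂ := Function.update (fun s => (s - 1) * riemannZeta s) 1 1

theorem differentiable_zetaNumerator : Differentiable ℂ zetaNumerator := by
  intro s
  rcases eq_or_ne s 1 with rfl | hs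
  · refine (Complex.analyticAt_of_differentiable_on_punctured_nhds_of_continuousAt ?_ ?_).differentiableAt
    · filter_upwards [self_mem_nhdsWithin] with t ht
      refine DifferentiableAt.congr_of_eventuallyEq (f := fun s => (s - 1) * riemannZeta s) ?_ ?_
      · exact (by fun_prop : DifferentiableAt ℂ (fun s : ℂ => s - 1) t).mul
          (differentiableAt_riemannZeta ht)
      · filter_upwards [isOpen_ne.mem_nhds ht] with u hu
        exact Function.update_of_ne hu _ _
    · simpa only [zetaNumerator, continuousAt_update_same] using riemannZeta_residue_one
  · refine DifferentiableAt.congr_of_eventuallyEq (f := fun s => (s - 1) * riemannZeta s) ?_ ?_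
    · exact (by fun_prop : DifferentiableAt ℂ (fun s : ℂ => s - 1) s).mul
        (differentiableAt_riemannZeta hs)
    · filter_upwards [isOpen_ne.mem_nhds hs] with u hu
      exact Function.update_of_ne hu _ _

theorem tendsto_natCast_cpow_zero {a : ℂ} (ha : a.re < 0) :
    Tendsto (fun n : ℕ => (n : ℂ) ^ a) atTop (nhds 0) := by
  rw [tendsto_zero_iff_norm_tendsto_zero]
  have h := (tendsto_rpow_neg_atTop (y := -a.re) (by linarith)).comp
    (tendsto_natCast_atTop_atTop (R := ℝ))
  refine h.congr' ?_
  filter_upwards [eventually_gt_atTop 0] with n hn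
  rw [Complex.norm_natCast_cpow_of_pos hn]
  simp

theorem tendsto_eulerMaclaurinZeta_of_one_lt_re {s : ℂ} (hs : 1 < s.re) :
    Tendsto (fun n => eulerMaclaurinZeta n s) atTop (nhds (zetaNumerator s)) := by
  have h1 : s ≠ 1 := by rintro rfl; simp at hs
  have hsum : Summable fun n : ℕ => 1 / ((n : ℂ) + 1) ^ s := by
    have := (summable_nat_add_iff 1).2 (Complex.summable_one_div_nat_cpow.2 hs)
    exact_mod_cast this
  have h2 : Tendsto (fun n => ∑ k ∈ Finset.range n, ((k + 1 : ℕ) : ℂ) ^ (-s)) atTop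
      (nhds (riemannZeta s)) := by
    rw [zeta_eq_tsum_one_div_nat_add_one_cpow hs]
    refine hsum.hasSum.tendsto_sum_nat.congr fun n => Finset.sum_congr rfl fun k _ => ?_
    rw [Complex.cpow_neg, one_div]
    push_cast
    rfl
  have h3 := ((((h2.sub ((tendsto_natCast_cpow_zero (a := -s) (by simp; linarith)).div_const 2)).add
    ((tendsto_natCast_cpow_zero (a := -s - 1) (by simp; linarith)).const_mul (s / 12))).const_mul
    (s - 1)).add (tendsto_natCast_cpow_zero (a := 1 - s) (by simp; linarith)))
  rw [zetaNumerator, Function.update_of_ne h1]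
  simpa [eulerMaclaurinZeta] using h3

/-- The telescoping series converges uniformly on the region, so its sum is holomorphic and can be
differentiated termwise. The sum is known for `Re s > 1`, and the identity theorem carries it to
`-1`. -/
theorem tendsto_deriv_eulerMaclaurinZeta :
    Tendsto (fun n : ℕ => deriv (eulerMaclaurinZeta n) (-1)) atTop (nhds (deriv zetaNumerator (-1))) := by
  set U := eulerMaclaurinRegion with hU
  have hUo : IsOpen U := (isOpen_lt continuous_const Complex.continuous_re).inter Metric.isOpen_ball
  have hUc : Convex ℝ U := (convex_halfSpace_re_gt _).inter (convex_ball _ _)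
  let F : ℕ → ℂ → ℂ := fun i s => eulerMaclaurinZeta (i + 2) s - eulerMaclaurinZeta (i + 1) s
  let u : ℕ → ℝ := fun i => 600 * ((i + 1 : ℕ) : ℝ) ^ (-(3 / 2) : ℝ)
  have hu : Summable u := by
    have h := (summable_nat_add_iff 1).2 (Real.summable_nat_rpow.2 (by norm_num : (-(3 / 2) : ℝ) < -1))
    exact h.mul_left 600
  have hFd : ∀ i, Differentiable ℂ (F i) := fun i s =>
    (hasDerivAt_eulerMaclaurinZeta (Nat.succ_ne_zero _) s).differentiableAt.sub
      (hasDerivAt_eulerMaclaurinZeta (Nat.succ_ne_zero _) s).differentiableAt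
  have hFb : ∀ i s, s ∈ U → ‖F i s‖ ≤ u i := fun i s hs =>
    norm_eulerMaclaurinZeta_succ_sub_le (Nat.succ_le_succ (Nat.zero_le i)) hs
  have htel : ∀ n s, ∑ i ∈ Finset.range n, F i s =
      eulerMaclaurinZeta (n + 1) s - eulerMaclaurinZeta 1 s := fun n s =>
    Finset.sum_range_sub (fun i => eulerMaclaurinZeta (i + 1) s) n
  have hm1 : (-1 : ℂ) ∈ U := by
    constructor
    · simp; norm_num
    · simp
  have hderiv := Complex.hasSum_deriv_of_summable_norm hu (fun i => (hFd i).differentiableOn) hUo hFb hm1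
  have hdiff := Complex.differentiableOn_tsum_of_summable_norm hu (fun i => (hFd i).differentiableOn) hUo hFb
  have hT : ∀ s ∈ U, 1 < s.re → ∑' i, F i s = zetaNumerator s - eulerMaclaurinZeta 1 s := by
    intro s hs hre
    have hs' : Summable fun i => F i s := Summable.of_norm_bounded hu fun i => hFb i s hs
    refine tendsto_nhds_unique hs'.hasSum.tendsto_sum_nat ?_
    simp only [htel]
    exact ((tendsto_add_atTop_iff_nat 1).2 (tendsto_eulerMaclaurinZeta_of_one_lt_re hre)).sub_const _
  have hE1 : Differentiable ℂ (eulerMaclaurinZeta 1) := fun s =>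
    (hasDerivAt_eulerMaclaurinZeta one_ne_zero s).differentiableAt
  have hrhs : Differentiable ℂ fun s => zetaNumerator s - eulerMaclaurinZeta 1 s :=
    differentiable_zetaNumerator.sub hE1
  have h2 : (2 : ℂ) ∈ U := by
    constructor
    · simp; norm_num
    · simp; norm_num
  have heq : Set.EqOn (fun s => ∑' i, F i s) (fun s => zetaNumerator s - eulerMaclaurinZeta 1 s) U := by
    refine (hdiff.analyticOnNhd hUo).eqOn_of_preconnected_of_eventuallyEq
      (hrhs.differentiableOn.analyticOnNhd hUo) hUc.isPreconnected h2 ?_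
    filter_upwards [hUo.mem_nhds h2, (isOpen_lt continuous_const Complex.continuous_re).mem_nhds
      (by simp : (1 : ℝ) < (2 : ℂ).re)] with s hs hre
    exact hT s hs hre
  have hd2 : deriv (fun s => ∑' i, F i s) (-1) =
      deriv zetaNumerator (-1) - deriv (eulerMaclaurinZeta 1) (-1) := by
    rw [(heq.eventuallyEq_of_mem (hUo.mem_nhds hm1)).deriv_eq]
    exact deriv_sub (differentiable_zetaNumerator _) (hE1 _)
  rw [hd2] at hderiv
  have h3 := (hderiv.tendsto_sum_nat).add_const (deriv (eulerMaclaurinZeta 1) (-1))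
  rw [sub_add_cancel] at h3
  rw [← tendsto_add_atTop_iff_nat 1]
  refine h3.congr fun n => ?_
  have h4 : ∀ i, deriv (F i) (-1) =
      deriv (eulerMaclaurinZeta (i + 1 + 1)) (-1) - deriv (eulerMaclaurinZeta (i + 1)) (-1) := fun i =>
    deriv_sub (hasDerivAt_eulerMaclaurinZeta (Nat.succ_ne_zero _) _).differentiableAt
      (hasDerivAt_eulerMaclaurinZeta (Nat.succ_ne_zero _) _).differentiableAt
  simp only [h4]
  rw [Finset.sum_range_sub (fun i => deriv (eulerMaclaurinZeta (i + 1)) (-1)) n]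
  simp

/-- Differentiating the approximations at `-1` produces `∑ k log k` with its main terms. The limit
follows from `(d/ds)((s - 1)ζ(s)) = ζ(-1) - 2ζ'(-1)` at that point and `ζ(-1) = -1/12`. -/
theorem tendsto_sum_mul_log :
    Tendsto (fun n : ℕ => ∑ k ∈ Finset.range n, ((k + 1 : ℕ) : ℝ) * Real.log (k + 1 : ℕ) -
      ((n : ℝ) ^ 2 / 2 + n / 2 + 1 / 12) * Real.log n + (n : ℝ) ^ 2 / 4) atTop
      (nhds (1 / 12 - zetaDerivNegOne)) := by
  have hz : deriv zetaNumerator (-1) = riemannZeta (-1) - 2 * deriv riemannZeta (-1) := by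
    have h1 : zetaNumerator =ᶠ[nhds (-1)] fun s => (s - 1) * riemannZeta s := by
      filter_upwards [isOpen_ne.mem_nhds (by norm_num : (-1 : ℂ) ≠ 1)] with u hu
      exact Function.update_of_ne hu _ _
    have h2 := ((hasDerivAt_id (-1 : ℂ)).sub_const 1).mul
      (differentiableAt_riemannZeta (by norm_num : (-1 : ℂ) ≠ 1)).hasDerivAt
    rw [h1.deriv_eq]
    refine h2.deriv.trans ?_
    simp only [id]
    ring
  have hz1 : riemannZeta (-1) = -1 / 12 := by
    have h := riemannZeta_neg_nat_eq_bernoulli 1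
    norm_num [bernoulli_two] at h
    rw [h]
    norm_num
  have h := (Complex.continuous_re.tendsto _).comp tendsto_deriv_eulerMaclaurinZeta
  have h2 := (h.add_const (-(1 / 12 : ℝ))).div_const 2
  rw [hz, hz1] at h2
  have e : ((-1 / 12 - 2 * deriv riemannZeta (-1) : ℂ).re + -(1 / 12)) / 2 + 1 / 6 =
      1 / 12 - zetaDerivNegOne := by
    simp [zetaDerivNegOne]
    ring
  have h3 := h2.add_const (1 / 6)
  rw [e] at h3
  refine h3.congr' ?_
  filter_upwards [eventually_gt_atTop 0] with n hn
  simp only [Function.comp_apply]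
  rw [(hasDerivAt_eulerMaclaurinZeta hn.ne' (-1)).deriv]
  have e0 : (n : ℂ) ^ (-(-1 : ℂ) - 1) = 1 := by norm_num
  have e2 : (n : ℂ) ^ (1 - (-1) : ℂ) = (n : ℂ) ^ 2 := by norm_num
  rw [e0, e2]
  simp only [neg_neg, Complex.cpow_one]
  have hs : ∑ k ∈ Finset.range n, ((k + 1 : ℕ) : ℂ) = n * (n + 1) / 2 := by
    have := Finset.sum_range_id_mul_two (n + 1)
    rw [Finset.sum_range_succ'] at this
    have h' := congrArg (Nat.cast : ℕ → ℂ) this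
    push_cast at h' ⊢
    simp only [add_zero] at h'
    rw [eq_div_iff two_ne_zero, h']
    ring
  rw [hs]
  simp only [← Complex.natCast_log]
  have hfin : ((n : ℂ) * (n + 1) / 2 - n / 2 + -1 / 12 * 1 + (-1 - 1) *
      (-∑ k ∈ Finset.range n, ((Real.log (k + 1 : ℕ) : ℝ) : ℂ) * ((k + 1 : ℕ) : ℂ) +
        (Real.log n : ℝ) * n / 2 + (1 / 12 - -1 / 12 * ((Real.log n : ℝ) * 1))) -
      (Real.log n : ℝ) * (n : ℂ) ^ 2) =
      (((n : ℝ) * (n + 1) / 2 - n / 2 + -1 / 12 * 1 + (-1 - 1) *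
      (-∑ k ∈ Finset.range n, Real.log (k + 1 : ℕ) * ((k + 1 : ℕ) : ℝ) +
        Real.log n * n / 2 + (1 / 12 - -1 / 12 * (Real.log n * 1))) -
      Real.log n * (n : ℝ) ^ 2 : ℝ) : ℂ) := by
    push_cast
    ring
  rw [hfin, Complex.ofReal_re, Finset.sum_congr rfl fun k _ =>
    mul_comm (Real.log (k + 1 : ℕ)) ((k + 1 : ℕ) : ℝ)]
  ring

/-! ### Stirling expansions with error `O(n⁻²)` -/

/-- Turns a known limit into a rate: `K / k³ ≤ 2K / k² - 2K / (k + 1)²`, so the increments are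
dominated by a telescoping series. -/
theorem abs_sub_le_of_abs_succ_sub_le {b : ℕ → ℝ} {L K : ℝ} {n₀ : ℕ} (hn₀ : 1 ≤ n₀)
    (hb : Tendsto b atTop (nhds L)) (h : ∀ n, n₀ ≤ n → |b (n + 1) - b n| ≤ K / (n : ℝ) ^ 3)
    {n : ℕ} (hn : n₀ ≤ n) : |b n - L| ≤ 2 * K / (n : ℝ) ^ 2 := by
  have hK : 0 ≤ K := by
    have h1 := (abs_nonneg _).trans (h n₀ le_rfl)
    have h2 : (0 : ℝ) < n₀ := by exact_mod_cast hn₀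
    rw [le_div_iff₀ (by positivity)] at h1
    simpa using h1
  have hstep : ∀ k : ℕ, n₀ ≤ k →
      K / (k : ℝ) ^ 3 ≤ 2 * K / (k : ℝ) ^ 2 - 2 * K / ((k + 1 : ℕ) : ℝ) ^ 2 := by
    intro k hk
    have hk1 : (1 : ℝ) ≤ k := by exact_mod_cast hn₀.trans hk
    have e : 2 * K / (k : ℝ) ^ 2 - 2 * K / ((k + 1 : ℕ) : ℝ) ^ 2 - K / (k : ℝ) ^ 3 =
        K * (3 * (k : ℝ) ^ 2 - 1) / ((k : ℝ) ^ 3 * (k + 1) ^ 2) := by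
      push_cast
      field_simp
      ring
    have : 0 ≤ K * (3 * (k : ℝ) ^ 2 - 1) / ((k : ℝ) ^ 3 * (k + 1) ^ 2) := by
      refine div_nonneg (mul_nonneg hK ?_) (by positivity)
      nlinarith
    linarith
  have hind : ∀ j : ℕ, |b (n + j) - b n| ≤ 2 * K / (n : ℝ) ^ 2 - 2 * K / ((n + j : ℕ) : ℝ) ^ 2 := by
    intro j
    induction j with
    | zero => simp
    | succ j ih =>
      have h1 := h (n + j) (by omega)
      have h2 := hstep (n + j) (by omega)
      have h3 := abs_sub_le (b (n + j + 1)) (b (n + j)) (b n)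
      rw [← add_assoc]
      linarith
  have hlim : Tendsto (fun j => |b (n + j) - b n|) atTop (nhds |L - b n|) := by
    refine ((Tendsto.comp hb ?_).sub_const _).abs
    exact tendsto_atTop_mono (fun j => Nat.le_add_left j n) tendsto_id
  rw [abs_sub_comm]
  refine le_of_tendsto' hlim fun j => (hind j).trans ?_
  have : 0 ≤ 2 * K / ((n + j : ℕ) : ℝ) ^ 2 := by positivity
  linarith

theorem abs_log_one_add_sub_le {x : ℝ} (h0 : 0 ≤ x) (h1 : x ≤ 1 / 2) :
    |Real.log (1 + x) - (x - x ^ 2 / 2 + x ^ 3 / 3 - x ^ 4 / 4)| ≤ 2 * x ^ 5 := by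
  have h := Real.abs_log_sub_add_sum_range_le (x := -x) (by rw [abs_neg, abs_of_nonneg h0]; linarith) 4
  rw [abs_neg, abs_of_nonneg h0, sub_neg_eq_add] at h
  simp only [Finset.sum_range_succ, Finset.sum_range_zero] at h
  refine le_trans (le_of_eq ?_) (h.trans ?_)
  · congr 1
    push_cast
    ring
  · rw [div_le_iff₀ (by linarith)]
    have : 0 ≤ x ^ 5 * (1 - 2 * x) := mul_nonneg (by positivity) (by linarith)
    rw [show 4 + 1 = 5 from rfl]
    linarith

theorem log_add_one_sub_log {x : ℝ} (hx : 0 < x) (a : ℝ) (ha : 0 ≤ a) :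
    Real.log (x + a) = Real.log x + Real.log (1 + a * x⁻¹) := by
  rw [← Real.log_mul hx.ne' (by positivity)]
  congr 1
  field_simp

theorem abs_sum_mul_log_sub_le : ∃ K : ℝ, ∀ n : ℕ, 4 ≤ n →
    |(∑ k ∈ Finset.range n, ((k + 1 : ℕ) : ℝ) * Real.log (k + 1 : ℕ) -
      ((n : ℝ) ^ 2 / 2 + n / 2 + 1 / 12) * Real.log n + (n : ℝ) ^ 2 / 4) -
        (1 / 12 - zetaDerivNegOne)| ≤ K / (n : ℝ) ^ 2 := by
  refine ⟨2 * 3, fun n hn => abs_sub_le_of_abs_succ_sub_le (by norm_num) tendsto_sum_mul_log ?_ hn⟩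
  intro n hn
  have hn4 : (4 : ℝ) ≤ n := by exact_mod_cast hn
  have hn0 : (0 : ℝ) < n := by linarith
  set x : ℝ := (n : ℝ)⁻¹ with hx
  have hx0 : 0 < x := inv_pos.2 hn0
  have hx1 : x ≤ 1 / 4 := by
    rw [hx, inv_le_comm₀ hn0 (by norm_num)]; simpa using hn4
  have hlog := abs_log_one_add_sub_le hx0.le (by linarith)
  have hl := log_add_one_sub_log hn0 1 zero_le_one
  rw [one_mul, ← hx] at hl
  have hnx : (n : ℝ) = x⁻¹ := by rw [hx, inv_inv]
  set r := Real.log (1 + x) - (x - x ^ 2 / 2 + x ^ 3 / 3 - x ^ 4 / 4) with hr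
  have hl2 : Real.log (1 + x) = (x - x ^ 2 / 2 + x ^ 3 / 3 - x ^ 4 / 4) + r := by rw [hr]; ring
  -- With `x = 1/n` and the fourth-order expansion of `log (1 + x)`, all terms below `x ^ 3` cancel,
  -- as do the terms in `log n`.
  have e : (∑ k ∈ Finset.range (n + 1), ((k + 1 : ℕ) : ℝ) * Real.log (k + 1 : ℕ) -
      (((n + 1 : ℕ) : ℝ) ^ 2 / 2 + (n + 1 : ℕ) / 2 + 1 / 12) * Real.log (n + 1 : ℕ) +
        ((n + 1 : ℕ) : ℝ) ^ 2 / 4) -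
      (∑ k ∈ Finset.range n, ((k + 1 : ℕ) : ℝ) * Real.log (k + 1 : ℕ) -
      ((n : ℝ) ^ 2 / 2 + n / 2 + 1 / 12) * Real.log n + (n : ℝ) ^ 2 / 4) =
      7 / 72 * x ^ 3 + x ^ 4 / 48 - (x⁻¹ ^ 2 / 2 + x⁻¹ / 2 + 1 / 12) * r := by
    rw [Finset.sum_range_succ]
    push_cast
    rw [hl, hl2]
    generalize Real.log (n : ℝ) = l
    rw [hnx]
    field_simp
    ring
  refine (congrArg abs e).le.trans ?_
  rw [show (3 : ℝ) / (n : ℝ) ^ 3 = 3 * x ^ 3 by rw [hx, inv_pow, div_eq_mul_inv]]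
  have hc : |(x⁻¹ ^ 2 / 2 + x⁻¹ / 2 + 1 / 12) * r| ≤ x ^ 3 + x ^ 4 + x ^ 5 / 6 := by
    rw [abs_mul, abs_of_nonneg (by positivity)]
    refine (mul_le_mul_of_nonneg_left hlog (by positivity)).trans (le_of_eq ?_)
    field_simp
    ring
  have h3 : 0 < x ^ 3 := by positivity
  have h4 : x ^ 4 ≤ x ^ 3 := pow_le_pow_of_le_one hx0.le (by linarith) (by norm_num)
  have h5 : x ^ 5 ≤ x ^ 3 := pow_le_pow_of_le_one hx0.le (by linarith) (by norm_num)
  have h4' : 0 < x ^ 4 := by positivity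
  rw [abs_le] at hc ⊢
  constructor <;> linarith [hc.1, hc.2]

theorem tendsto_log_factorial :
    Tendsto (fun n : ℕ => Real.log (n.factorial) - ((n : ℝ) + 1 / 2) * Real.log n + n) atTop
      (nhds (Real.log (2 * Real.pi) / 2)) := by
  have h := ((Real.continuousAt_log (Real.sqrt_pos.2 Real.pi_pos).ne').tendsto.comp
    Stirling.tendsto_stirlingSeq_sqrt_pi).add_const (Real.log 2 / 2)
  rw [Real.log_sqrt Real.pi_pos.le] at h
  have e : Real.log Real.pi / 2 + Real.log 2 / 2 = Real.log (2 * Real.pi) / 2 := by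
    rw [Real.log_mul two_ne_zero Real.pi_pos.ne']; ring
  rw [e] at h
  refine h.congr' ?_
  filter_upwards [eventually_gt_atTop 0] with n hn
  have hn0 : (n : ℝ) ≠ 0 := by exact_mod_cast hn.ne'
  rw [Function.comp_apply, Stirling.log_stirlingSeq_formula, Real.log_mul two_ne_zero hn0,
    Real.log_div hn0 (Real.exp_ne_zero 1), Real.log_exp]
  ring

/-- The term `1/(12n)` is kept because `log n!` enters `log P_n` multiplied by `n`, so it
contributes to the constant. -/
theorem abs_log_factorial_sub_le : ∃ K : ℝ, ∀ n : ℕ, 4 ≤ n →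
    |(Real.log (n.factorial) - ((n : ℝ) + 1 / 2) * Real.log n + n - (n : ℝ)⁻¹ / 12) -
        Real.log (2 * Real.pi) / 2| ≤ K / (n : ℝ) ^ 2 := by
  have hlim := tendsto_log_factorial.sub ((tendsto_inv_atTop_nhds_zero_nat (𝕜 := ℝ)).div_const 12)
  rw [zero_div, sub_zero] at hlim
  refine ⟨2 * 4, fun n hn => abs_sub_le_of_abs_succ_sub_le (by norm_num) hlim ?_ hn⟩
  intro n hn
  have hn4 : (4 : ℝ) ≤ n := by exact_mod_cast hn
  have hn0 : (0 : ℝ) < n := by linarith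
  set x : ℝ := (n : ℝ)⁻¹ with hx
  have hx0 : 0 < x := inv_pos.2 hn0
  have hx1 : x ≤ 1 / 4 := by
    rw [hx, inv_le_comm₀ hn0 (by norm_num)]; simpa using hn4
  have hlog := abs_log_one_add_sub_le hx0.le (by linarith)
  have hl := log_add_one_sub_log hn0 1 zero_le_one
  rw [one_mul, ← hx] at hl
  have hnx : (n : ℝ) = x⁻¹ := by rw [hx, inv_inv]
  set r := Real.log (1 + x) - (x - x ^ 2 / 2 + x ^ 3 / 3 - x ^ 4 / 4) with hr
  have hl2 : Real.log (1 + x) = (x - x ^ 2 / 2 + x ^ 3 / 3 - x ^ 4 / 4) + r := by rw [hr]; ring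
  have hinv : ((n + 1 : ℕ) : ℝ)⁻¹ = x - x ^ 2 + x ^ 3 / (1 + x) := by
    push_cast
    rw [hnx]
    field_simp
    ring
  have e : (Real.log ((n + 1).factorial) - (((n + 1 : ℕ) : ℝ) + 1 / 2) * Real.log (n + 1 : ℕ) +
      (n + 1 : ℕ) - ((n + 1 : ℕ) : ℝ)⁻¹ / 12) -
      (Real.log (n.factorial) - ((n : ℝ) + 1 / 2) * Real.log n + n - x / 12) =
      x ^ 3 / 12 + x ^ 4 / 8 - x ^ 3 / (1 + x) / 12 - (x⁻¹ + 1 / 2) * r := by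
    rw [hinv, Nat.factorial_succ, Nat.cast_mul, Real.log_mul (by positivity) (by positivity)]
    push_cast
    rw [hl, hl2]
    generalize Real.log (n : ℝ) = l
    rw [hnx]
    field_simp
    ring
  refine (congrArg abs e).le.trans ?_
  rw [show (4 : ℝ) / (n : ℝ) ^ 3 = 4 * x ^ 3 by rw [hx, inv_pow, div_eq_mul_inv]]
  have hc : |(x⁻¹ + 1 / 2) * r| ≤ 2 * x ^ 4 + x ^ 5 := by
    rw [abs_mul, abs_of_nonneg (by positivity)]
    refine (mul_le_mul_of_nonneg_left hlog (by positivity)).trans (le_of_eq ?_)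
    field_simp
  have h3 : 0 < x ^ 3 := by positivity
  have h4 : x ^ 4 ≤ x ^ 3 := pow_le_pow_of_le_one hx0.le (by linarith) (by norm_num)
  have h5 : x ^ 5 ≤ x ^ 3 := pow_le_pow_of_le_one hx0.le (by linarith) (by norm_num)
  have h4' : 0 < x ^ 4 := by positivity
  have h6 : 0 ≤ x ^ 3 / (1 + x) := by positivity
  have h7 : x ^ 3 / (1 + x) ≤ x ^ 3 := div_le_self h3.le (by linarith)
  rw [abs_le] at hc ⊢
  constructor <;> linarith [hc.1, hc.2]

/-- The remainder in Stirling's formula for the Gamma function at half-integers. -/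
noncomputable def gammaRemainder (n : ℕ) : ℝ :=
  Real.log (Real.Gamma (((n : ℝ) + 1) / 2)) - (n : ℝ) / 2 * Real.log ((n : ℝ) / 2) + (n : ℝ) / 2 +
    (n : ℝ)⁻¹ / 12

/-- Increments of two in `n` correspond to `Γ(z + 1) = zΓ(z)` at `z = (n + 1) / 2`; the two parities
are therefore treated as separate sequences. -/
theorem abs_gammaRemainder_add_two_sub_le {n : ℕ} (hn : 4 ≤ n) :
    |gammaRemainder (n + 2) - gammaRemainder n| ≤ 200 / (n : ℝ) ^ 3 := by
  have hn4 : (4 : ℝ) ≤ n := by exact_mod_cast hn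
  have hn0 : (0 : ℝ) < n := by linarith
  set x : ℝ := (n : ℝ)⁻¹ with hx
  have hx0 : 0 < x := inv_pos.2 hn0
  have hx1 : x ≤ 1 / 4 := by
    rw [hx, inv_le_comm₀ hn0 (by norm_num)]; simpa using hn4
  have hlog := abs_log_one_add_sub_le hx0.le (by linarith)
  have hlog2 := abs_log_one_add_sub_le (x := 2 * x) (by positivity) (by linarith)
  have hl := log_add_one_sub_log hn0 1 zero_le_one
  have hl2 := log_add_one_sub_log hn0 2 zero_le_two
  rw [one_mul, ← hx] at hl
  rw [← hx] at hl2
  have hnx : (n : ℝ) = x⁻¹ := by rw [hx, inv_inv]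
  set r := Real.log (1 + x) - (x - x ^ 2 / 2 + x ^ 3 / 3 - x ^ 4 / 4) with hr
  set q := Real.log (1 + 2 * x) - ((2 * x) - (2 * x) ^ 2 / 2 + (2 * x) ^ 3 / 3 - (2 * x) ^ 4 / 4)
    with hq
  have hr2 : Real.log (1 + x) = (x - x ^ 2 / 2 + x ^ 3 / 3 - x ^ 4 / 4) + r := by rw [hr]; ring
  have hq2 : Real.log (1 + 2 * x) =
      ((2 * x) - (2 * x) ^ 2 / 2 + (2 * x) ^ 3 / 3 - (2 * x) ^ 4 / 4) + q := by rw [hq]; ring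
  have hinv : ((n : ℝ) + 2)⁻¹ = x - 2 * x ^ 2 + 4 * x ^ 3 / (1 + 2 * x) := by
    rw [hnx]
    field_simp
    ring
  have hΓ : Real.log (Real.Gamma (((n : ℝ) + 2 + 1) / 2)) =
      Real.log ((n : ℝ) + 1) - Real.log 2 + Real.log (Real.Gamma (((n : ℝ) + 1) / 2)) := by
    rw [show ((n : ℝ) + 2 + 1) / 2 = ((n : ℝ) + 1) / 2 + 1 by ring,
      Real.Gamma_add_one (by positivity), Real.log_mul (by positivity)
      (Real.Gamma_pos_of_pos (by positivity)).ne', Real.log_div (by positivity) two_ne_zero]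
  have e : gammaRemainder (n + 2) - gammaRemainder n =
      -x ^ 3 / 3 + 15 / 4 * x ^ 4 + x ^ 3 / (1 + 2 * x) / 3 + r - (x⁻¹ / 2 + 1) * q := by
    unfold gammaRemainder
    push_cast
    rw [hΓ, hinv, Real.log_div (x := (n : ℝ) + 2) (by positivity) two_ne_zero,
      Real.log_div hn0.ne' two_ne_zero, hl, hl2, hr2, hq2, ← hx]
    generalize Real.log (n : ℝ) = l
    generalize Real.log (Real.Gamma (((n : ℝ) + 1) / 2)) = g
    generalize Real.log 2 = l2
    rw [hnx]
    field_simp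
    ring
  refine (congrArg abs e).le.trans ?_
  rw [show (200 : ℝ) / (n : ℝ) ^ 3 = 200 * x ^ 3 by rw [hx, inv_pow, div_eq_mul_inv]]
  have hc : |(x⁻¹ / 2 + 1) * q| ≤ 32 * x ^ 4 + 64 * x ^ 5 := by
    rw [abs_mul, abs_of_nonneg (by positivity)]
    refine (mul_le_mul_of_nonneg_left hlog2 (by positivity)).trans (le_of_eq ?_)
    field_simp
    ring
  have h3 : 0 < x ^ 3 := by positivity
  have h4 : x ^ 4 ≤ x ^ 3 := pow_le_pow_of_le_one hx0.le (by linarith) (by norm_num)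
  have h5 : x ^ 5 ≤ x ^ 3 := pow_le_pow_of_le_one hx0.le (by linarith) (by norm_num)
  have h4' : 0 < x ^ 4 := by positivity
  have h6 : 0 ≤ x ^ 3 / (1 + 2 * x) := by positivity
  have h7 : x ^ 3 / (1 + 2 * x) ≤ x ^ 3 := div_le_self h3.le (by linarith)
  rw [abs_le] at hc hlog ⊢
  constructor <;> linarith [hc.1, hc.2, hlog.1, hlog.2]

/-- For odd `n = 2m + 1` the Gamma value is `m!`, and Stirling's formula applies after recentring
the logarithm from `m` to `m + 1 / 2`. -/
theorem tendsto_gammaRemainder_odd :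
    Tendsto (fun m : ℕ => gammaRemainder (2 * m + 1)) atTop (nhds (Real.log (2 * Real.pi) / 2)) := by
  have h1 := (Real.tendsto_mul_log_one_add_div_atTop (1 / 2)).comp
    (tendsto_natCast_atTop_atTop (R := ℝ))
  have hinv := tendsto_inv_atTop_nhds_zero_nat (𝕜 := ℝ)
  have h2 : Tendsto (fun m : ℕ => Real.log (1 + 1 / 2 / (m : ℝ))) atTop (nhds 0) := by
    have h := (hinv.const_mul (1 / 2)).const_add 1
    rw [mul_zero, add_zero] at h
    have h' := (Real.continuousAt_log one_ne_zero).tendsto.comp h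
    rw [Real.log_one] at h'
    refine h'.congr fun m => ?_
    simp [div_eq_mul_inv]
  have h3 : Tendsto (fun m : ℕ => ((2 * m + 1 : ℕ) : ℝ)⁻¹ / 12) atTop (nhds 0) := by
    have h := (hinv.comp (tendsto_atTop_mono (fun m : ℕ => (by omega : m ≤ 2 * m + 1))
      tendsto_id)).div_const 12
    rw [zero_div] at h
    exact h
  have h := (((tendsto_log_factorial.sub h1).sub (h2.div_const 2)).add_const (1 / 2)).add h3
  rw [show Real.log (2 * Real.pi) / 2 - 1 / 2 - 0 / 2 + 1 / 2 + 0 =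
    Real.log (2 * Real.pi) / 2 by ring] at h
  refine h.congr' ?_
  filter_upwards [eventually_gt_atTop 0] with m hm
  have hm0 : (0 : ℝ) < m := by exact_mod_cast hm
  have e1 : (((2 * m + 1 : ℕ) : ℝ) + 1) / 2 = m + 1 := by push_cast; ring
  have e2 : ((2 * m + 1 : ℕ) : ℝ) / 2 = m + 1 / 2 := by push_cast; ring
  have e3 : Real.log ((m : ℝ) + 1 / 2) = Real.log m + Real.log (1 + 1 / 2 / (m : ℝ)) := by
    rw [log_add_one_sub_log hm0 (1 / 2) (by norm_num)]
    rfl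
  rw [gammaRemainder, e1, e2, e3, Real.Gamma_nat_eq_factorial, Function.comp_apply]
  ring

/-- For `n = 2m` the duplication formula expresses `Γ(m + 1/2)` through `(2m)!` and `m!`; the two
Stirling limits cancel, and the constant comes from that formula. -/
theorem tendsto_gammaRemainder_even :
    Tendsto (fun m : ℕ => gammaRemainder (2 * m)) atTop (nhds (Real.log (2 * Real.pi) / 2)) := by
  have hinv := tendsto_inv_atTop_nhds_zero_nat (𝕜 := ℝ)
  have ht : Tendsto (fun m : ℕ => 2 * m) atTop atTop :=
    tendsto_atTop_mono (fun m : ℕ => (by omega : m ≤ 2 * m)) tendsto_id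
  have h := (((tendsto_log_factorial.comp ht).sub tendsto_log_factorial).add_const
    (Real.log (2 * Real.pi) / 2)).add ((hinv.comp ht).div_const 12)
  rw [sub_self, zero_add, zero_div, add_zero] at h
  refine h.congr' ?_
  filter_upwards [eventually_gt_atTop 0] with m hm
  have hm0 : (0 : ℝ) < m := by exact_mod_cast hm
  have hdup := Real.Gamma_mul_Gamma_add_half ((m : ℝ) + 1 / 2)
  rw [show (m : ℝ) + 1 / 2 + 1 / 2 = m + 1 by ring,
    show 2 * ((m : ℝ) + 1 / 2) = ((2 * m : ℕ) : ℝ) + 1 by push_cast; ring,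
    Real.Gamma_nat_eq_factorial, Real.Gamma_nat_eq_factorial] at hdup
  have hG : 0 < Real.Gamma ((m : ℝ) + 1 / 2) := Real.Gamma_pos_of_pos (by positivity)
  have hlog := congrArg Real.log hdup
  rw [Real.log_mul hG.ne' (by positivity), Real.log_mul (by positivity) (by positivity),
    Real.log_mul (by positivity) (by positivity), Real.log_rpow two_pos,
    Real.log_sqrt Real.pi_pos.le] at hlog
  have e1 : (((2 * m : ℕ) : ℝ) + 1) / 2 = m + 1 / 2 := by push_cast; ring
  have e2 : ((2 * m : ℕ) : ℝ) / 2 = m := by push_cast; ring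
  have e3 : Real.log ((2 * m : ℕ) : ℝ) = Real.log 2 + Real.log m := by
    push_cast
    exact Real.log_mul two_ne_zero hm0.ne'
  simp only [Function.comp_apply]
  rw [gammaRemainder, e1, e2, e3, Real.log_mul two_ne_zero Real.pi_pos.ne']
  push_cast at hlog ⊢
  linear_combination -hlog

theorem abs_gammaRemainder_sub_le : ∃ K : ℝ, ∀ n : ℕ, 8 ≤ n →
    |gammaRemainder n - Real.log (2 * Real.pi) / 2| ≤ K / (n : ℝ) ^ 2 := by
  have hmono : ∀ m k : ℕ, 4 ≤ m → m ≤ k → (200 : ℝ) / (k : ℝ) ^ 3 ≤ 200 / (m : ℝ) ^ 3 := by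
    intro m k hm hk
    have h1 : (0 : ℝ) < m := by exact_mod_cast (by omega : 0 < m)
    have h2 : (m : ℝ) ≤ k := by exact_mod_cast hk
    gcongr
  have heven : ∀ m : ℕ, 4 ≤ m →
      |gammaRemainder (2 * m) - Real.log (2 * Real.pi) / 2| ≤ 2 * 200 / (m : ℝ) ^ 2 := by
    intro m hm
    refine abs_sub_le_of_abs_succ_sub_le (b := fun m => gammaRemainder (2 * m)) (n₀ := 4)
      (by norm_num) tendsto_gammaRemainder_even (fun k hk => ?_) hm
    exact (abs_gammaRemainder_add_two_sub_le (n := 2 * k) (by omega)).trans (hmono k (2 * k) hk (Nat.le_mul_of_pos_left k two_pos))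
  have hodd : ∀ m : ℕ, 4 ≤ m →
      |gammaRemainder (2 * m + 1) - Real.log (2 * Real.pi) / 2| ≤ 2 * 200 / (m : ℝ) ^ 2 := by
    intro m hm
    refine abs_sub_le_of_abs_succ_sub_le (b := fun m => gammaRemainder (2 * m + 1)) (n₀ := 4)
      (by norm_num) tendsto_gammaRemainder_odd (fun k hk => ?_) hm
    exact (abs_gammaRemainder_add_two_sub_le (n := 2 * k + 1) (by omega)).trans
      (hmono k (2 * k + 1) hk (by omega))
  -- From `n ≤ 2m + 1 ≤ 3m` one gets `400 / m² ≤ 3600 / n²`.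
  refine ⟨3600, fun n hn => ?_⟩
  obtain ⟨m, hm | hm⟩ : ∃ m, n = 2 * m ∨ n = 2 * m + 1 := ⟨n / 2, by omega⟩
  all_goals
    have hm4 : 4 ≤ m := by omega
    have hm0 : (4 : ℝ) ≤ m := by exact_mod_cast hm4
    subst hm
  · refine (heven m hm4).trans ?_
    rw [div_le_div_iff₀ (by positivity) (by positivity)]
    push_cast
    nlinarith
  · refine (hodd m hm4).trans ?_
    rw [div_le_div_iff₀ (by positivity) (by positivity)]
    push_cast
    nlinarith

/-! ### Assembling the asymptotics -/

theorem sum_log_factorial (n : ℕ) :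
    ∑ j ∈ Finset.range n, Real.log (j.factorial) = n * Real.log (n.factorial) -
      ∑ k ∈ Finset.range n, ((k + 1 : ℕ) : ℝ) * Real.log (k + 1 : ℕ) := by
  induction n with
  | zero => simp
  | succ n ih =>
    rw [Finset.sum_range_succ, Finset.sum_range_succ, ih, Nat.factorial_succ, Nat.cast_mul,
      Real.log_mul (by positivity) (by positivity)]
    push_cast
    ring

theorem rankProb_pos (n : ℕ) : 0 < rankProb n := by
  rw [rankProb_eq_gamma]
  exact div_pos (pow_pos (Real.Gamma_pos_of_pos (by positivity)) n)
    (Finset.prod_pos fun j _ => by positivity)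

theorem log_rankProb (n : ℕ) :
    Real.log (rankProb n) = n * Real.log (Real.Gamma (((n : ℝ) + 1) / 2)) -
      n * Real.log (n.factorial) +
      ∑ k ∈ Finset.range n, ((k + 1 : ℕ) : ℝ) * Real.log (k + 1 : ℕ) := by
  rw [rankProb_eq_gamma, Real.log_div
    (pow_pos (Real.Gamma_pos_of_pos (by positivity)) n).ne'
    (Finset.prod_pos fun j _ => by positivity).ne', Real.log_pow,
    Real.log_prod fun j _ => by positivity, sum_log_factorial]
  ring

/-- The constants `log (2π) / 2` cancel. Each of the two terms `1/(12n)`, multiplied by `n`,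
contributes `-1/12`; together with `1/12 - ζ'(-1)` this gives the constant `-1/12 - ζ'(-1)`. The
remainder is `n * c - n * b + a` with all three of `a`, `b`, `c` of order `n⁻²`. -/
theorem log_rankProb_isBigO :
    (fun N : ℕ => Real.log (rankProb N) -
        ((N : ℝ) ^ 2 / 4 * Real.log (Real.exp 1 / 4) + (Real.log (N : ℝ) - 1) / 12
          - zetaDerivNegOne)) =O[atTop] (fun N : ℕ => 1 / (N : ℝ)) := by
  obtain ⟨K₁, h₁⟩ := abs_sum_mul_log_sub_le
  obtain ⟨K₂, h₂⟩ := abs_log_factorial_sub_le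
  obtain ⟨K₃, h₃⟩ := abs_gammaRemainder_sub_le
  refine IsBigO.of_bound (|K₁| + |K₂| + |K₃|) ?_
  filter_upwards [eventually_ge_atTop 8] with n hn
  have hn1 : (1 : ℝ) ≤ n := by exact_mod_cast (by omega : 1 ≤ n)
  have hn0 : (0 : ℝ) < n := by linarith
  have b₁ := h₁ n (by omega)
  have b₂ := h₂ n (by omega)
  have b₃ := h₃ n hn
  set a := (∑ k ∈ Finset.range n, ((k + 1 : ℕ) : ℝ) * Real.log (k + 1 : ℕ) -
      ((n : ℝ) ^ 2 / 2 + n / 2 + 1 / 12) * Real.log n + (n : ℝ) ^ 2 / 4) -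
        (1 / 12 - zetaDerivNegOne) with ha
  set b := (Real.log (n.factorial) - ((n : ℝ) + 1 / 2) * Real.log n + n - (n : ℝ)⁻¹ / 12) -
        Real.log (2 * Real.pi) / 2 with hb
  set c := gammaRemainder n - Real.log (2 * Real.pi) / 2 with hc
  have hlog4 : Real.log (Real.exp 1 / 4) = 1 - 2 * Real.log 2 := by
    rw [Real.log_div (Real.exp_ne_zero _) (by norm_num), Real.log_exp,
      show (4 : ℝ) = 2 ^ 2 by norm_num, Real.log_pow]
    norm_num
  have e : Real.log (rankProb n) -
        ((n : ℝ) ^ 2 / 4 * Real.log (Real.exp 1 / 4) + (Real.log (n : ℝ) - 1) / 12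
          - zetaDerivNegOne) = n * c - n * b + a := by
    rw [log_rankProb, ha, hb, hc, gammaRemainder, hlog4, Real.log_div hn0.ne' two_ne_zero]
    field_simp
    ring
  rw [e, Real.norm_eq_abs, Real.norm_of_nonneg (by positivity)]
  have t1 : |(n : ℝ) * c| ≤ |K₃| * (1 / n) := by
    rw [abs_mul, abs_of_pos hn0]
    refine (mul_le_mul_of_nonneg_left (b₃.trans (div_le_div_of_nonneg_right (le_abs_self K₃)
      (by positivity))) hn0.le).trans (le_of_eq ?_)
    field_simp
  have t2 : |(n : ℝ) * b| ≤ |K₂| * (1 / n) := by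
    rw [abs_mul, abs_of_pos hn0]
    refine (mul_le_mul_of_nonneg_left (b₂.trans (div_le_div_of_nonneg_right (le_abs_self K₂)
      (by positivity))) hn0.le).trans (le_of_eq ?_)
    field_simp
  have t3 : |a| ≤ |K₁| * (1 / n) := by
    refine b₁.trans ((div_le_div_of_nonneg_right (le_abs_self K₁) (by positivity)).trans ?_)
    rw [mul_one_div]
    exact div_le_div_of_nonneg_left (abs_nonneg _) hn0 (by nlinarith)
  calc |(n : ℝ) * c - n * b + a| ≤ |(n : ℝ) * c| + |(n : ℝ) * b| + |a| :=
        (abs_add_le _ _).trans (add_le_add_left (abs_sub _ _) _)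
    _ ≤ _ := by linarith

theorem isBigO_exp_sub_one {f : ℕ → ℝ} (hf : f =O[atTop] fun N : ℕ => 1 / (N : ℝ)) :
    (fun N => Real.exp (f N) - 1) =O[atTop] fun N : ℕ => 1 / (N : ℝ) := by
  have h0 : Tendsto f atTop (nhds 0) :=
    hf.trans_tendsto tendsto_one_div_atTop_nhds_zero_nat
  have h1 : (fun x : ℝ => Real.exp x - 1) =O[nhds 0] fun x => x := by
    have := (Real.hasDerivAt_exp 0).differentiableAt.isBigO_sub
    simpa using this
  exact (h1.comp_tendsto h0).trans hf

theorem theorem4 :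
    (∃ ε : ℕ → ℝ, ε =O[atTop] (fun N : ℕ => 1 / (N : ℝ)) ∧
      ∀ N : ℕ, 1 ≤ N →
        rankProb N = (N : ℝ) ^ (1 / 12 : ℝ) * (Real.exp 1 / 4) ^ ((N : ℝ) ^ 2 / 4) *
          (glaisherKinkelin * Real.exp (-1 / 6)) * (1 + ε N)) ∧
    (fun N : ℕ => Real.log (rankProb N) -
        ((N : ℝ) ^ 2 / 4 * Real.log (Real.exp 1 / 4) + (Real.log (N : ℝ) - 1) / 12
          - zetaDerivNegOne)) =O[atTop] (fun N : ℕ => 1 / (N : ℝ)) := by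
  -- Here `1 + ε N` is the exponential of the logarithmic remainder, so the product formula is an
  -- exact identity for every `N ≥ 1`.
  refine ⟨⟨_, isBigO_exp_sub_one log_rankProb_isBigO, fun N hN => ?_⟩, log_rankProb_isBigO⟩
  have hN0 : (0 : ℝ) < N := by exact_mod_cast hN
  rw [add_sub_cancel, Real.exp_sub, Real.exp_log (rankProb_pos N), Real.rpow_def_of_pos hN0,
    Real.rpow_def_of_pos (by positivity), glaisherKinkelin, ← Real.exp_add, ← Real.exp_add,
    ← Real.exp_add]
  rw [show Real.log (N : ℝ) * (1 / 12) + Real.log (Real.exp 1 / 4) * ((N : ℝ) ^ 2 / 4) +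
    (-zetaDerivNegOne + 1 / 12 + -1 / 6) = (N : ℝ) ^ 2 / 4 * Real.log (Real.exp 1 / 4) +
      (Real.log (N : ℝ) - 1) / 12 - zetaDerivNegOne by ring]
  rw [mul_div_cancel₀ _ (Real.exp_ne_zero _)]
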